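/- **Bin packing.** An input is a finite sequence $I$ of items with rational sizes in $(0,1]$. A packing partitions the items into bins of total size at most $1$; $OPT(I)$ is the minimum number of bins. An online algorithm packs each item irrevocably before the next one arrives. We consider the following online algorithm AH (Advanced Harmonic), and write $AH(I)$ for its number of (nonempty) bins after all of $I$ has been packed. **Theorem.** There is a constant $C\ge 0$ such that for every input $I$, and for every way of resolving the choices that AH leaves arbitrary, $$AH(I)\le \frac{10060574276093395247}{6374352691333693440}\cdot OPT(I)+C .$$ In particular the asymptotic competitive ratio $\lim_{N\to\infty}\ \sup_{I:\,OPT(I)\ge N}\frac{AH(I)}{OPT(I)}$ of AH (with the supremum also over those choices) is at most $1.57828956$. **Parameters of AH.** The boundary points $1=t_0>t_1>\dots>t_{211}>t_{212}=0$ are $t_1=\frac12$, $t_2=\frac37$, $t_3=\frac{43}{120}$, $t_4=\frac{59}{166}$, $t_j=\frac7{20}-\frac{j-5}{9600}$ for $5\le j\le 165$ (so $t_{165}=\frac13$), $t_{166}=\frac{271}{960}$, $t_{167}=\frac14$, $t_{168}=\frac{97}{480}$, $t_{169}=\frac15$, $t_{170}=\frac{15}{88}$, $t_{171}=\frac16$,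 $t_{172}=\frac3{20}$, $t_{173}=\frac{12}{83}$, $t_{174}=\frac17$, $t_{175}=\frac{11}{83}$, and $t_j=\frac1{j-168}$ for $176\le j\le 211$ (so $t_{211}=\frac1{43}$). Items of size in $(t_j,t_{j-1}]$ form class $j$. Class $1$ is huge, classes $2,\dots,165$ are large, classes $166,\dots,211$ are small, class $212$ is tiny. The proportions $\alpha_{ij}$ are zero except for the following. - $j=2$: $\alpha_{2,2}=1$ - $j=3$: $\alpha_{1,3}=\frac{31755722}{150095589}$, $\alpha_{2,3}=\frac{118339867}{150095589}$ - $j=4$: $\alpha_{1,4}=\frac{33382666}{150909061}$, $\alpha_{2,4}=\frac{117526395}{150909061}$ - $j=5$: $\alpha_{1,5}=\frac{4493270}{19023851}$, $\alpha_{2,5}=\frac{14530581}{19023851}$ - $j=166$: $\alpha_{1,166}=\frac{3445801}{1433952966}$, $\alpha_{3,166}=\frac{1430507165}{1433952966}$ - $j=167$: $\alpha_{1,167}=\frac{18718929}{79588150}$, $\alpha_{3,167}=\frac{60869221}{79588150}$ - $j=168$: $\alpha_{1,168}=\frac{10193524}{41199575}$, $\alpha_{4,168}=\frac{31006051}{41199575}$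 - $j=169$: $\alpha_{1,169}=\frac{22658284}{84102577}$, $\alpha_{4,169}=\frac{61444293}{84102577}$ - $j=170$: $\alpha_{5,170}=1$ - $j=171$: $\alpha_{1,171}=\frac{76872685}{1135239972}$, $\alpha_{5,171}=\frac{1058367287}{1135239972}$ - $j=172$: $\alpha_{1,172}=\frac{48313566}{191010959}$, $\alpha_{2,172}=\frac{24797889}{191010959}$, $\alpha_{6,172}=\frac{117899504}{191010959}$ - $j=173$: $\alpha_{1,173}=\frac{20946010}{480752651}$, $\alpha_{2,173}=\frac{158075552}{480752651}$, $\alpha_{6,173}=\frac{301731089}{480752651}$ - $j=174$: $\alpha_{2,174}=\frac{5682641}{14973238}$, $\alpha_{6,174}=\frac{9290597}{14973238}$ - $j=175$: $\alpha_{1,175}=\frac{103268403}{85455946430}$, $\alpha_{2,175}=\frac{11653567744}{42727973215}$, $\alpha_{7,175}=\frac{62045542539}{85455946430}$ - $j=176$: $\alpha_{2,176}=\frac{4313813}{11469903}$, $\alpha_{7,176}=\frac{7156090}{11469903}$ - $j=177$: $\alpha_{2,177}=\frac{35844844}{93992497}$, $\alpha_{8,177}=\frac{58147653}{93992497}$ -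 $j=178$: $\alpha_{2,178}=\frac{145576935}{381661961}$, $\alpha_{9,178}=\frac{236085026}{381661961}$ - $j=179$: $\alpha_{2,179}=\frac{8723245}{23755812}$, $\alpha_{10,179}=\frac{15032567}{23755812}$ - $j=180$: $\alpha_{3,180}=\frac{145045373}{508140728}$, $\alpha_{11,180}=\frac{363095355}{508140728}$ - $j=181$: $\alpha_{3,181}=\frac{16276212}{45761591}$, $\alpha_{12,181}=\frac{29485379}{45761591}$ - $j=182$: $\alpha_{3,182}=\frac{72087509}{189669658}$, $\alpha_{13,182}=\frac{117582149}{189669658}$ - $j=183$: $\alpha_{1,183}=\frac{182118174}{97499546341}$, $\alpha_{3,183}=\frac{36413948928}{97499546341}$, $\alpha_{14,183}=\frac{60903479239}{97499546341}$ - $j=184$: $\alpha_{4,184}=\frac{36527825}{116265557}$, $\alpha_{15,184}=\frac{79737732}{116265557}$ - $j=185$: $\alpha_{4,185}=\frac{30799804}{90208717}$, $\alpha_{16,185}=\frac{59408913}{90208717}$ - $j=186$: $\alpha_{4,186}=\frac{61076393}{180923205}$, $\alpha_{17,186}=\frac{119846812}{180923205}$ - $j=187$: $\alpha_{5,187}=\frac{246282282}{848959177}$,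 $\alpha_{18,187}=\frac{602676895}{848959177}$ - $j=188$: $\alpha_{5,188}=\frac{3612237}{11491762}$, $\alpha_{19,188}=\frac{7879525}{11491762}$ - $j=189$: $\alpha_{3,189}=\frac{99039140}{34169004389}$, $\alpha_{5,189}=\frac{11086689792}{34169004389}$, $\alpha_{20,189}=\frac{22983275457}{34169004389}$ - $j=190$: $\alpha_{3,190}=\frac{11750995}{4674681342}$, $\alpha_{5,190}=\frac{1773973504}{5453794899}$, $\alpha_{21,190}=\frac{21996671405}{32722769394}$ - $j=191$: $\alpha_{6,191}=\frac{72660709}{254170744}$, $\alpha_{22,191}=\frac{181510035}{254170744}$ - $j=192$: $\alpha_{6,192}=\frac{17990899}{63629269}$, $\alpha_{23,192}=\frac{45638370}{63629269}$ - $j=193$: $\alpha_{6,193}=\frac{6868668}{21928717}$, $\alpha_{24,193}=\frac{15060049}{21928717}$ - $j=194$: $\alpha_{7,194}=\frac{6623739}{23559574}$, $\alpha_{25,194}=\frac{16935835}{23559574}$ - $j=195$: $\alpha_{7,195}=\frac{20598370}{73772911}$, $\alpha_{26,195}=\frac{53174541}{73772911}$ - $j=196$: $\alpha_{7,196}=\frac{20611449}{73987996}$,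 $\alpha_{27,196}=\frac{53376547}{73987996}$ - $j=197$: $\alpha_{7,197}=\frac{5843252}{21159655}$, $\alpha_{28,197}=\frac{15316403}{21159655}$ - $j=198$: $\alpha_{8,198}=\frac{97422165}{338982541}$, $\alpha_{29,198}=\frac{241560376}{338982541}$ - $j=199$: $\alpha_{8,199}=\frac{246577815}{717694643}$, $\alpha_{30,199}=\frac{471116828}{717694643}$ - $j=200$: $\alpha_{8,200}=\frac{136787965}{369923301}$, $\alpha_{31,200}=\frac{233135336}{369923301}$ - $j=201$: $\alpha_{9,201}=\frac{193885600}{743335051}$, $\alpha_{32,201}=\frac{549449451}{743335051}$ - $j=202$: $\alpha_{9,202}=\frac{2009051}{7752584}$, $\alpha_{33,202}=\frac{5743533}{7752584}$ - $j=203$: $\alpha_{9,203}=\frac{63841426}{248268817}$, $\alpha_{34,203}=\frac{184427391}{248268817}$ - $j=204$: $\alpha_{9,204}=\frac{389848025}{1497560942}$, $\alpha_{35,204}=\frac{1107712917}{1497560942}$ - $j=205$: $\alpha_{10,205}=\frac{99052686}{407082371}$, $\alpha_{36,205}=\frac{308029685}{407082371}$ - $j=206$: $\alpha_{10,206}=\frac{407411107}{1639477277}$,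 $\alpha_{37,206}=\frac{1232066170}{1639477277}$ - $j=207$: $\alpha_{10,207}=\frac{44138539}{166740862}$, $\alpha_{38,207}=\frac{122602323}{166740862}$ - $j=208$: $\alpha_{11,208}=\frac{73429915}{298784748}$, $\alpha_{39,208}=\frac{225354833}{298784748}$ - $j=209$: $\alpha_{11,209}=\frac{479473800}{1824013513}$, $\alpha_{40,209}=\frac{1344539713}{1824013513}$ - $j=210$: $\alpha_{11,210}=\frac{478583529}{1826578078}$, $\alpha_{41,210}=\frac{1347994549}{1826578078}$ - $j=211$: $\alpha_{11,211}=\frac{119627466}{457395215}$, $\alpha_{42,211}=\frac{337767749}{457395215}$ - $6\le j\le 165$: $\alpha_{1,j}=\frac{22145926}{78181827}$, $\alpha_{2,j}=\frac{56035901}{78181827}$ - $j=212$: $\alpha_{1,212}=\frac{13701867480}{32568497273}$, $\alpha_{2,212}=\frac{18866629793}{32568497273}$ Put $A_{i,j}=i\,t_{j-1}$ for $2\le j\le 211$, and $A_{1,212}=\frac{17}{60}$, $A_{2,212}=1$. **Containers.** AH packs items into containers, each of which holds items of one class only and is packed into a bin when it is created. A container has a class $j$ and a type $i$. A huge item forms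 a container of type $1$. For a small class, a type $i$ container is meant to receive $i$ items and is *open* while it has fewer than $i$ items; a type $i$ container of class $212$ is open while its total size is at most $A_{i,212}-t_{211}$. A container of a large class is either *temporary type 1* or *regular type 1* (one item), or *declared type 2* (one item so far, a second one is planned), or *regular type 2* (two items). The *volume* of a type $1$ container of a huge or large class is the size of its item; the volume of any other type $i$ container of class $j$ is $A_{i,j}$. A container is *negative* if its volume is at most $\frac12$ and *positive* otherwise. Two containers *fit together* if the sum of their volumes is at most $1$. A bin has at most one negative and at most one positive container; it is *negative* (*positive*) if it has only a negative (only a positive) container. Let $n_j$ and $n_{ij}$ be the current numbers of containers of class $j$, and of type $i$ and class $j$, just before the arriving item is packed. *Best Fit* selects, among the admissible bins, one whose container has the largest volume. All other choices are arbitrary. **Packing an item.** 1. *Huge item.* Its container is packed by Best Fit into a negative bin whose container it fits together with; if that container is a temporary type 1 container, it becomes a regular type 1 container. If there is no such bin, a new bin is used. 2. *Small or tiny item of class $j$.* If there is an open container of class $j$, the item is put there. Otherwise a new container of class $j$ is created for it, with type the smallest $i$ such that $\alpha_{ij}>0$ and $n_{ij}\le\lfloor\alpha_{ij}n_j\rfloor$.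 - If the new container is negative: it goes to some positive bin whose container it fits together with. If there is none, consider the large classes $j'$ that have a temporary type 1 container and satisfy $n_{2j'}\le\lfloor\alpha_{2j'}n_{j'}\rfloor-1$ and $A_{2,j'}+(\text{volume of the new container})\le1$; if such classes exist, one of them is chosen, the new container joins the bin of a temporary type 1 container of class $j'$ of largest volume, and the latter becomes a declared type 2 container. Otherwise a new bin is used. - If the new container is positive: it goes to some negative bin whose container is not a temporary type 1 container and with which it fits together. If there is none, but it fits together with some temporary type 1 container, then a class $j'$ of such containers is chosen, the new container joins the bin of one of class $j'$ of largest volume among those it fits together with, and the latter becomes a regular type 1 container. Otherwise a new bin is used. 3. *Large item of class $j$.* If there is a declared type 2 container of class $j$, the item is put into one, which becomes a regular type 2 container. Otherwise: - If $n_{2j}=\lfloor\alpha_{2j}n_j\rfloor$: the item forms a new type 1 container. It is packed by Best Fit into a positive bin whose container it fits together with, as a regular type 1 container; if there is no such bin, it is packed into a new bin as a temporary type 1 container. - If $n_{2j}\ne\lfloor\alpha_{2j}n_j\rfloor$: if there is a negative bin whose container has volume at most $1-A_{2,j}$, the item is packed there in a new declared type 2 container. Otherwise, if there is a temporary type 1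 container of class $j$, the item is put into one of largest volume, which becomes a regular type 2 container. Otherwise the item is packed into a new bin, in a new declared type 2 container. -/

import Mathlib

namespace AdvancedHarmonic

/-! ### Parameters

Classes are numbered `1, …, 212`; class `j` consists of the sizes in `(t j, t (j - 1)]`.
Class `1` is huge, classes `2, …, 165` are large, classes `166, …, 211` are small and
class `212` is tiny. -/

/-- The index `b` of the boundary point `1/3`; the large classes are `2, …, b`. -/
def lastLarge : ℕ := 165

/-- The index `M` of the last positive boundary point; the small classes are `b + 1, …, M`. -/
def lastSmall : ℕ := 211

/-- The index `M + 1` of the class of tiny items. -/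
def tinyClass : ℕ := 212

/-- The boundary points `1 = t 0 > t 1 = 1/2 > ⋯ > t 165 = 1/3 > ⋯ > t 211 = 1/43 > t 212 = 0`. -/
def t (j : ℕ) : ℚ :=
  if j = 0 then 1
  else if j = 1 then 1 / 2
  else if j = 2 then 3 / 7
  else if j = 3 then 43 / 120
  else if j = 4 then 59 / 166
  else if j ≤ 165 then 7 / 20 - ((j : ℚ) - 5) / 9600
  else if j = 166 then 271 / 960
  else if j = 167 then 1 / 4
  else if j = 168 then 97 / 480
  else if j = 169 then 1 / 5
  else if j = 170 then 15 / 88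
  else if j = 171 then 1 / 6
  else if j = 172 then 3 / 20
  else if j = 173 then 12 / 83
  else if j = 174 then 1 / 7
  else if j = 175 then 11 / 83
  else if j ≤ 211 then 1 / ((j : ℚ) - 168)
  else 0

/-- The lists of pairs `(i, α i j)` with `α i j > 0`, for the small classes `j = 166, …, 211`
in this order. -/
def smallRows : List (List (ℕ × ℚ)) :=
  [
   [(1, 3445801 / 1433952966), (3, 1430507165 / 1433952966)],
   [(1, 18718929 / 79588150), (3, 60869221 / 79588150)],
   [(1, 10193524 / 41199575), (4, 31006051 / 41199575)],
   [(1, 22658284 / 84102577), (4, 61444293 / 84102577)],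
   [(5, 1)],
   [(1, 76872685 / 1135239972), (5, 1058367287 / 1135239972)],
   [(1, 48313566 / 191010959), (2, 24797889 / 191010959), (6, 117899504 / 191010959)],
   [(1, 20946010 / 480752651), (2, 158075552 / 480752651), (6, 301731089 / 480752651)],
   [(2, 5682641 / 14973238), (6, 9290597 / 14973238)],
   [(1, 103268403 / 85455946430), (2, 11653567744 / 42727973215), (7, 62045542539 / 85455946430)],
   [(2, 4313813 / 11469903), (7, 7156090 / 11469903)],
   [(2, 35844844 / 93992497), (8, 58147653 / 93992497)],
   [(2, 145576935 / 381661961), (9, 236085026 / 381661961)],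
   [(2, 8723245 / 23755812), (10, 15032567 / 23755812)],
   [(3, 145045373 / 508140728), (11, 363095355 / 508140728)],
   [(3, 16276212 / 45761591), (12, 29485379 / 45761591)],
   [(3, 72087509 / 189669658), (13, 117582149 / 189669658)],
   [(1, 182118174 / 97499546341), (3, 36413948928 / 97499546341), (14, 60903479239 / 97499546341)],
   [(4, 36527825 / 116265557), (15, 79737732 / 116265557)],
   [(4, 30799804 / 90208717), (16, 59408913 / 90208717)],
   [(4, 61076393 / 180923205), (17, 119846812 / 180923205)],
   [(5, 246282282 / 848959177), (18, 602676895 / 848959177)],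
   [(5, 3612237 / 11491762), (19, 7879525 / 11491762)],
   [(3, 99039140 / 34169004389), (5, 11086689792 / 34169004389), (20, 22983275457 / 34169004389)],
   [(3, 11750995 / 4674681342), (5, 1773973504 / 5453794899), (21, 21996671405 / 32722769394)],
   [(6, 72660709 / 254170744), (22, 181510035 / 254170744)],
   [(6, 17990899 / 63629269), (23, 45638370 / 63629269)],
   [(6, 6868668 / 21928717), (24, 15060049 / 21928717)],
   [(7, 6623739 / 23559574), (25, 16935835 / 23559574)],
   [(7, 20598370 / 73772911), (26, 53174541 / 73772911)],
   [(7, 20611449 / 73987996), (27, 53376547 / 73987996)],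
   [(7, 5843252 / 21159655), (28, 15316403 / 21159655)],
   [(8, 97422165 / 338982541), (29, 241560376 / 338982541)],
   [(8, 246577815 / 717694643), (30, 471116828 / 717694643)],
   [(8, 136787965 / 369923301), (31, 233135336 / 369923301)],
   [(9, 193885600 / 743335051), (32, 549449451 / 743335051)],
   [(9, 2009051 / 7752584), (33, 5743533 / 7752584)],
   [(9, 63841426 / 248268817), (34, 184427391 / 248268817)],
   [(9, 389848025 / 1497560942), (35, 1107712917 / 1497560942)],
   [(10, 99052686 / 407082371), (36, 308029685 / 407082371)],
   [(10, 407411107 / 1639477277), (37, 1232066170 / 1639477277)],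
   [(10, 44138539 / 166740862), (38, 122602323 / 166740862)],
   [(11, 73429915 / 298784748), (39, 225354833 / 298784748)],
   [(11, 479473800 / 1824013513), (40, 1344539713 / 1824013513)],
   [(11, 478583529 / 1826578078), (41, 1347994549 / 1826578078)],
   [(11, 119627466 / 457395215), (42, 337767749 / 457395215)]
  ]

/-- The list of pairs `(i, α i j)` with `α i j > 0`, for a class `j` with `2 ≤ j ≤ 212`. -/
def row (j : ℕ) : List (ℕ × ℚ) :=
  if j = 2 then [(2, 1)]
  else if j = 3 then [(1, 31755722 / 150095589), (2, 118339867 / 150095589)]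
  else if j = 4 then [(1, 33382666 / 150909061), (2, 117526395 / 150909061)]
  else if j = 5 then [(1, 4493270 / 19023851), (2, 14530581 / 19023851)]
  else if 6 ≤ j ∧ j ≤ 165 then [(1, 22145926 / 78181827), (2, 56035901 / 78181827)]
  else if 166 ≤ j ∧ j ≤ 211 then smallRows.getD (j - 166) []
  else if j = 212 then [(1, 13701867480 / 32568497273), (2, 18866629793 / 32568497273)]
  else []

/-- The proportion `α i j` of type `i` containers among the containers of class `j`. -/
def α (i j : ℕ) : ℚ := ((row j).lookup i).getD 0

/-- The largest total size `A i j` of a type `i` container of class `j`: `i * t (j - 1)` for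
non-tiny classes, while tiny items have two types with bounds `17/60` and `1`. -/
def A (i j : ℕ) : ℚ :=
  if j = tinyClass then (if i = 1 then 17 / 60 else 1) else i * t (j - 1)

/-- An item of size `s` is of class `j`. -/
def InClass (s : ℚ) (j : ℕ) : Prop := t j < s ∧ s ≤ t (j - 1)

/-- `j` is a large class. -/
def IsLarge (j : ℕ) : Prop := 2 ≤ j ∧ j ≤ lastLarge

/-! ### Containers, bins and configurations -/

/-- A container. For large classes, the four possibilities are: temporary type 1 (`type = 1`,
`temporary = true`), regular type 1 (`type = 1`, `temporary = false`), declared type 2 (`type = 2`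
with one item so far) and regular type 2 (`type = 2` with two items). The flag `temporary` is
`false` for all other containers. -/
structure Container where
  /-- the class of the items -/
  cls : ℕ
  /-- the type of the container -/
  type : ℕ
  /-- whether this is a temporary type 1 container of a large class -/
  temporary : Bool
  /-- the sizes of the items packed so far -/
  items : Multiset ℚ

namespace Container

/-- The volume: the exact size of the item for a type 1 container of a huge or large class, and
`A i j` for every other container of type `i` and class `j`. -/
def volume (c : Container) : ℚ :=
  if c.cls ≤ lastLarge ∧ c.type = 1 then c.items.sum else A c.type c.cls

/-- A container is negative if its volume is at most `1/2`. -/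
def IsNegative (c : Container) : Prop := c.volume ≤ 1 / 2

/-- A container is positive if its volume is more than `1/2`. -/
def IsPositive (c : Container) : Prop := 1 / 2 < c.volume

/-- Two containers fit together if their total volume is at most `1`. -/
def Fits (c d : Container) : Prop := c.volume + d.volume ≤ 1

/-- A temporary type 1 container of the large class `j`. -/
def IsTemp (c : Container) (j : ℕ) : Prop :=
  IsLarge j ∧ c.cls = j ∧ c.type = 1 ∧ c.temporary = true

/-- A declared type 2 container of the large class `j`. -/
def IsDeclared (c : Container) (j : ℕ) : Prop :=
  IsLarge j ∧ c.cls = j ∧ c.type = 2 ∧ c.items.card = 1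

/-- An open container of the small or tiny class `j`. -/
def IsOpen (c : Container) (j : ℕ) : Prop :=
  lastLarge < j ∧ c.cls = j ∧
    if j = tinyClass then c.items.sum ≤ A c.type j - t lastSmall else c.items.card < c.type

/-- Put an additional item of size `s` into the container. -/
def add (c : Container) (s : ℚ) : Container := { c with items := s ::ₘ c.items }

/-- A temporary type 1 container becomes a regular one (other containers do not change). -/
def toRegular (c : Container) : Container := { c with temporary := false }

/-- Change the type of a temporary type 1 container to type 2. It is then a declared type 2
container as long as it has only one item. -/
def toType2 (c : Container) : Container := { c with type := 2, temporary := false }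

end Container

/-- A new container of class `j` and type `i` with a single item of size `s`. -/
def single (i j : ℕ) (s : ℚ) : Container := ⟨j, i, false, {s}⟩

/-- A new temporary type 1 container of class `j`, with an item of size `s`. -/
def newTemp (j : ℕ) (s : ℚ) : Container := ⟨j, 1, true, {s}⟩

/-- A nonempty bin: it is negative (one negative container), positive (one positive container) or
neutral (a negative and a positive container). -/
inductive Bin where
  | negative (n : Container)
  | positive (p : Container)
  | neutral (n p : Container)

/-- The containers packed into a bin. -/
def Bin.containers : Bin → Multiset Container
  | .negative n => {n}
  | .positive p => {p}
  | .neutral n p => {n, p}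

/-- `B'` arises from `B` by replacing the container `c` in it by `c'`. -/
inductive Bin.Replace (c c' : Container) : Bin → Bin → Prop
  | negative : Bin.Replace c c' (.negative c) (.negative c')
  | positive : Bin.Replace c c' (.positive c) (.positive c')
  | neutralLeft (p : Container) : Bin.Replace c c' (.neutral c p) (.neutral c' p)
  | neutralRight (n : Container) : Bin.Replace c c' (.neutral n c) (.neutral n c')

/-- A configuration is the collection of the nonempty bins. -/
abbrev Config := Multiset Bin

namespace Config

/-- All containers. -/
def containers (S : Config) : Multiset Container := S.bind Bin.containers

/-- The number `n_j` of containers of class `j`. -/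
def num (S : Config) (j : ℕ) : ℕ := S.containers.countP (fun c => c.cls = j)

/-- The number `n_{ij}` of containers of type `i` of class `j`. -/
def numType (S : Config) (i j : ℕ) : ℕ :=
  S.containers.countP (fun c => c.cls = j ∧ c.type = i)

/-- The number of type 2 containers of class `j` equals `⌊α 2 j * n_j⌋`. -/
def Type2Full (S : Config) (j : ℕ) : Prop := S.numType 2 j = ⌊α 2 j * S.num j⌋₊

/-- At most `⌊α i j * n_j⌋` containers of class `j` have type `i`, where `α i j > 0`. -/
def TypeAllowed (S : Config) (i j : ℕ) : Prop :=
  0 < α i j ∧ S.numType i j ≤ ⌊α i j * S.num j⌋₊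

/-- The negative container `d` is a temporary type 1 container of some large class such that a type
2 container of this class fits together with `c`, and there are at most `⌊α 2 j * n_j⌋ - 1`
type 2 containers of its class `j`. -/
def Convertible (S : Config) (c d : Container) : Prop :=
  d.IsTemp d.cls ∧ d.toType2.Fits c ∧ S.numType 2 d.cls + 1 ≤ ⌊α 2 d.cls * S.num d.cls⌋₊

end Config

/-! ### The packing rules -/

/-- `PlaceNew c S S'`: packing the new container `c` of a small or tiny class into a bin turns the
configuration `S` into `S'`. -/
inductive PlaceNew (c : Container) : Config → Config → Prop
  /-- A negative container goes to an arbitrary positive bin where it fits. -/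
  | negToPositive (S : Config) (p : Container) (hc : c.IsNegative) (hp : p.Fits c) :
      PlaceNew c (.positive p ::ₘ S) (.neutral c p ::ₘ S)
  /-- Otherwise, it goes to a bin with a temporary type 1 container that can become a declared
  type 2 container; a largest one of its (arbitrary) class is taken. -/
  | negToTemp (S : Config) (d : Container) (hc : c.IsNegative)
      (hnone : ∀ p, Bin.positive p ∈ Bin.negative d ::ₘ S → ¬ p.Fits c)
      (hd : Config.Convertible (.negative d ::ₘ S) c d)
      (hbest : ∀ d', Bin.negative d' ∈ Bin.negative d ::ₘ S → d'.IsTemp d.cls →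
        d'.volume ≤ d.volume) :
      PlaceNew c (.negative d ::ₘ S) (.neutral c d.toType2 ::ₘ S)
  /-- Otherwise, it goes to a new bin. -/
  | negToNew (S : Config) (hc : c.IsNegative)
      (hnone : ∀ p, Bin.positive p ∈ S → ¬ p.Fits c)
      (hnone' : ∀ d, Bin.negative d ∈ S → ¬ Config.Convertible S c d) :
      PlaceNew c S (.negative c ::ₘ S)
  /-- A positive container goes to an arbitrary negative bin where it fits and whose container is
  not a temporary type 1 container. -/
  | posToNegative (S : Config) (n : Container) (hc : c.IsPositive)
      (hn : ¬ n.IsTemp n.cls) (hfit : n.Fits c) :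
      PlaceNew c (.negative n ::ₘ S) (.neutral n c ::ₘ S)
  /-- Otherwise, it goes to a bin with a temporary type 1 container where it fits; a largest
  possible one of its (arbitrary) class is taken, and it becomes a regular type 1 container. -/
  | posToTemp (S : Config) (d : Container) (hc : c.IsPositive)
      (hnone : ∀ n, Bin.negative n ∈ Bin.negative d ::ₘ S → ¬ n.IsTemp n.cls → ¬ n.Fits c)
      (hd : d.IsTemp d.cls) (hfit : d.Fits c)
      (hbest : ∀ d', Bin.negative d' ∈ Bin.negative d ::ₘ S → d'.IsTemp d.cls → d'.Fits c →
        d'.volume ≤ d.volume) :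
      PlaceNew c (.negative d ::ₘ S) (.neutral d.toRegular c ::ₘ S)
  /-- Otherwise, it goes to a new bin. -/
  | posToNew (S : Config) (hc : c.IsPositive)
      (hnone : ∀ n, Bin.negative n ∈ S → ¬ n.Fits c) :
      PlaceNew c S (.positive c ::ₘ S)

/-- `Step s S S'`: when an item of size `s` arrives, the algorithm AH may turn the configuration
`S` into `S'`. Ties that the algorithm breaks arbitrarily give several possible `S'`. -/
inductive Step (s : ℚ) : Config → Config → Prop
  /-- A huge item is packed by Best Fit into a negative bin, if it fits into one. A temporary type 1
  container in that bin becomes a regular type 1 container. -/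
  | hugeBestFit (S : Config) (n : Container) (hs : InClass s 1)
      (hfit : n.Fits (single 1 1 s))
      (hbest : ∀ n', Bin.negative n' ∈ Bin.negative n ::ₘ S → n'.Fits (single 1 1 s) →
        n'.volume ≤ n.volume) :
      Step s (.negative n ::ₘ S) (.neutral n.toRegular (single 1 1 s) ::ₘ S)
  /-- Otherwise, a huge item is packed into a new bin. -/
  | hugeNew (S : Config) (hs : InClass s 1)
      (hnone : ∀ n, Bin.negative n ∈ S → ¬ n.Fits (single 1 1 s)) :
      Step s S (.positive (single 1 1 s) ::ₘ S)
  /-- A small or tiny item is packed into an open container of its class, if there is one. -/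
  | smallOpen (S : Config) (j : ℕ) (B B' : Bin) (c : Container) (hj : lastLarge < j)
      (hs : InClass s j) (hc : c.IsOpen j) (hB : Bin.Replace c (c.add s) B B') :
      Step s (B ::ₘ S) (B' ::ₘ S)
  /-- Otherwise, a small or tiny item is packed into a new container, whose type is the smallest
  one that is allowed. -/
  | smallNew (S S' : Config) (i j : ℕ) (hj : lastLarge < j) (hs : InClass s j)
      (hopen : ∀ c ∈ S.containers, ¬ c.IsOpen j)
      (hi : S.TypeAllowed i j) (hmin : ∀ i' < i, ¬ S.TypeAllowed i' j)
      (hplace : PlaceNew (single i j s) S S') :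
      Step s S S'
  /-- A large item is packed into a declared type 2 container of its class, if there is one. -/
  | largeDeclared (S : Config) (j : ℕ) (B B' : Bin) (c : Container) (hj : IsLarge j)
      (hs : InClass s j) (hc : c.IsDeclared j) (hB : Bin.Replace c (c.add s) B B') :
      Step s (B ::ₘ S) (B' ::ₘ S)
  /-- Otherwise, if there are enough type 2 containers, a large item is packed into a type 1
  container. By Best Fit, it becomes a regular type 1 container in a positive bin, if it fits. -/
  | largeOneBestFit (S : Config) (j : ℕ) (p : Container) (hj : IsLarge j) (hs : InClass s j)
      (hdecl : ∀ c ∈ Config.containers (.positive p ::ₘ S), ¬ c.IsDeclared j)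
      (hfull : Config.Type2Full (.positive p ::ₘ S) j)
      (hfit : p.Fits (single 1 j s))
      (hbest : ∀ p', Bin.positive p' ∈ Bin.positive p ::ₘ S → p'.Fits (single 1 j s) →
        p'.volume ≤ p.volume) :
      Step s (.positive p ::ₘ S) (.neutral (single 1 j s) p ::ₘ S)
  /-- Otherwise, it becomes a temporary type 1 container in a new bin. -/
  | largeOneNew (S : Config) (j : ℕ) (hj : IsLarge j) (hs : InClass s j)
      (hdecl : ∀ c ∈ S.containers, ¬ c.IsDeclared j)
      (hfull : S.Type2Full j)
      (hnone : ∀ p, Bin.positive p ∈ S → ¬ p.Fits (single 1 j s)) :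
      Step s S (.negative (newTemp j s) ::ₘ S)
  /-- If there are not enough type 2 containers, a large item is packed as a new declared type 2
  container into an arbitrary negative bin where this container fits. -/
  | largeTwoNegative (S : Config) (j : ℕ) (n : Container) (hj : IsLarge j) (hs : InClass s j)
      (hdecl : ∀ c ∈ Config.containers (.negative n ::ₘ S), ¬ c.IsDeclared j)
      (hfull : ¬ Config.Type2Full (.negative n ::ₘ S) j)
      (hfit : n.Fits (single 2 j s)) :
      Step s (.negative n ::ₘ S) (.neutral n (single 2 j s) ::ₘ S)
  /-- Otherwise, it joins a largest temporary type 1 container of its class, which becomes a regular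
  type 2 container. -/
  | largeTwoTemp (S : Config) (j : ℕ) (d : Container) (hj : IsLarge j) (hs : InClass s j)
      (hdecl : ∀ c ∈ Config.containers (.negative d ::ₘ S), ¬ c.IsDeclared j)
      (hfull : ¬ Config.Type2Full (.negative d ::ₘ S) j)
      (hnone : ∀ n, Bin.negative n ∈ Bin.negative d ::ₘ S → ¬ n.Fits (single 2 j s))
      (hd : d.IsTemp j)
      (hbest : ∀ d', Bin.negative d' ∈ Bin.negative d ::ₘ S → d'.IsTemp j →
        d'.volume ≤ d.volume) :
      Step s (.negative d ::ₘ S) (.positive (d.toType2.add s) ::ₘ S)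
  /-- Otherwise, a new declared type 2 container is packed into a new bin. -/
  | largeTwoNew (S : Config) (j : ℕ) (hj : IsLarge j) (hs : InClass s j)
      (hdecl : ∀ c ∈ S.containers, ¬ c.IsDeclared j)
      (hfull : ¬ S.Type2Full j)
      (hnone : ∀ n, Bin.negative n ∈ S → ¬ n.Fits (single 2 j s))
      (hnone' : ∀ d, Bin.negative d ∈ S → ¬ d.IsTemp j) :
      Step s S (.positive (single 2 j s) ::ₘ S)

/-- `Run I S`: on the input sequence `I`, the algorithm AH may end with the configuration `S`. -/
inductive Run : List ℚ → Config → Prop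
  | nil : Run [] 0
  | snoc {I : List ℚ} {s : ℚ} {S S' : Config} (h : Run I S) (hs : Step s S S') :
      Run (I ++ [s]) S'

/-! ### Bin packing and the competitive ratio -/

/-- An input: a sequence of rational sizes in `(0, 1]`. -/
def IsInput (I : List ℚ) : Prop := ∀ s ∈ I, 0 < s ∧ s ≤ 1

/-- The items of `I` can be partitioned into `m` bins of total sizes at most `1`. -/
def Packable (I : List ℚ) (m : ℕ) : Prop :=
  ∃ f : Fin I.length → Fin m, ∀ b : Fin m, ∑ k with f k = b, I.get k ≤ 1

/-- The optimal (offline) cost. -/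
noncomputable def OPT (I : List ℚ) : ℕ := sInf {m | Packable I m}

open scoped ENNReal in
/-- The asymptotic competitive ratio `lim_{N → ∞} sup {AH(I) / OPT(I) : OPT(I) ≥ N}`, where the
supremum is also over all possible outputs of AH on `I`. -/
noncomputable def asymptoticRatio : ℝ≥0∞ :=
  Filter.limsup (fun N : ℕ => ⨆ (I : List ℚ) (S : Config)
    (_ : IsInput I ∧ Run I S ∧ N ≤ OPT I), (S.card : ℝ≥0∞) / (OPT I : ℝ≥0∞)) Filter.atTop

/-! ### The algorithm is defined on every input -/

theorem smallRows_spec : ∀ r ∈ smallRows, (r.map Prod.snd).sum = 1 ∧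
    (r.map Prod.fst).Nodup ∧ ∀ p ∈ r, 0 < p.2 := by
  simp only [smallRows, List.forall_mem_cons, List.map_cons, List.map_nil, List.sum_cons,
    List.sum_nil]
  norm_num

theorem lookup_of_mem (l : List (ℕ × ℚ)) (hl : (l.map Prod.fst).Nodup) (p : ℕ × ℚ) (hp : p ∈ l) :
    l.lookup p.1 = some p.2 := by
  induction l with
  | nil => simp at hp
  | cons a l ih =>
    rw [List.map_cons, List.nodup_cons] at hl
    rcases List.mem_cons.mp hp with rfl | hp
    · simp [List.lookup]
    · have hne : p.1 ≠ a.1 := fun h => hl.1 (h ▸ List.mem_map_of_mem hp)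
      have : (p.1 == a.1) = false := by simpa using hne
      simpa [List.lookup, this] using ih hl.2 hp

theorem row_spec (j : ℕ) (h1 : lastLarge < j) (h2 : j ≤ tinyClass) :
    ((row j).map Prod.snd).sum = 1 ∧ ((row j).map Prod.fst).Nodup ∧
      ∀ p ∈ row j, α p.1 j = p.2 ∧ 0 < p.2 := by
  unfold lastLarge at h1
  unfold tinyClass at h2
  have h : ((row j).map Prod.snd).sum = 1 ∧ ((row j).map Prod.fst).Nodup ∧
      ∀ p ∈ row j, 0 < p.2 := by
    by_cases hj : j = 212
    · subst hj
      norm_num [row]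
    · have hr : row j = smallRows.getD (j - 166) [] := by
        unfold row
        rw [if_neg (by omega), if_neg (by omega), if_neg (by omega), if_neg (by omega),
          if_neg (by omega), if_pos (by omega)]
      have hlen : j - 166 < smallRows.length := by
        have : smallRows.length = 46 := rfl
        omega
      rw [hr, List.getD_eq_getElem _ _ hlen]
      exact smallRows_spec _ (List.getElem_mem hlen)
  refine ⟨h.1, h.2.1, fun p hp => ⟨?_, h.2.2 p hp⟩⟩
  unfold α
  rw [lookup_of_mem _ h.2.1 p hp]
  rfl

theorem sum_countP_le (m : Multiset Container) (j : ℕ) (l : List ℕ) (hl : l.Nodup) :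
    (l.map fun i => m.countP (fun c => c.cls = j ∧ c.type = i)).sum
      ≤ m.countP (fun c => c.cls = j) := by
  induction m using Multiset.induction with
  | empty => simp
  | cons c m ih =>
    have h1 : (l.map fun i => (c ::ₘ m).countP (fun c => c.cls = j ∧ c.type = i)).sum
        = (l.map fun i => m.countP (fun c => c.cls = j ∧ c.type = i)).sum
          + (l.map fun i => if c.cls = j ∧ c.type = i then 1 else 0).sum := by
      rw [← List.sum_map_add]
      simp only [Multiset.countP_cons]
    rw [h1, Multiset.countP_cons]
    refine Nat.add_le_add ih ?_
    by_cases hc : c.cls = j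
    · simp only [hc, true_and, if_true]
      clear h1 ih
      have : ∀ l : List ℕ, (l.map fun i => if c.type = i then 1 else 0).sum = l.count c.type := by
        intro l
        induction l with
        | nil => simp
        | cons a l ih => simp only [List.map_cons, List.sum_cons, ih, List.count_cons]
                         by_cases h : c.type = a
                         · subst h; simp; omega
                         · simp [h, Ne.symm h]
      rw [this]
      exact List.nodup_iff_count_le_one.mp hl _
    · simp [hc]

theorem exists_typeAllowed (S : Config) (j : ℕ) (h1 : lastLarge < j) (h2 : j ≤ tinyClass) :
    ∃ i, S.TypeAllowed i j := by
  by_contra hcon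
  simp only [Config.TypeAllowed, not_exists, not_and, not_le] at hcon
  obtain ⟨hs, hn, hp⟩ := row_spec j h1 h2
  have h3 := sum_countP_le S.containers j _ hn
  have key : ∀ l : List (ℕ × ℚ), (∀ p ∈ l, α p.1 j = p.2 ∧ 0 < p.2) → l ≠ [] →
      (l.map Prod.snd).sum * S.num j <
        (((l.map Prod.fst).map fun i => S.numType i j).sum : ℕ) := by
    intro l
    induction l with
    | nil => simp
    | cons a l ih =>
      intro hl _
      have ha := hl a (by simp)
      have h4 : a.2 * S.num j < S.numType a.1 j := by
        have := Nat.lt_of_floor_lt (hcon a.1 (ha.1 ▸ ha.2))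
        rwa [ha.1] at this
      by_cases hl0 : l = []
      · subst hl0; simpa using h4
      · have := ih (fun p hp => hl p (by simp [hp])) hl0
        simp only [List.map_cons, List.sum_cons, Nat.cast_add, add_mul]
        linarith
  have h5 := key _ hp (by intro h0; rw [h0] at hs; simp at hs)
  rw [hs, one_mul] at h5
  exact absurd (Nat.cast_lt.mp h5) (not_lt.mpr h3)

theorem exists_class (s : ℚ) (h0 : 0 < s) (h1 : s ≤ 1) :
    ∃ j, 1 ≤ j ∧ j ≤ tinyClass ∧ InClass s j := by
  classical
  have h : ∃ j, t j < s := ⟨212, by simpa [t] using h0⟩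
  refine ⟨Nat.find h, ?_, Nat.find_min' h (by simpa [t, tinyClass] using h0), Nat.find_spec h, ?_⟩
  · rw [Nat.one_le_iff_ne_zero, ne_eq, Nat.find_eq_zero]
    simpa [t] using h1
  · by_cases hz : Nat.find h = 0
    · have := Nat.find_spec h
      rw [hz] at this ⊢
      simpa [t] using h1
    · exact not_lt.mp (Nat.find_min h (by omega))

/-- Among the bins `f n` of `S` with `P n`, there is one where `n` has largest volume. -/
theorem exists_best (f : Container → Bin) (hf : Function.Injective f) (S : Config)
    (P : Container → Prop) (h : ∃ n, f n ∈ S ∧ P n) :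
    ∃ n S', S = f n ::ₘ S' ∧ P n ∧ ∀ n', f n' ∈ S → P n' → n'.volume ≤ n.volume := by
  classical
  have hfin : {n | f n ∈ S ∧ P n}.Finite := by
    refine Set.Finite.subset (Set.Finite.preimage hf.injOn (S.toFinset.finite_toSet)) ?_
    intro n hn
    simpa using hn.1
  obtain ⟨n, hn, hmax⟩ := Set.exists_max_image _ Container.volume hfin h
  obtain ⟨S', hS⟩ := Multiset.exists_cons_of_mem hn.1
  exact ⟨n, S', hS, hn.2, fun n' h1 h2 => hmax n' ⟨h1, h2⟩⟩

theorem exists_placeNew (c : Container) (S : Config) : ∃ S', PlaceNew c S S' := by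
  rcases le_or_gt c.volume (1 / 2) with hc | hc
  · by_cases h1 : ∃ p, Bin.positive p ∈ S ∧ p.Fits c
    · obtain ⟨p, S', rfl, hp, -⟩ := exists_best Bin.positive (fun _ _ h => by injection h) S _ h1
      exact ⟨_, .negToPositive _ p hc hp⟩
    · push Not at h1
      by_cases h2 : ∃ d, Bin.negative d ∈ S ∧ Config.Convertible S c d
      · obtain ⟨d, hd, hd'⟩ := h2
        obtain ⟨e, S', hS, he, hbest⟩ := exists_best Bin.negative (fun _ _ h => by injection h) S
          (fun e => e.IsTemp d.cls) ⟨d, hd, hd'.1⟩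
        have hcl : e.cls = d.cls := he.2.1
        subst hS
        refine ⟨_, .negToTemp S' e hc h1 ⟨hcl ▸ he, ?_, hcl ▸ hd'.2.2⟩ (hcl ▸ hbest)⟩
        have hv : e.toType2.volume = d.toType2.volume := by
          simp [Container.volume, Container.toType2, hcl]
        exact (add_le_add_left hv.le _).trans hd'.2.1
      · push Not at h2
        exact ⟨_, .negToNew S hc h1 h2⟩
  · by_cases h1 : ∃ n, Bin.negative n ∈ S ∧ (¬ n.IsTemp n.cls ∧ n.Fits c)
    · obtain ⟨p, S', rfl, hp, -⟩ := exists_best Bin.negative (fun _ _ h => by injection h) S _ h1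
      exact ⟨_, .posToNegative _ p hc hp.1 hp.2⟩
    · push Not at h1
      by_cases h2 : ∃ d, Bin.negative d ∈ S ∧ (d.IsTemp d.cls ∧ d.Fits c)
      · obtain ⟨d, hd, hd'⟩ := h2
        obtain ⟨e, S', hS, he, hbest⟩ := exists_best Bin.negative (fun _ _ h => by injection h) S
          (fun e => e.IsTemp d.cls ∧ e.Fits c) ⟨d, hd, hd'⟩
        have hcl : e.cls = d.cls := he.1.2.1
        subst hS
        exact ⟨_, .posToTemp S' e hc h1 (hcl ▸ he.1) he.2
          (fun d' h3 h4 h5 => hbest d' h3 ⟨hcl ▸ h4, h5⟩)⟩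
      · push Not at h2
        exact ⟨_, .posToNew S hc fun n hn => by
          by_cases hh : n.IsTemp n.cls
          · exact h2 n hn hh
          · exact h1 n hn hh⟩

theorem exists_replace {S : Config} {c c' : Container} (h : c ∈ S.containers) :
    ∃ B S' B', S = B ::ₘ S' ∧ Bin.Replace c c' B B' := by
  obtain ⟨B, hB, hc⟩ := Multiset.mem_bind.mp h
  obtain ⟨S', rfl⟩ := Multiset.exists_cons_of_mem hB
  cases B with
  | negative n => obtain rfl : c = n := by simpa [Bin.containers] using hc
                  exact ⟨_, _, _, rfl, .negative⟩
  | positive n => obtain rfl : c = n := by simpa [Bin.containers] using hc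
                  exact ⟨_, _, _, rfl, .positive⟩
  | neutral n p =>
    rcases (by simpa [Bin.containers] using hc : c = n ∨ c = p) with rfl | rfl
    · exact ⟨_, _, _, rfl, .neutralLeft _⟩
    · exact ⟨_, _, _, rfl, .neutralRight _⟩

theorem exists_step (s : ℚ) (h0 : 0 < s) (h1 : s ≤ 1) (S : Config) : ∃ S', Step s S S' := by
  classical
  have hinj : Function.Injective Bin.negative := fun _ _ h => by injection h
  have hinj' : Function.Injective Bin.positive := fun _ _ h => by injection h
  obtain ⟨j, hj1, hj2, hs⟩ := exists_class s h0 h1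
  rcases hj1.eq_or_lt with rfl | hj1
  · by_cases h : ∃ n, Bin.negative n ∈ S ∧ n.Fits (single 1 1 s)
    · obtain ⟨n, S', rfl, hn, hb⟩ := exists_best _ hinj S _ h
      exact ⟨_, .hugeBestFit _ n hs hn hb⟩
    · push Not at h
      exact ⟨_, .hugeNew S hs h⟩
  · rcases lt_or_ge lastLarge j with hl | hl
    · by_cases ho : ∃ c ∈ S.containers, c.IsOpen j
      · obtain ⟨c, hc, ho⟩ := ho
        obtain ⟨B, S', B', rfl, hB⟩ := exists_replace (c' := c.add s) hc
        exact ⟨_, .smallOpen _ j _ _ c hl hs ho hB⟩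
      · push Not at ho
        have ht := exists_typeAllowed S j hl hj2
        obtain ⟨S', hS'⟩ := exists_placeNew (single (Nat.find ht) j s) S
        exact ⟨_, .smallNew S S' _ j hl hs ho (Nat.find_spec ht) (fun _ h => Nat.find_min ht h) hS'⟩
    · have hj : IsLarge j := ⟨hj1, hl⟩
      by_cases hd : ∃ c ∈ S.containers, c.IsDeclared j
      · obtain ⟨c, hc, ho⟩ := hd
        obtain ⟨B, S', B', rfl, hB⟩ := exists_replace (c' := c.add s) hc
        exact ⟨_, .largeDeclared _ j _ _ c hj hs ho hB⟩
      · push Not at hd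
        by_cases hfull : S.Type2Full j
        · by_cases h : ∃ p, Bin.positive p ∈ S ∧ p.Fits (single 1 j s)
          · obtain ⟨n, S', rfl, hn, hb⟩ := exists_best _ hinj' S _ h
            exact ⟨_, .largeOneBestFit _ j n hj hs hd hfull hn hb⟩
          · push Not at h
            exact ⟨_, .largeOneNew S j hj hs hd hfull h⟩
        · by_cases h : ∃ n, Bin.negative n ∈ S ∧ n.Fits (single 2 j s)
          · obtain ⟨n, S', rfl, hn, -⟩ := exists_best _ hinj S _ h
            exact ⟨_, .largeTwoNegative _ j n hj hs hd hfull hn⟩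
          · push Not at h
            by_cases h2 : ∃ d, Bin.negative d ∈ S ∧ d.IsTemp j
            · obtain ⟨n, S', rfl, hn, hb⟩ := exists_best _ hinj S _ h2
              exact ⟨_, .largeTwoTemp _ j n hj hs hd hfull h hn hb⟩
            · push Not at h2
              exact ⟨_, .largeTwoNew S j hj hs hd hfull h h2⟩

/-- The algorithm is defined on every input. -/
theorem exists_run (I : List ℚ) (hI : IsInput I) : ∃ S, Run I S := by
  induction I using List.reverseRecOn with
  | nil => exact ⟨0, .nil⟩
  | append_singleton I s ih =>
    obtain ⟨S, hS⟩ := ih fun x hx => hI x (by simp [hx])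
    obtain ⟨h0, h1⟩ := hI s (by simp)
    obtain ⟨S', hS'⟩ := exists_step s h0 h1 S
    exact ⟨S', .snoc hS hS'⟩

end AdvancedHarmonic

/-! The proof is a weighting argument whose weight function depends on the final configuration
through one number, the threshold `v`: the smallest volume of a container that is alone in a
negative bin. A negative and a positive bin never fit together (`Separated.step`), so every positive
bin has volume greater than `1 - v`. Hence a negative container of volume less than `v`, and a
positive one of volume at most `1 - v`, must share its bin.

Every bin is worth one unit. The unit goes to a lone container entirely; in a neutral bin it is
split into `1 - w` for the negative and `w` for the positive container. Knowing only that `lo < v ≤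
hi`, this bounds the contribution of each type of container (`share_le_typeWeight`). AH keeps the
types of a class in nearly fixed proportions (`Change.small_le`, `Change.balanced`), so averaging
over the types gives a weight per item, or per unit of size for tiny items. The number of bins is
then at most the total weight plus a constant (`Params.Valid.exists_card_le`).

Averaging is too crude for the large classes that lie in the interval from `lo` to `hi`, because
their type 1 containers can be on either side of `v`. There, items below `v` get a weight smaller by
`m` than the others. This is legitimate because AH always pairs up a largest temporary container: if
many items of size at least `v` are left alone, then few items below `v` can be present in relation
to the other containers. The potential `gain` expresses this. It is nonnegative whenever no lone
item of size at least `v` exists, and it cannot decrease while one exists (`Run.gain_nonneg`); added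
to the shares it yields exactly the two weights (`share_add_gainBin_le`).

It remains to see that items of total size at most `1` have total weight at most `ratio`
(`Params.sum_weight_le`). The thresholds are covered by thirteen intervals, and for each one this is
a finite knapsack problem, solved by a branch and bound search that is proved sound
(`boundCheck_sound`) and evaluated in the kernel. Summing over the bins of an optimal packing
finishes the proof. -/

namespace AdvancedHarmonic

/-! ### Weights of classes -/

/-- The parameters of a weight function, used when the smallest volume `v` of the container of a
negative bin satisfies `lo < v ≤ hi`. A negative container in a neutral bin contributes `1 - w`, a
positive one `w`. Items of the large classes `k₁, …, k₂` have a weight that depends on whether they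
are smaller than `v`; the difference of the two weights is `m`. -/
structure Params where
  /-- the strict lower bound for the threshold -/
  lo : ℚ
  /-- the upper bound for the threshold -/
  hi : ℚ
  /-- the contribution of a positive container in a neutral bin -/
  w : ℚ
  /-- the difference of the weights of large items above and below the threshold -/
  m : ℚ
  /-- the first class with two weights -/
  k₁ : ℕ
  /-- the last class with two weights -/
  k₂ : ℕ

/-- A lower bound for the total measure of the items of a full container: for small classes, items
are counted, and tiny items are measured by their size. -/
def measure (i j : ℕ) : ℚ := if j = tinyClass then A i j - t lastSmall else i

namespace Params

variable (P : Params)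

/-- An upper bound for the contribution of a container of type `i` and class `j`. -/
def typeWeight (i j : ℕ) : ℚ :=
  if j ≤ lastLarge ∧ i = 1 then (if t (j - 1) ≤ P.lo then 1 - P.w else 1)
  else if A i j ≤ 1 / 2 then (if A i j ≤ P.lo then 1 - P.w else 1)
  else (if A i j ≤ 1 - P.hi then P.w else 1)

/-- The average contribution of containers of class `j` per unit of measure of their items. -/
def classWeight (j : ℕ) : ℚ :=
  ((row j).map fun p => p.2 * P.typeWeight p.1 j).sum / ((row j).map fun p => p.2 * measure p.1 j).sum

/-- The weight of an item of the large class `j` below the threshold. -/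
def lowWeight (j : ℕ) : ℚ :=
  if P.k₁ ≤ j ∧ j ≤ P.k₂ then (1 - P.m) / (1 + α 2 j) else P.classWeight j

/-- The weight of an item of the large class `j` that is at least the threshold. -/
def highWeight (j : ℕ) : ℚ :=
  if P.k₁ ≤ j ∧ j ≤ P.k₂ then (1 + P.m * α 2 j) / (1 + α 2 j) else P.classWeight j

/-- Pairs of a lower bound for the size and an upper bound for the weight which cover all items
below the threshold that are neither huge nor tiny. -/
def kindsBelow : List (ℚ × ℚ) :=
  (if P.k₁ ≤ P.k₂ then [(P.lo, P.lowWeight P.k₁)] else []) ++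
  ((([2, 3, 4, 5].filter fun j => ¬ (P.k₁ ≤ j ∧ j ≤ P.k₂)) ++
    ((if P.k₂ < 165 then [165] else []) ++ List.range' 166 46)).map fun j => (t j, P.classWeight j))

/-- Pairs of a lower bound for the size and an upper bound for the weight which cover all items
except for the tiny ones and the huge ones of weight `1`. -/
def kinds : List (ℚ × ℚ) :=
  (1 / 2, P.w) :: ((if P.k₁ ≤ P.k₂ then [(P.lo, P.highWeight P.k₁)] else []) ++ P.kindsBelow)

end Params

/-! ### A verified search for knapsack bounds -/

/-- A common denominator of the boundary points. -/
def sizeScale : ℕ := 3127303268722403971200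

/-- The denominator used to round weights. -/
def weightScale : ℕ := 10 ^ 12

/-- The integral size and the integral excess of the weight over `d` times the size. -/
def scaled (d : ℚ) (q : ℚ × ℚ) : ℕ × ℕ :=
  (⌊q.1 * sizeScale⌋₊, ⌈(q.2 - d * q.1) * weightScale⌉₊)

/-- Sort pairs of size and profit by decreasing density. -/
def byDensity (l : List (ℕ × ℕ)) : List (ℕ × ℕ) :=
  l.insertionSort fun x y => y.2 * x.1 ≤ x.2 * y.1

/-- The first element has the largest density among all elements, and recursively so. -/
def densityChain : List (ℕ × ℕ) → Bool
  | [] => true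
  | [x] => Nat.blt 0 x.1
  | x :: y :: l => Nat.blt 0 x.1 && (Nat.ble (y.2 * x.1) (x.2 * y.1) && densityChain (y :: l))

/-- Branch and bound: every multiset of pairs in `l` whose total size is less than `r` has a total
profit of at most `g`. -/
def knapsackCheck : ℕ → List (ℕ × ℕ) → ℕ → ℕ → Bool
  | 0, _, _, _ => false
  | _ + 1, [], _, _ => true
  | n + 1, x :: l, r, g =>
    Nat.ble (x.2 * r) (g * x.1) ||
      ((Nat.ble r x.1 || (Nat.ble x.2 g && knapsackCheck n (x :: l) (r - x.1) (g - x.2))) &&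
        knapsackCheck n l r g)

/-- The competitive ratio. -/
def ratio : ℚ := 10060574276093395247 / 6374352691333693440

/-- Total weights in a set of items of total size less than `cap` covered by `kinds` are at most
`bound`, where tiny items have density `d`. -/
def boundCheck (kinds : List (ℚ × ℚ)) (d cap bound : ℚ) : Bool :=
  densityChain (byDensity (kinds.map (scaled d))) &&
    -- The number 300 is only fuel for the recursion: running out of it makes the check fail.
    -- Capacity is rounded up and the profit bound down, so rounding can only make the check
    -- stricter.
    knapsackCheck 300 (byDensity (kinds.map (scaled d))) ⌈cap * sizeScale⌉₊
      ⌊(bound - d * cap) * weightScale⌋₊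

/-- The conditions that make the weight function of `P` valid and bounded by `ratio`. -/
structure Params.Valid (P : Params) : Prop where
  w_nonneg : 0 ≤ P.w
  w_le : P.w ≤ 1
  m_nonneg : 0 ≤ P.m
  m_le : P.m ≤ 1 - P.w
  group : ∀ j ∈ List.range' P.k₁ (P.k₂ + 1 - P.k₁), (2 ≤ j ∧ j ≤ 165) ∧ P.m ≤ P.w * (1 - α 2 j)
  cover : ∀ j ∈ List.range' 2 164,
    (t j < P.hi → ∃ q ∈ P.kindsBelow, q.1 ≤ t j ∧ P.lowWeight j ≤ q.2) ∧
    ((P.k₁ ≤ j ∧ j ≤ P.k₂) ∨ P.hi ≤ t j → ∃ q ∈ P.kinds, q.1 ≤ t j ∧ P.highWeight j ≤ q.2)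
  tiny_nonneg : 0 ≤ P.classWeight 212
  tiny_le : P.classWeight 212 ≤ ratio
  check : boundCheck P.kinds (P.classWeight 212) 1 ratio = true
  le_ratio : 1 + P.classWeight 212 * min P.hi (1 / 2) ≤ ratio
  checkBelow : boundCheck P.kindsBelow (P.classWeight 212) (min P.hi (1 / 2)) (ratio - 1) = true

/-- The parameters for all possible thresholds, which are contained in `(0, 1]`. -/
def allParams : List Params :=
  -- The upper end `1` admits the threshold `1`, used when there are no negative bins. The pair `k₁
  -- = 1`, `k₂ = 0` encodes an empty group; a nonempty group consists of exactly the large classes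
  -- inside the interval.
  [⟨3 / 7, 1, 1, 0, 1, 0⟩,
   ⟨43 / 120, 3 / 7, 80984468 / 10 ^ 8, 112070019 / 10 ^ 9, 3, 3⟩,
   ⟨59 / 166, 43 / 120, 790013534 / 10 ^ 9, 54941633 / 10 ^ 9, 4, 4⟩,
   ⟨7 / 20, 59 / 166, 796663069 / 10 ^ 9, 45881582 / 10 ^ 9, 5, 5⟩,
   ⟨t 98, 7 / 20, 81252323 / 10 ^ 8, 24052898 / 10 ^ 9, 6, 98⟩,
   ⟨t 138, t 98, 812871963 / 10 ^ 9, 14295466 / 10 ^ 9, 99, 138⟩,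
   ⟨t 155, t 138, 812893425 / 10 ^ 9, 10215605 / 10 ^ 9, 139, 155⟩,
   ⟨t 162, t 155, 812886414 / 10 ^ 9, 8496258 / 10 ^ 9, 156, 162⟩,
   ⟨1 / 3, t 162, 812892098 / 10 ^ 9, 7780696 / 10 ^ 9, 163, 165⟩,
   ⟨3 / 10, 1 / 3, 789478263 / 10 ^ 9, 0, 1, 0⟩,
   ⟨24 / 83, 3 / 10, 788497799 / 10 ^ 9, 0, 1, 0⟩,
   ⟨271 / 960, 24 / 83, 21219225 / 10 ^ 9, 0, 1, 0⟩,
   ⟨0, 271 / 960, 0, 0, 1, 0⟩]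

/-! ### Finite verification of the parameters -/

theorem nonneg_of_mem_allParams : ∀ P ∈ allParams, (0 ≤ P.w ∧ P.w ≤ 1) ∧
    (0 ≤ P.m ∧ P.m ≤ 1 - P.w) ∧ 0 ≤ P.classWeight 212 ∧
    P.classWeight 212 ≤ ratio ∧ 1 + P.classWeight 212 * min P.hi (1 / 2) ≤ ratio := by decide +kernel

theorem group_of_mem_allParams : ∀ P ∈ allParams, ∀ j ∈ List.range' P.k₁ (P.k₂ + 1 - P.k₁),
    (2 ≤ j ∧ j ≤ 165) ∧ P.m ≤ P.w * (1 - α 2 j) := by decide +kernel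

/-- Classes 6 to 165 have the same proportions, which is why `kindsBelow` needs only representatives
of them: `k₁` for those in the group and 165 for those below it. Those above the group are covered
in `kinds` by the heavier weight of `k₁`. -/
theorem cover_of_mem_allParams : ∀ P ∈ allParams, ∀ j ∈ List.range' 2 164,
    (t j < P.hi → ∃ q ∈ P.kindsBelow, q.1 ≤ t j ∧ P.lowWeight j ≤ q.2) ∧
    ((P.k₁ ≤ j ∧ j ≤ P.k₂) ∨ P.hi ≤ t j → ∃ q ∈ P.kinds, q.1 ≤ t j ∧ P.highWeight j ≤ q.2) := by
  decide +kernel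

theorem check_of_mem_allParams : ∀ P ∈ allParams,
    boundCheck P.kinds (P.classWeight 212) 1 ratio = true := by decide +kernel

theorem checkBelow_of_mem_allParams : ∀ P ∈ allParams,
    boundCheck P.kindsBelow (P.classWeight 212) (min P.hi (1 / 2)) (ratio - 1) = true := by
  decide +kernel

theorem valid_of_mem_allParams (P : Params) (hP : P ∈ allParams) : P.Valid := by
  obtain ⟨⟨h1, h2⟩, ⟨h3, h4⟩, h5, h6, h7⟩ := nonneg_of_mem_allParams P hP
  exact ⟨h1, h2, h3, h4, group_of_mem_allParams P hP, cover_of_mem_allParams P hP, h5, h6,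
    check_of_mem_allParams P hP, h7, checkBelow_of_mem_allParams P hP⟩

/-- Every threshold in `(0, 1]` is covered. -/
theorem exists_params (v : ℚ) (h0 : 0 < v) (h1 : v ≤ 1) : ∃ P ∈ allParams, P.lo < v ∧ v ≤ P.hi := by
  -- The intervals are listed from the top down and each one ends where its predecessor begins, so
  -- the first one with `lo < v` also has `v ≤ hi`.
  have key : ∀ (l : List Params) (b : ℚ), v ≤ b → l.IsChain (fun P Q => P.lo = Q.hi) →
      (∀ P ∈ l.head?, P.hi = b) → (∀ P ∈ l.getLast?, P.lo = 0) → l ≠ [] →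
      ∃ P ∈ l, P.lo < v ∧ v ≤ P.hi := by
    intro l
    induction l with
    | nil => simp
    | cons P l ih =>
      intro b hb hc hh hl _
      have hP : P.hi = b := hh P (by simp)
      by_cases hv : P.lo < v
      · exact ⟨P, by simp, hv, hP ▸ hb⟩
      · cases l with
        | nil => exact absurd (by rw [hl P (by simp)]; exact h0) hv
        | cons Q l =>
          rw [List.isChain_cons_cons] at hc
          obtain ⟨R, hR, h⟩ := ih P.lo (not_lt.mp hv) hc.2 (by simp [hc.1])
            (fun R hR => hl R (by simpa using hR)) (by simp)
          exact ⟨R, List.mem_cons_of_mem _ hR, h⟩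
  exact key allParams 1 h1 (by decide +kernel) (by decide +kernel) (by decide +kernel)
    (by decide)

/-! ### Soundness of the branch and bound search -/

/-- Comparison of densities by cross multiplication is transitive only when the middle size is
positive, hence the positivity tests in `densityChain`. -/
theorem densityChain_spec (x : ℕ × ℕ) (l : List (ℕ × ℕ)) (h : densityChain (x :: l) = true) :
    densityChain l = true ∧ ∀ y ∈ x :: l, y.2 * x.1 ≤ x.2 * y.1 ∧ 0 < y.1 := by
  induction l generalizing x with
  | nil => simpa [densityChain] using h
  | cons y l ih =>
    simp only [densityChain, Bool.and_eq_true, Nat.blt_eq, Nat.ble_eq] at h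
    obtain ⟨hx, hxy, hl⟩ := h
    refine ⟨hl, fun z hz => ?_⟩
    rcases List.mem_cons.mp hz with rfl | hz
    · exact ⟨le_rfl, hx⟩
    · obtain ⟨hz1, hz2⟩ := (ih y hl).2 z hz
      have hy := ((ih y hl).2 y (by simp)).2
      refine ⟨Nat.le_of_mul_le_mul_right (c := y.1) ?_ hy, hz2⟩
      calc z.2 * x.1 * y.1 = (z.2 * y.1) * x.1 := by ring
        _ ≤ (y.2 * z.1) * x.1 := Nat.mul_le_mul_right _ hz1
        _ = (y.2 * x.1) * z.1 := by ring
        _ ≤ (x.2 * y.1) * z.1 := Nat.mul_le_mul_right _ hxy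
        _ = x.2 * z.1 * y.1 := by ring

/-- Branch on the densest pair `x`: a multiset containing `x` loses one copy, and capacity and
profit are reduced while the list stays the same; a multiset without `x` uses only the rest of the
list. A branch is cut off as soon as filling the whole capacity at the density of `x` cannot exceed
`g`. -/
theorem knapsackCheck_sound (n : ℕ) (l : List (ℕ × ℕ)) (r g : ℕ) (hl : densityChain l = true)
    (h : knapsackCheck n l r g = true) (M : Multiset (ℕ × ℕ)) (hM : ∀ x ∈ M, x ∈ l)
    (hr : (M.map Prod.fst).sum < r) : (M.map Prod.snd).sum ≤ g := by
  induction n generalizing l r g M with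
  | zero => simp [knapsackCheck] at h
  | succ n ih =>
    cases l with
    | nil =>
      obtain rfl : M = 0 := Multiset.eq_zero_of_forall_notMem fun x hx => by simpa using hM x hx
      simp
    | cons x l =>
      obtain ⟨hl', hd⟩ := densityChain_spec x l hl
      simp only [knapsackCheck, Bool.or_eq_true, Bool.and_eq_true, Nat.ble_eq] at h
      rcases h with h | ⟨h1, h2⟩
      -- The fractional relaxation: total profit is at most the density of `x` times the total size.
      · have hx := (hd x (by simp)).2
        refine Nat.le_of_mul_le_mul_right (c := x.1) ?_ hx
        calc (M.map Prod.snd).sum * x.1 = (M.map fun y => y.2 * x.1).sum := by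
              rw [Multiset.sum_map_mul_right]
          _ ≤ (M.map fun y => x.2 * y.1).sum :=
              Multiset.sum_map_le_sum_map _ _ fun y hy => (hd y (hM y hy)).1
          _ = x.2 * (M.map Prod.fst).sum := by rw [Multiset.sum_map_mul_left]
          _ ≤ x.2 * r := Nat.mul_le_mul_left _ hr.le
          _ ≤ g * x.1 := h
      · by_cases hx : x ∈ M
        · obtain ⟨M, rfl⟩ := Multiset.exists_cons_of_mem hx
          simp only [Multiset.map_cons, Multiset.sum_cons] at hr ⊢
          rcases h1 with h1 | ⟨h1, h3⟩
          · omega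
          · have := ih _ _ _ hl h3 M (fun y hy => hM y (Multiset.mem_cons_of_mem hy)) (by omega)
            omega
        · refine ih _ _ _ hl' h2 M (fun y hy => ?_) hr
          rcases List.mem_cons.mp (hM y hy) with rfl | hy'
          · exact absurd hy hx
          · exact hy'

/-- Charge density `d` to every item, as if the whole bin were filled with tiny items. An item
covered by a pair `q` then only has the excess `q.2 - d * q.1` left, because `d * q.1 ≤ d * s`. The
excesses form a knapsack problem without tiny items, and `d * cap` is added back at the end. -/
theorem boundCheck_sound (kinds : List (ℚ × ℚ)) (d cap bound : ℚ) (hd : 0 ≤ d)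
    (hb : d * cap ≤ bound) (h : boundCheck kinds d cap bound = true) (f : ℚ → ℚ) (M : Multiset ℚ)
    (hM : ∀ s ∈ M, 0 < s ∧ (f s ≤ d * s ∨ ∃ q ∈ kinds, q.1 < s ∧ f s ≤ q.2))
    (hcap : M.sum ≤ cap) : (M.map f).sum ≤ bound := by
  have hD : (0 : ℚ) < sizeScale := by norm_num [sizeScale]
  have hK : (0 : ℚ) < weightScale := by norm_num [weightScale]
  have key : ∃ Q : Multiset (ℕ × ℕ), (∀ x ∈ Q, x ∈ kinds.map (scaled d)) ∧
      -- Items are strictly larger than their lower bounds, so the sum is strict unless no item is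
      -- charged to a pair. Strictness matters: it excludes, for example, two huge items in one bin.
      (Q = 0 ∨ ((Q.map Prod.fst).sum : ℚ) < M.sum * sizeScale) ∧ 0 ≤ M.sum ∧
      (M.map f).sum ≤ d * M.sum + (Q.map Prod.snd).sum / weightScale := by
    clear hcap
    induction M using Multiset.induction with
    | empty => exact ⟨0, by simp⟩
    | cons s M ih =>
      obtain ⟨Q, hQ, hs, h0, hw⟩ := ih fun s hs => hM s (Multiset.mem_cons_of_mem hs)
      obtain ⟨hs0, hs'⟩ := hM s (Multiset.mem_cons_self _ _)
      have hsD : 0 < s * sizeScale := mul_pos hs0 hD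
      simp only [Multiset.map_cons, Multiset.sum_cons]
      rcases hs' with hs' | ⟨q, hq, hqs, hfq⟩
      · refine ⟨Q, hQ, hs.imp_right fun h => ?_, by linarith, by linarith⟩
        rw [add_mul]
        linarith
      · refine ⟨scaled d q ::ₘ Q, ?_, .inr ?_, by linarith, ?_⟩
        · intro x hx
          rcases Multiset.mem_cons.mp hx with rfl | hx
          · exact List.mem_map_of_mem hq
          · exact hQ x hx
        · have h1 : ((⌊q.1 * sizeScale⌋₊ : ℕ) : ℚ) < s * sizeScale := by
            rcases le_total 0 (q.1 * sizeScale) with h | h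
            · exact (Nat.floor_le h).trans_lt (mul_lt_mul_of_pos_right hqs hD)
            · rw [Nat.floor_of_nonpos h]
              simpa using hsD
          have h2 : ((Q.map Prod.fst).sum : ℚ) ≤ M.sum * sizeScale := by
            rcases hs with rfl | hs
            · simpa using mul_nonneg h0 hD.le
            · exact hs.le
          simp only [Multiset.map_cons, Multiset.sum_cons, Nat.cast_add, scaled, add_mul]
          linarith
        · have h1 : q.2 - d * q.1 ≤ (⌈(q.2 - d * q.1) * weightScale⌉₊ : ℕ) / (weightScale : ℚ) := by
            rw [le_div_iff₀ hK]
            exact Nat.le_ceil _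
          have h2 : d * q.1 ≤ d * s := mul_le_mul_of_nonneg_left hqs.le hd
          simp only [Multiset.map_cons, Multiset.sum_cons, Nat.cast_add, scaled, add_div, mul_add]
          linarith
  obtain ⟨Q, hQ, hs, -, hw⟩ := key
  simp only [boundCheck, Bool.and_eq_true] at h
  have hmem : ∀ x ∈ Q, x ∈ byDensity (kinds.map (scaled d)) := fun x hx =>
    ((List.perm_insertionSort _ _).mem_iff).mpr (hQ x hx)
  have hg : (Q.map Prod.snd).sum ≤ ⌊(bound - d * cap) * weightScale⌋₊ := by
    rcases hs with rfl | hs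
    · simp
    · refine knapsackCheck_sound _ _ _ _ h.1 h.2 Q hmem ?_
      have : ((Q.map Prod.fst).sum : ℚ) < (⌈cap * sizeScale⌉₊ : ℕ) :=
        hs.trans_le ((mul_le_mul_of_nonneg_right hcap hD.le).trans (Nat.le_ceil _))
      exact_mod_cast this
  have h1 : ((Q.map Prod.snd).sum : ℚ) / weightScale ≤ bound - d * cap := by
    rw [div_le_iff₀ hK]
    exact (Nat.cast_le.mpr hg).trans
      (Nat.floor_le (mul_nonneg (sub_nonneg.mpr hb) hK.le))
  have h2 := mul_le_mul_of_nonneg_left hcap hd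
  linarith

/-! ### Weights of items -/

theorem t_antitone : Antitone t := by
  refine antitone_nat_of_succ_le fun j => ?_
  rcases lt_or_ge j 212 with h | h
  · have : ∀ j < 212, t (j + 1) ≤ t j := by decide +kernel
    exact this j h
  · have h0 : ∀ i, 212 ≤ i → t i = 0 := fun i hi => by
      unfold t
      repeat rw [if_neg (by omega)]
    rw [h0 j h, h0 (j + 1) (by omega)]

theorem t_nonneg (j : ℕ) : 0 ≤ t j := by
  have h : t (max j 212) = 0 := by
    unfold t
    repeat rw [if_neg (by omega)]
  exact h ▸ t_antitone (le_max_left j 212)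

/-- The class of an item. -/
noncomputable def classOf (s : ℚ) : ℕ := sInf {j | t j < s}

theorem InClass.classOf_eq {s : ℚ} {j : ℕ} (h : InClass s j) : classOf s = j := by
  refine le_antisymm (Nat.sInf_le h.1) (le_csInf ⟨j, h.1⟩ fun i hi => ?_)
  by_contra hij
  exact absurd (h.2.trans (t_antitone (by omega))) (not_le.mpr hi)

theorem inClass_classOf {s : ℚ} (h0 : 0 < s) (h1 : s ≤ 1) :
    InClass s (classOf s) ∧ 1 ≤ classOf s ∧ classOf s ≤ 212 := by
  obtain ⟨j, hj1, hj2, hj⟩ := exists_class s h0 h1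
  rw [hj.classOf_eq]
  exact ⟨hj, hj1, hj2⟩

theorem t_one : t 1 = 1 / 2 := by norm_num [t]

theorem InClass.pos {s : ℚ} {j : ℕ} (h : InClass s j) : 0 < s := (t_nonneg j).trans_lt h.1

theorem InClass.le_one {s : ℚ} {j : ℕ} (h : InClass s j) : s ≤ 1 :=
  h.2.trans ((t_antitone (Nat.zero_le _)).trans (by simp [t]))

theorem InClass.one_le {s : ℚ} {j : ℕ} (h : InClass s j) : 1 ≤ j :=
  h.classOf_eq ▸ (inClass_classOf h.pos h.le_one).2.1

theorem InClass.le_tiny {s : ℚ} {j : ℕ} (h : InClass s j) : j ≤ 212 :=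
  h.classOf_eq ▸ (inClass_classOf h.pos h.le_one).2.2

/-- Tiny items are measured by their size, all other items are counted. -/
def itemMeasure (j : ℕ) (s : ℚ) : ℚ := if j = tinyClass then s else 1

namespace Params

/-- The weight of an item of class `j` and size `s`, for the threshold `v`. -/
def itemWeight (P : Params) (v : ℚ) (j : ℕ) (s : ℚ) : ℚ :=
  if j = 1 then (if 1 - v < s then 1 else P.w)
  else if j ≤ lastLarge then (if v ≤ s then P.highWeight j else P.lowWeight j)
  else P.classWeight j * itemMeasure j s

/-- The weight of an item of size `s`, for the threshold `v`. -/
noncomputable def weight (P : Params) (v s : ℚ) : ℚ := P.itemWeight v (classOf s) s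

theorem mem_kindsBelow (P : Params) {j : ℕ} (h1 : lastLarge < j) (h2 : j ≤ 211) :
    (t j, P.classWeight j) ∈ P.kindsBelow := by
  unfold lastLarge at h1
  refine List.mem_append_right _ (List.mem_map.mpr ⟨j, ?_, rfl⟩)
  refine List.mem_append_right _ (List.mem_append_right _ ?_)
  rw [List.mem_range'_1]
  omega

theorem kindsBelow_subset (P : Params) {q : ℚ × ℚ} (h : q ∈ P.kindsBelow) : q ∈ P.kinds :=
  List.mem_cons_of_mem _ (List.mem_append_right _ h)

/-- An item below the threshold is tiny or covered by `kindsBelow`, unless it is huge. -/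
theorem exists_kindsBelow {P : Params} (hP : P.Valid) {v s : ℚ} (hv : v ≤ P.hi) (h0 : 0 < s)
    (h1 : s ≤ 1) (hc : classOf s ≠ 1) (hs : s < v ∨ lastLarge < classOf s) :
    P.weight v s ≤ P.classWeight 212 * s ∨ ∃ q ∈ P.kindsBelow, q.1 < s ∧ P.weight v s ≤ q.2 := by
  obtain ⟨hj, hj1, hj2⟩ := inClass_classOf h0 h1
  unfold weight
  set j := classOf s
  by_cases hl : j ≤ lastLarge
  · right
    have hsv : s < v := hs.resolve_right (not_lt.mpr hl)
    have hl' := hl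
    unfold lastLarge at hl'
    obtain ⟨q, hq, hq1, hq2⟩ := (hP.cover j (List.mem_range'_1.mpr (by omega))).1
      (hj.1.trans (hsv.trans_le hv))
    refine ⟨q, hq, hq1.trans_lt hj.1, ?_⟩
    rw [itemWeight, if_neg hc, if_pos hl, if_neg (not_le.mpr hsv)]
    exact hq2
  · rw [itemWeight, if_neg hc, if_neg hl]
    rcases hj2.eq_or_lt with h | h
    · left
      rw [h]
      exact le_rfl
    · right
      refine ⟨_, P.mem_kindsBelow (not_le.mp hl) (by omega), hj.1, ?_⟩
      rw [itemMeasure, if_neg (by unfold tinyClass; omega), mul_one]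

/-- The total weight of the items in a bin is at most the competitive ratio. -/
theorem sum_weight_le {P : Params} (hP : P.Valid) {v : ℚ} (hv : v ≤ P.hi) (M : Multiset ℚ)
    (hM : ∀ s ∈ M, 0 < s ∧ s ≤ 1) (hsum : M.sum ≤ 1) : (M.map (P.weight v)).sum ≤ ratio := by
  have hle := hP.le_ratio
  -- A huge item above `1 - v` has weight `1` and leaves less than `min v (1 / 2)` for the others,
  -- which are therefore below the threshold and not huge. Their budget is `ratio - 1`.
  by_cases hh : ∃ s ∈ M, classOf s = 1 ∧ 1 - v < s
  · obtain ⟨h, hh, hc, hhv⟩ := hh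
    obtain ⟨M, rfl⟩ := Multiset.exists_cons_of_mem hh
    obtain ⟨h0, h1⟩ := hM h (Multiset.mem_cons_self _ _)
    have hj := (inClass_classOf h0 h1).1
    rw [hc] at hj
    have hhalf : 1 / 2 < h := t_one ▸ hj.1
    have hw : P.weight v h = 1 := by rw [weight, hc, itemWeight, if_pos rfl, if_pos hhv]
    simp only [Multiset.sum_cons, Multiset.map_cons] at hsum ⊢
    rw [hw]
    have hM' : ∀ s ∈ M, s ≤ M.sum := fun s hs => Multiset.single_le_sum
      (fun x hx => (hM x (Multiset.mem_cons_of_mem hx)).1.le) s hs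
    suffices (M.map (P.weight v)).sum ≤ ratio - 1 by linarith
    refine boundCheck_sound P.kindsBelow (P.classWeight 212) (min P.hi (1 / 2)) (ratio - 1)
      hP.tiny_nonneg (by linarith) hP.checkBelow _ M (fun s hs => ?_) (le_min ?_ ?_)
    · obtain ⟨hs0, hs1⟩ := hM s (Multiset.mem_cons_of_mem hs)
      have := hM' s hs
      refine ⟨hs0, exists_kindsBelow hP hv hs0 hs1 (fun hc => ?_) (.inl (by linarith))⟩
      have := (inClass_classOf hs0 hs1).1.1
      rw [hc, t_one] at this
      linarith
    · linarith
    · linarith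
  -- Now all huge items have weight `w`, so they are covered by the pair `(1 / 2, P.w)` like other
  -- items.
  · push Not at hh
    refine boundCheck_sound P.kinds (P.classWeight 212) 1 ratio hP.tiny_nonneg
      (by linarith [hP.tiny_le]) hP.check _ M
      (fun s hs => ?_) hsum
    obtain ⟨hs0, hs1⟩ := hM s hs
    refine ⟨hs0, ?_⟩
    by_cases hc : classOf s = 1
    · refine .inr ⟨(1 / 2, P.w), List.mem_cons_self, ?_, ?_⟩
      · have := (inClass_classOf hs0 hs1).1.1
        rwa [hc, t_one] at this
      · rw [weight, hc, itemWeight, if_pos rfl, if_neg (not_lt.mpr (hh s hs hc))]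
    · by_cases hs' : s < v ∨ lastLarge < classOf s
      · refine (exists_kindsBelow hP hv hs0 hs1 hc hs').imp_right ?_
        rintro ⟨q, hq, h⟩
        exact ⟨q, P.kindsBelow_subset hq, h⟩
      · rw [not_or, not_lt, not_lt] at hs'
        obtain ⟨hj, hj1, -⟩ := inClass_classOf hs0 hs1
        have hl := hs'.2
        unfold lastLarge at hl
        have hw : P.weight v s = P.highWeight (classOf s) := by
          rw [weight, itemWeight, if_neg hc, if_pos hs'.2, if_pos hs'.1]
        rw [hw]
        right
        obtain ⟨hc1, hc2⟩ := hP.cover (classOf s) (List.mem_range'_1.mpr (by omega))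
        by_cases hg : (P.k₁ ≤ classOf s ∧ classOf s ≤ P.k₂) ∨ P.hi ≤ t (classOf s)
        · obtain ⟨q, hq, hq1, hq2⟩ := hc2 hg
          exact ⟨q, hq, hq1.trans_lt hj.1, hq2⟩
        -- Outside the group the low and the high weight coincide, so the cover for items below the
        -- threshold can be used for an item above it.
        · rw [not_or, not_le] at hg
          obtain ⟨q, hq, hq1, hq2⟩ := hc1 hg.2
          refine ⟨q, P.kindsBelow_subset hq, hq1.trans_lt hj.1, ?_⟩
          rw [lowWeight, if_neg hg.1] at hq2
          rwa [highWeight, if_neg hg.1]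

end Params

/-! ### Rows of large classes -/

/-- Large classes have only the types 1 and 2. Class 2 has no entry for type 1, which agrees with
the formula since `α 2 2 = 1`. -/
theorem IsLarge.sum_row {j : ℕ} (hj : IsLarge j) (g : ℕ → ℚ) :
    ((row j).map fun p => p.2 * g p.1).sum = (1 - α 2 j) * g 1 + α 2 j * g 2 := by
  obtain ⟨h1, h2⟩ := hj
  unfold lastLarge at h2
  have key : ∀ a b : ℚ, row j = [(1, a), (2, b)] → a = 1 - b →
      ((row j).map fun p => p.2 * g p.1).sum = (1 - α 2 j) * g 1 + α 2 j * g 2 := by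
    intro a b hr hab
    have : α 2 j = b := by
      unfold α
      rw [hr]
      rfl
    rw [this, hr, hab]
    simp
  by_cases h : 6 ≤ j
  · refine key (22145926 / 78181827) (56035901 / 78181827) ?_ (by norm_num)
    unfold row
    iterate 4 rw [if_neg (by omega)]
    rw [if_pos (by omega)]
  · have : j = 2 ∨ j = 3 ∨ j = 4 ∨ j = 5 := by omega
    rcases this with rfl | rfl | rfl | rfl
    · norm_num [α, row, List.lookup]
    · exact key _ _ rfl (by norm_num)
    · exact key _ _ rfl (by norm_num)
    · exact key _ _ rfl (by norm_num)

theorem IsLarge.alpha_bounds {j : ℕ} (hj : IsLarge j) : 0 < α 2 j ∧ α 2 j ≤ 1 := by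
  have h : ∀ j ∈ List.range' 2 164, 0 < α 2 j ∧ α 2 j ≤ 1 := by decide +kernel
  obtain ⟨h1, h2⟩ := hj
  unfold lastLarge at h2
  exact h j (List.mem_range'_1.mpr (by omega))

/-! ### The containers of a configuration -/

/-- The number of containers of class `j`. -/
def countClass (M : Multiset Container) (j : ℕ) : ℕ := M.countP fun c => c.cls = j

/-- The number of containers of type `i` and class `j`. -/
def countType (M : Multiset Container) (i j : ℕ) : ℕ := M.countP fun c => c.cls = j ∧ c.type = i

open Classical in
/-- The number of declared type 2 containers of class `j`. -/
noncomputable def countDeclared (M : Multiset Container) (j : ℕ) : ℕ :=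
  M.countP fun c => c.IsDeclared j

open Classical in
/-- The number of open containers of class `j`. -/
noncomputable def countOpen (M : Multiset Container) (j : ℕ) : ℕ := M.countP fun c => c.IsOpen j

/-- The number of type 2 containers of class `j` that AH aims at. -/
def target (M : Multiset Container) (j : ℕ) : ℕ := ⌊α 2 j * countClass M j⌋₊

/-- The containers of a configuration, without the distinction between temporary and regular
containers. -/
def Config.normal (S : Config) : Multiset Container := S.containers.map Container.toRegular

namespace Config

@[simp] theorem normal_negative (S : Config) (n : Container) :
    normal (.negative n ::ₘ S) = n.toRegular ::ₘ S.normal := by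
  simp [normal, containers, Bin.containers]

@[simp] theorem normal_positive (S : Config) (p : Container) :
    normal (.positive p ::ₘ S) = p.toRegular ::ₘ S.normal := by
  simp [normal, containers, Bin.containers]

@[simp] theorem normal_neutral (S : Config) (n p : Container) :
    normal (.neutral n p ::ₘ S) = n.toRegular ::ₘ p.toRegular ::ₘ S.normal := by
  simp [normal, containers, Bin.containers]

theorem num_eq (S : Config) (j : ℕ) : S.num j = countClass S.normal j := by
  rw [num, countClass, normal, Multiset.countP_map, Multiset.countP_eq_card_filter]
  rfl

theorem numType_eq (S : Config) (i j : ℕ) : S.numType i j = countType S.normal i j := by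
  rw [numType, countType, normal, Multiset.countP_map, Multiset.countP_eq_card_filter]
  rfl

theorem not_isDeclared_normal {S : Config} {j : ℕ} (h : ∀ c ∈ S.containers, ¬ c.IsDeclared j) :
    ∀ c ∈ S.normal, ¬ c.IsDeclared j := by
  intro c hc
  obtain ⟨d, hd, rfl⟩ := Multiset.mem_map.mp hc
  exact h d hd

theorem not_isOpen_normal {S : Config} {j : ℕ} (h : ∀ c ∈ S.containers, ¬ c.IsOpen j) :
    ∀ c ∈ S.normal, ¬ c.IsOpen j := by
  intro c hc
  obtain ⟨d, hd, rfl⟩ := Multiset.mem_map.mp hc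
  exact h d hd

theorem type2Full_iff (S : Config) (j : ℕ) :
    S.Type2Full j ↔ countType S.normal 2 j = target S.normal j := by
  rw [Type2Full, numType_eq, num_eq, target]

end Config

/-- A new container of type `i` and class `j` is allowed. -/
def Allowed (M : Multiset Container) (i j : ℕ) : Prop :=
  lastLarge < j ∧ (∀ c ∈ M, ¬ c.IsOpen j) ∧ 0 < α i j ∧
    countType M i j ≤ ⌊α i j * countClass M j⌋₊

/-- The effect of the arrival of an item of size `s` on the containers. -/
inductive Change (s : ℚ) : Multiset Container → Multiset Container → Prop
  | huge (M : Multiset Container) (hs : InClass s 1) : Change s M (single 1 1 s ::ₘ M)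
  | fill (M : Multiset Container) (c : Container) (j : ℕ) (hs : InClass s j)
      (hc : c.IsOpen j ∨ c.IsDeclared j) : Change s (c ::ₘ M) (c.add s ::ₘ M)
  | small (M : Multiset Container) (i j : ℕ) (hs : InClass s j) (h : Allowed M i j) :
      Change s M (single i j s ::ₘ M)
  | convert (M : Multiset Container) (d : Container) (i j : ℕ) (hs : InClass s j)
      (h : Allowed (d ::ₘ M) i j) (hd : IsLarge d.cls) (hd1 : d.type = 1)
      (hlt : countType (d ::ₘ M) 2 d.cls + 1 ≤ target (d ::ₘ M) d.cls) :
      Change s (d ::ₘ M) (single i j s ::ₘ d.toType2 ::ₘ M)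
  | one (M : Multiset Container) (j : ℕ) (hs : InClass s j) (hj : IsLarge j)
      (hdecl : ∀ c ∈ M, ¬ c.IsDeclared j) (hfull : countType M 2 j = target M j) :
      Change s M (single 1 j s ::ₘ M)
  | two (M : Multiset Container) (j : ℕ) (hs : InClass s j) (hj : IsLarge j)
      (hdecl : ∀ c ∈ M, ¬ c.IsDeclared j) (hfull : countType M 2 j ≠ target M j) :
      Change s M (single 2 j s ::ₘ M)
  | pair (M : Multiset Container) (d : Container) (hs : InClass s d.cls) (hd : IsLarge d.cls)
      (hd1 : d.type = 1) (hdecl : ∀ c ∈ d ::ₘ M, ¬ c.IsDeclared d.cls)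
      (hfull : countType (d ::ₘ M) 2 d.cls ≠ target (d ::ₘ M) d.cls) :
      Change s (d ::ₘ M) (d.toType2.add s ::ₘ M)

theorem Bin.Replace.exists_normal {c c' : Container} {B B' : Bin} (h : Bin.Replace c c' B B')
    (S : Config) : ∃ M, Config.normal (B ::ₘ S) = c.toRegular ::ₘ M ∧
      Config.normal (B' ::ₘ S) = c'.toRegular ::ₘ M := by
  cases h with
  | negative => exact ⟨S.normal, by simp, by simp⟩
  | positive => exact ⟨S.normal, by simp, by simp⟩
  | neutralLeft p => exact ⟨p.toRegular ::ₘ S.normal, by simp, by simp⟩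
  | neutralRight n =>
    exact ⟨n.toRegular ::ₘ S.normal, by simp [Multiset.cons_swap n.toRegular],
      by simp [Multiset.cons_swap n.toRegular]⟩

/-- The counting invariants do not depend on which bins the containers share, nor on whether a type
1 container is temporary. Forgetting both leaves only seven kinds of transition. -/
theorem Step.change {s : ℚ} {S S' : Config} (h : Step s S S') : Change s S.normal S'.normal := by
  have hfill : ∀ (S : Config) (j : ℕ) (B B' : Bin) (c : Container), InClass s j →
      c.IsOpen j ∨ c.IsDeclared j → Bin.Replace c (c.add s) B B' →
      Change s (Config.normal (B ::ₘ S)) (Config.normal (B' ::ₘ S)) := by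
    intro S j B B' c hs hc hB
    obtain ⟨M, h1, h2⟩ := hB.exists_normal S
    rw [h1, h2]
    exact .fill M c.toRegular j hs hc
  cases h with
  | hugeBestFit S n hs hfit hbest =>
    simp only [Config.normal_negative, Config.normal_neutral]
    rw [Multiset.cons_swap]
    exact .huge _ hs
  | hugeNew S hs hnone =>
    rw [Config.normal_positive]
    exact .huge _ hs
  | smallOpen S j B B' c hj hs hc hB => exact hfill S j B B' c hs (.inl hc) hB
  | smallNew S S' i j hj hs hopen hi hmin hplace =>
    have hall : Allowed S.normal i j := by
      refine ⟨hj, Config.not_isOpen_normal hopen, hi.1, ?_⟩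
      rw [← Config.numType_eq, ← Config.num_eq]
      exact hi.2
    cases hplace with
    | negToPositive S p hc hp =>
      simp only [Config.normal_positive, Config.normal_neutral] at hall ⊢
      exact .small _ i j hs hall
    | negToTemp S d hc hnone hd hbest =>
      have hlt := hd.2.2
      rw [Config.numType_eq, Config.num_eq] at hlt
      simp only [Config.normal_negative, Config.normal_neutral] at hall hlt ⊢
      exact .convert _ d.toRegular i j hs hall hd.1.1 hd.1.2.2.1 hlt
    | negToNew S hc hnone hnone' =>
      rw [Config.normal_negative]
      exact .small _ i j hs hall
    | posToNegative S n hc hn hfit =>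
      simp only [Config.normal_negative, Config.normal_neutral] at hall ⊢
      rw [Multiset.cons_swap]
      exact .small _ i j hs hall
    | posToTemp S d hc hnone hd hfit hbest =>
      simp only [Config.normal_negative, Config.normal_neutral] at hall ⊢
      rw [Multiset.cons_swap]
      exact .small _ i j hs hall
    | posToNew S hc hnone =>
      rw [Config.normal_positive]
      exact .small _ i j hs hall
  | largeDeclared S j B B' c hj hs hc hB => exact hfill S j B B' c hs (.inr hc) hB
  | largeOneBestFit S j p hj hs hdecl hfull hfit hbest =>
    have h1 := Config.not_isDeclared_normal hdecl
    rw [Config.type2Full_iff] at hfull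
    simp only [Config.normal_positive, Config.normal_neutral] at h1 hfull ⊢
    exact .one _ j hs hj h1 hfull
  | largeOneNew S j hj hs hdecl hfull hnone =>
    rw [Config.normal_negative]
    exact .one _ j hs hj (Config.not_isDeclared_normal hdecl) ((Config.type2Full_iff _ _).mp hfull)
  | largeTwoNegative S j n hj hs hdecl hfull hfit =>
    have h1 := Config.not_isDeclared_normal hdecl
    rw [Config.type2Full_iff] at hfull
    simp only [Config.normal_negative, Config.normal_neutral] at h1 hfull ⊢
    rw [Multiset.cons_swap]
    exact .two _ j hs hj h1 hfull
  | largeTwoTemp S j d hj hs hdecl hfull hnone hd hbest =>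
    obtain rfl : d.cls = j := hd.2.1
    have h1 := Config.not_isDeclared_normal hdecl
    rw [Config.type2Full_iff] at hfull
    simp only [Config.normal_negative, Config.normal_positive] at h1 hfull ⊢
    exact .pair _ d.toRegular hs hj hd.2.2.1 h1 hfull
  | largeTwoNew S j hj hs hdecl hfull hnone hnone' =>
    rw [Config.normal_positive]
    exact .two _ j hs hj (Config.not_isDeclared_normal hdecl)
      (fun h => hfull ((Config.type2Full_iff _ _).mpr h))

/-- A container that may occur. -/
def Container.IsValid (c : Container) : Prop :=
  (∀ s ∈ c.items, InClass s c.cls) ∧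
    ((c.cls = 1 ∧ c.type = 1 ∧ c.items.card = 1) ∨
      (IsLarge c.cls ∧ ((c.type = 1 ∧ c.items.card = 1) ∨
        (c.type = 2 ∧ (c.items.card = 1 ∨ c.items.card = 2)))) ∨
      (lastLarge < c.cls ∧ 0 < α c.type c.cls ∧ 1 ≤ c.items.card))

/-- The properties of the containers that hold at all times. -/
structure Good (I : List ℚ) (M : Multiset Container) : Prop where
  valid : ∀ c ∈ M, c.IsValid
  items : (M.map Container.items).sum = (I : Multiset ℚ)
  opened : ∀ j, countOpen M j ≤ 1
  small : ∀ i j, lastLarge < j → countType M i j ≤ ⌊α i j * countClass M j⌋₊ + 1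
  le_target : ∀ j, IsLarge j → countType M 2 j ≤ target M j
  target_le : ∀ j, IsLarge j → target M j ≤ countType M 2 j + 1
  declared : ∀ j, IsLarge j → countDeclared M j + target M j ≤ countType M 2 j + 2

/-! ### Preservation of the counting invariants -/

theorem floor_mul_mono (a : ℚ) {m n : ℕ} (h : m ≤ n) : ⌊a * m⌋₊ ≤ ⌊a * n⌋₊ := by
  rcases le_total 0 a with h0 | h0
  · exact Nat.floor_le_floor (mul_le_mul_of_nonneg_left (Nat.cast_le.mpr h) h0)
  · rw [Nat.floor_of_nonpos (mul_nonpos_of_nonpos_of_nonneg h0 (Nat.cast_nonneg m))]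
    exact Nat.zero_le _

theorem floor_mul_succ_le {a : ℚ} (h0 : 0 ≤ a) (h1 : a ≤ 1) (n : ℕ) :
    ⌊a * (n + 1 : ℕ)⌋₊ ≤ ⌊a * n⌋₊ + 1 := by
  rw [← Nat.floor_add_one (by positivity)]
  refine Nat.floor_le_floor ?_
  push_cast
  linarith

theorem Good.nil : Good [] 0 := by
  refine ⟨by simp, by simp, fun j => by simp [countOpen], fun i j _ => by simp [countType],
    fun j _ => by simp [countType], fun j _ => ?_, fun j _ => ?_⟩ <;>
  simp [target, countClass, countDeclared]

theorem countClass_cons (c : Container) (M : Multiset Container) (j : ℕ) :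
    countClass (c ::ₘ M) j = countClass M j + if c.cls = j then 1 else 0 :=
  Multiset.countP_cons _ _ _

theorem countType_cons (c : Container) (M : Multiset Container) (i j : ℕ) :
    countType (c ::ₘ M) i j = countType M i j + if c.cls = j ∧ c.type = i then 1 else 0 :=
  Multiset.countP_cons _ _ _

open Classical in
theorem countDeclared_cons (c : Container) (M : Multiset Container) (j : ℕ) :
    countDeclared (c ::ₘ M) j = countDeclared M j + if c.IsDeclared j then 1 else 0 :=
  Multiset.countP_cons _ _ _

open Classical in
theorem countOpen_cons (c : Container) (M : Multiset Container) (j : ℕ) :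
    countOpen (c ::ₘ M) j = countOpen M j + if c.IsOpen j then 1 else 0 :=
  Multiset.countP_cons _ _ _

theorem Container.not_isOpen {c : Container} (h : c.cls ≤ lastLarge) (j : ℕ) : ¬ c.IsOpen j :=
  fun ho => absurd ho.1 (by rw [← ho.2.1]; omega)

theorem Container.IsOpen.of_add {c : Container} {s : ℚ} (hs : 0 < s) {j : ℕ}
    (h : (c.add s).IsOpen j) : c.IsOpen j := by
  refine ⟨h.1, h.2.1, ?_⟩
  have h2 := h.2.2
  simp only [Container.add, Multiset.sum_cons, Multiset.card_cons] at h2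
  split_ifs at h2 ⊢
  · linarith
  · omega

theorem Container.IsValid.single {i j : ℕ} {s : ℚ} (hs : InClass s j)
    (h : (j = 1 ∧ i = 1) ∨ (IsLarge j ∧ (i = 1 ∨ i = 2)) ∨ (lastLarge < j ∧ 0 < α i j)) :
    (single i j s).IsValid := by
  refine ⟨by simpa [AdvancedHarmonic.single] using hs, ?_⟩
  simpa [AdvancedHarmonic.single] using h

theorem Container.IsValid.of_large {c : Container} (h : c.IsValid) (hc : IsLarge c.cls) :
    (c.type = 1 ∧ c.items.card = 1) ∨ (c.type = 2 ∧ (c.items.card = 1 ∨ c.items.card = 2)) := by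
  rcases h.2 with h | h | h
  · exact absurd hc.1 (by omega)
  · exact h.2
  · exact absurd hc.2 (by omega)

theorem Change.valid {s : ℚ} {M M' : Multiset Container} (h : Change s M M')
    (hM : ∀ c ∈ M, c.IsValid) : ∀ c ∈ M', c.IsValid := by
  have hcons : ∀ {c : Container} {M : Multiset Container}, c.IsValid → (∀ c ∈ M, c.IsValid) →
      ∀ d ∈ c ::ₘ M, d.IsValid := by
    intro c M hc hM d hd
    rcases Multiset.mem_cons.mp hd with rfl | hd
    · exact hc
    · exact hM d hd
  cases h with
  | huge _ hs => exact hcons (.single hs (.inl ⟨rfl, rfl⟩)) hM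
  | fill M c j hs hc =>
    obtain ⟨h1, h2⟩ := hM c (Multiset.mem_cons_self _ _)
    have hj : c.cls = j := hc.elim (fun h => h.2.1) fun h => h.2.1
    refine hcons ⟨?_, ?_⟩ fun d hd => hM d (Multiset.mem_cons_of_mem hd)
    · intro x hx
      rcases Multiset.mem_cons.mp hx with rfl | hx
      · exact hj ▸ hs
      · exact h1 x hx
    · rcases hc with hc | hc
      · have := hc.1
        rw [← hj] at this
        refine .inr (.inr ⟨this, ?_, by simp [Container.add]⟩)
        rcases h2 with h2 | h2 | h2
        · exact absurd this (by rw [h2.1]; unfold lastLarge; omega)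
        · exact absurd this (not_lt.mpr h2.1.2)
        · exact h2.2.1
      · refine .inr (.inl ⟨hj ▸ hc.1, .inr ⟨hc.2.2.1, .inr ?_⟩⟩)
        simp [Container.add, hc.2.2.2]
  | small _ i j hs h => exact hcons (.single hs (.inr (.inr ⟨h.1, h.2.2.1⟩))) hM
  | convert M d i j hs h hd hd1 hlt =>
    refine hcons (.single hs (.inr (.inr ⟨h.1, h.2.2.1⟩)))
      (hcons ?_ fun d hd => hM d (Multiset.mem_cons_of_mem hd))
    have hv := hM d (Multiset.mem_cons_self _ _)
    have := hv.of_large hd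
    exact ⟨hv.1, .inr (.inl ⟨hd, .inr ⟨rfl, by simp only [Container.toType2]; omega⟩⟩)⟩
  | one _ j hs hj => exact hcons (.single hs (.inr (.inl ⟨hj, .inl rfl⟩))) hM
  | two _ j hs hj => exact hcons (.single hs (.inr (.inl ⟨hj, .inr rfl⟩))) hM
  | pair M d hs hd hd1 =>
    refine hcons ?_ fun d hd => hM d (Multiset.mem_cons_of_mem hd)
    have hv := hM d (Multiset.mem_cons_self _ _)
    have := hv.of_large hd
    refine ⟨?_, .inr (.inl ⟨hd, .inr ⟨rfl, ?_⟩⟩)⟩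
    · intro x hx
      rcases Multiset.mem_cons.mp hx with rfl | hx
      · exact hs
      · exact hv.1 x hx
    · simp only [Container.toType2, Container.add, Multiset.card_cons]
      omega

theorem Change.items {s : ℚ} {M M' : Multiset Container} (h : Change s M M') :
    (M'.map Container.items).sum = s ::ₘ (M.map Container.items).sum := by
  cases h <;> simp [single, Container.add, Container.toType2]

open Classical in
theorem countOpen_eq_zero {M : Multiset Container} {j : ℕ} (h : ∀ c ∈ M, ¬ c.IsOpen j) :
    countOpen M j = 0 := Multiset.countP_eq_zero.mpr h

open Classical in
theorem countDeclared_eq_zero {M : Multiset Container} {j : ℕ}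
    (h : ∀ c ∈ M, ¬ c.IsDeclared j) : countDeclared M j = 0 := Multiset.countP_eq_zero.mpr h

/-- A new container of a small or tiny class is created only when no container of that class is
open, and adding an item can only close a container. -/
theorem Change.opened {s : ℚ} {M M' : Multiset Container} (h : Change s M M') {j : ℕ}
    (hM : countOpen M j ≤ 1) : countOpen M' j ≤ 1 := by
  have hsmall : ∀ {M : Multiset Container} {i j' : ℕ}, Allowed M i j' → countOpen M j ≤ 1 →
      countOpen (single i j' s ::ₘ M) j ≤ 1 := by
    intro M i j' h hM
    rw [countOpen_cons]
    by_cases hj : j' = j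
    · rw [← hj, countOpen_eq_zero h.2.1]
      split_ifs <;> omega
    · rw [if_neg fun ho => hj ho.2.1]
      exact hM
  have hlarge : ∀ {M : Multiset Container} {c : Container}, c.cls ≤ lastLarge →
      countOpen (c ::ₘ M) j = countOpen M j := by
    intro M c hc
    rw [countOpen_cons, if_neg (Container.not_isOpen hc j), add_zero]
  cases h with
  | huge _ hs => rwa [hlarge (by simp [single, lastLarge])]
  | fill M c j' hs hc =>
    rw [countOpen_cons] at hM ⊢
    by_cases ho : (c.add s).IsOpen j
    · rw [if_pos ho]
      rwa [if_pos (ho.of_add hs.pos)] at hM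
    · rw [if_neg ho]
      omega
  | small _ i j' hs h => exact hsmall h hM
  | convert M d i j' hs h hd hd1 hlt =>
    have h2 := hsmall h hM
    rw [Multiset.cons_swap, hlarge hd.2] at h2
    rwa [Multiset.cons_swap, hlarge (c := d.toType2) hd.2]
  | one _ j hs hj => rwa [hlarge (c := single 1 j s) hj.2]
  | two _ j hs hj => rwa [hlarge (c := single 2 j s) hj.2]
  | pair M d hs hd hd1 =>
    rw [hlarge hd.2] at hM
    rwa [hlarge (c := d.toType2.add s) hd.2]

/-- A new container has a type whose number did not exceed its floor before, and the floors are
monotone in the number of containers of the class; so the excess never goes beyond one. -/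
theorem Change.small_le {s : ℚ} {M M' : Multiset Container} (h : Change s M M') {i j : ℕ}
    (hj : lastLarge < j) (hM : countType M i j ≤ ⌊α i j * countClass M j⌋₊ + 1) :
    countType M' i j ≤ ⌊α i j * countClass M' j⌋₊ + 1 := by
  have hsmall : ∀ {M : Multiset Container} {i' j' : ℕ},
      countType M i' j' ≤ ⌊α i' j' * countClass M j'⌋₊ →
      countType M i j ≤ ⌊α i j * countClass M j⌋₊ + 1 →
      countType (single i' j' s ::ₘ M) i j
        ≤ ⌊α i j * countClass (single i' j' s ::ₘ M) j⌋₊ + 1 := by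
    intro M i' j' h hM
    have hmono : ⌊α i j * countClass M j⌋₊ ≤ ⌊α i j * countClass (single i' j' s ::ₘ M) j⌋₊ :=
      floor_mul_mono _ (by rw [countClass_cons]; omega)
    rw [countType_cons]
    split_ifs with hc
    · obtain ⟨rfl, rfl⟩ : j' = j ∧ i' = i := hc
      omega
    · omega
  have hlarge : ∀ {M : Multiset Container} {c : Container}, c.cls ≤ lastLarge →
      countType (c ::ₘ M) i j = countType M i j ∧ countClass (c ::ₘ M) j = countClass M j := by
    intro M c hc
    rw [countType_cons, countClass_cons, if_neg (by omega), if_neg (by omega)]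
    exact ⟨rfl, rfl⟩
  cases h with
  | huge _ hs =>
    obtain ⟨h1, h2⟩ := hlarge (M := M) (c := single 1 1 s) (by simp [single, lastLarge])
    rwa [h1, h2]
  | fill M c j' hs hc => rwa [countType_cons, countClass_cons] at hM ⊢
  | small _ i' j' hs h => exact hsmall h.2.2.2 hM
  | convert M d i' j' hs h hd hd1 hlt =>
    have h2 := hsmall h.2.2.2 hM
    rw [Multiset.cons_swap, (hlarge hd.2).1, (hlarge hd.2).2] at h2
    rwa [Multiset.cons_swap, (hlarge (c := d.toType2) hd.2).1, (hlarge (c := d.toType2) hd.2).2]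
  | one _ j' hs hj' =>
    obtain ⟨h1, h2⟩ := hlarge (M := M) (c := single 1 j' s) hj'.2
    rwa [h1, h2]
  | two _ j' hs hj' =>
    obtain ⟨h1, h2⟩ := hlarge (M := M) (c := single 2 j' s) hj'.2
    rwa [h1, h2]
  | pair M d hs hd hd1 =>
    obtain ⟨h1, h2⟩ := hlarge (M := M) (c := d) hd.2
    rw [h1, h2] at hM
    obtain ⟨h1, h2⟩ := hlarge (M := M) (c := d.toType2.add s) hd.2
    rwa [h1, h2]

/-- The numbers of type 2 containers of a large class are close to their targets. -/
def Balanced (M : Multiset Container) (j : ℕ) : Prop :=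
  countType M 2 j ≤ target M j ∧ target M j ≤ countType M 2 j + 1 ∧
    countDeclared M j + target M j ≤ countType M 2 j + 2

theorem target_cons_of_ne {c : Container} {M : Multiset Container} {j : ℕ} (h : c.cls ≠ j) :
    target (c ::ₘ M) j = target M j := by
  rw [target, target, countClass_cons, if_neg h, add_zero]

theorem balanced_cons_of_ne {c : Container} {M : Multiset Container} {j : ℕ} (h : c.cls ≠ j) :
    Balanced (c ::ₘ M) j ↔ Balanced M j := by
  rw [Balanced, Balanced, target_cons_of_ne h, countType_cons, countDeclared_cons,
    if_neg (fun h' => h h'.1), if_neg (fun h' => h h'.2.1)]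
  rfl

theorem target_congr {M M' : Multiset Container} {j : ℕ} (h : countClass M j = countClass M' j) :
    target M j = target M' j := by rw [target, target, h]

/-- A new large container raises the target by at most one, since `α 2 j ≤ 1`; it has type 1 only if
the target was attained, and type 2 only if one container was missing. Declared containers arise
either when there is none, or by a conversion, which needs a missing type 2 container and fills the
gap. Thus there are at most two of them, and at most one while the target is missed, which is what
the third inequality records. -/
theorem Change.balanced {s : ℚ} {M M' : Multiset Container} (h : Change s M M')
    (hv : ∀ c ∈ M, c.IsValid) {j : ℕ} (hj : IsLarge j) (hM : Balanced M j) : Balanced M' j := by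
  have hj' := hj
  unfold IsLarge lastLarge at hj'
  cases h with
  | huge _ hs =>
    rw [balanced_cons_of_ne]
    · exact hM
    · simp only [single]
      omega
  | fill M c j' hs hc =>
    obtain ⟨h1, h2, h3⟩ := hM
    have ht : target (c.add s ::ₘ M) j = target (c ::ₘ M) j :=
      target_congr (by rw [countClass_cons, countClass_cons]; rfl)
    have hn : countType (c.add s ::ₘ M) 2 j = countType (c ::ₘ M) 2 j := by
      rw [countType_cons, countType_cons]; rfl
    have hd : countDeclared (c.add s ::ₘ M) j ≤ countDeclared (c ::ₘ M) j := by
      rw [countDeclared_cons, countDeclared_cons]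
      by_cases hd : (c.add s).IsDeclared j
      · have hcj : c.cls = j := hd.2.1
        have hcard : c.items.card = 0 := by
          have := hd.2.2.2
          simp only [Container.add, Multiset.card_cons] at this
          omega
        have := (hv c (Multiset.mem_cons_self _ _)).of_large (hcj ▸ hj)
        omega
      · rw [if_neg hd]
        omega
    rw [Balanced, ht, hn]
    omega
  | small _ i j' hs h =>
    rw [balanced_cons_of_ne]
    · exact hM
    · have := h.1
      unfold lastLarge at this
      simp only [single]
      omega
  | convert M d i j' hs h hd hd1 hlt =>
    rw [balanced_cons_of_ne]
    · by_cases hdj : d.cls = j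
      · subst hdj
        obtain ⟨h1, h2, h3⟩ := hM
        have ht : target (d.toType2 ::ₘ M) d.cls = target (d ::ₘ M) d.cls :=
          target_congr (by rw [countClass_cons, countClass_cons]; rfl)
        have hn : countType (d.toType2 ::ₘ M) 2 d.cls = countType (d ::ₘ M) 2 d.cls + 1 := by
          rw [countType_cons, countType_cons, if_pos ⟨rfl, rfl⟩, if_neg (by omega)]
        have hdd : countDeclared (d.toType2 ::ₘ M) d.cls ≤ countDeclared (d ::ₘ M) d.cls + 1 := by
          rw [countDeclared_cons, countDeclared_cons]
          split_ifs <;> omega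
        rw [Balanced, ht, hn]
        omega
      · rw [balanced_cons_of_ne hdj] at hM
        rwa [balanced_cons_of_ne (c := d.toType2) hdj]
    · have := h.1
      unfold lastLarge at this
      simp only [single]
      omega
  | one _ j' hs hj' hdecl hfull =>
    by_cases hjj : j' = j
    · subst hjj
      obtain ⟨h1, h2, h3⟩ := hM
      have ht1 : target M j' ≤ target (single 1 j' s ::ₘ M) j' :=
        floor_mul_mono _ (by rw [countClass_cons]; omega)
      have ht2 : target (single 1 j' s ::ₘ M) j' ≤ target M j' + 1 := by
        rw [target, countClass_cons, if_pos (show (single 1 j' s).cls = j' from rfl)]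
        exact floor_mul_succ_le hj.alpha_bounds.1.le hj.alpha_bounds.2 _
      have hn : countType (single 1 j' s ::ₘ M) 2 j' = countType M 2 j' := by
        rw [countType_cons, if_neg (by simp [single])]
        rfl
      have hd : countDeclared (single 1 j' s ::ₘ M) j' = 0 := by
        rw [countDeclared_cons, countDeclared_eq_zero hdecl, if_neg (fun h => by
          simpa [single] using h.2.2.1)]
      rw [Balanced, hn, hd]
      omega
    · exact (balanced_cons_of_ne (c := single 1 j' s) hjj).mpr hM
  | two _ j' hs hj' hdecl hfull =>
    by_cases hjj : j' = j
    · subst hjj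
      obtain ⟨h1, h2, h3⟩ := hM
      have ht1 : target M j' ≤ target (single 2 j' s ::ₘ M) j' :=
        floor_mul_mono _ (by rw [countClass_cons]; omega)
      have ht2 : target (single 2 j' s ::ₘ M) j' ≤ target M j' + 1 := by
        rw [target, countClass_cons, if_pos (show (single 2 j' s).cls = j' from rfl)]
        exact floor_mul_succ_le hj.alpha_bounds.1.le hj.alpha_bounds.2 _
      have hn : countType (single 2 j' s ::ₘ M) 2 j' = countType M 2 j' + 1 := by
        rw [countType_cons, if_pos ⟨rfl, rfl⟩]
      have hd : countDeclared (single 2 j' s ::ₘ M) j' ≤ 1 := by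
        rw [countDeclared_cons, countDeclared_eq_zero hdecl]
        split_ifs <;> omega
      rw [Balanced, hn]
      omega
    · exact (balanced_cons_of_ne (c := single 2 j' s) hjj).mpr hM
  | pair M d hs hd hd1 hdecl hfull =>
    by_cases hdj : d.cls = j
    · subst hdj
      obtain ⟨h1, h2, h3⟩ := hM
      have ht : target (d.toType2.add s ::ₘ M) d.cls = target (d ::ₘ M) d.cls :=
        target_congr (by rw [countClass_cons, countClass_cons]; rfl)
      have hn : countType (d.toType2.add s ::ₘ M) 2 d.cls = countType (d ::ₘ M) 2 d.cls + 1 := by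
        rw [countType_cons, countType_cons, if_pos ⟨rfl, rfl⟩, if_neg (by omega)]
      have hd0 : countDeclared M d.cls = 0 :=
        countDeclared_eq_zero fun c hc => hdecl c (Multiset.mem_cons_of_mem hc)
      have hdd : countDeclared (d.toType2.add s ::ₘ M) d.cls ≤ 1 := by
        rw [countDeclared_cons, hd0]
        split_ifs <;> omega
      rw [Balanced, ht, hn]
      omega
    · rw [balanced_cons_of_ne hdj] at hM
      rwa [balanced_cons_of_ne (c := d.toType2.add s) hdj]

theorem Good.change {I : List ℚ} {s : ℚ} {M M' : Multiset Container} (hM : Good I M)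
    (h : Change s M M') : Good (I ++ [s]) M' := by
  have hb := fun j hj => h.balanced hM.valid hj ⟨hM.le_target j hj, hM.target_le j hj,
    hM.declared j hj⟩
  refine ⟨h.valid hM.valid, ?_, fun j => h.opened (hM.opened j),
    fun i j hj => h.small_le hj (hM.small i j hj), fun j hj => (hb j hj).1,
    fun j hj => (hb j hj).2.1, fun j hj => (hb j hj).2.2⟩
  rw [h.items, hM.items, Multiset.cons_coe, Multiset.coe_eq_coe]
  exact (List.perm_append_singleton s I).symm

theorem Run.good {I : List ℚ} {S : Config} (h : Run I S) : Good I S.normal := by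
  induction h with
  | nil => exact Good.nil
  | snoc _ hs ih => exact ih.change hs.change

/-! ### The bins of a configuration -/

theorem IsLarge.third_le {j : ℕ} (hj : IsLarge j) : 1 / 3 ≤ t j := by
  have h : t 165 = 1 / 3 := by norm_num [t]
  exact h ▸ t_antitone hj.2

theorem IsLarge.half_lt_A {j : ℕ} (hj : IsLarge j) : 1 / 2 < A 2 j := by
  have h1 := hj.third_le
  have h2 := t_antitone (Nat.sub_le j 1)
  have h3 : j ≠ tinyClass := fun h => absurd hj.2 (by rw [h]; decide)
  rw [A, if_neg h3]
  push_cast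
  linarith

theorem IsLarge.ne_one {j : ℕ} (hj : IsLarge j) : j ≠ 1 := by
  have := hj.1
  omega

theorem InClass.le_half {s : ℚ} {j : ℕ} (h : InClass s j) (hj : IsLarge j) : s ≤ 1 / 2 := by
  have h1 := hj.1
  exact h.2.trans (t_one ▸ t_antitone (show 1 ≤ j - 1 by omega))

namespace Container

theorem volume_of_type_one {c : Container} (hc : c.cls ≤ lastLarge) (h : c.type = 1) :
    c.volume = c.items.sum := if_pos ⟨hc, h⟩

theorem volume_of_type_ne_one {c : Container} (h : c.type ≠ 1) : c.volume = A c.type c.cls :=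
  if_neg fun h' => h h'.2

theorem volume_of_lt {c : Container} (h : lastLarge < c.cls) : c.volume = A c.type c.cls :=
  if_neg fun h' => absurd h'.1 (not_le.mpr h)

theorem volume_add {c : Container} {s : ℚ} {j : ℕ} (h : c.IsOpen j ∨ c.IsDeclared j) :
    (c.add s).volume = c.volume := by
  rcases h with h | h
  · have hj := h.1
    rw [← h.2.1] at hj
    rw [volume_of_lt (c := c.add s) hj, volume_of_lt hj]
    rfl
  · have : c.type ≠ 1 := by rw [h.2.2.1]; decide
    rw [volume_of_type_ne_one (c := c.add s) this, volume_of_type_ne_one this]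
    rfl

theorem half_lt_volume {c : Container} (h : IsLarge c.cls) (hc : c.type = 2) :
    1 / 2 < c.volume := by
  rw [volume_of_type_ne_one (by rw [hc]; decide), hc]
  exact h.half_lt_A

theorem Fits.symm {c d : Container} (h : c.Fits d) : d.Fits c := by
  unfold Fits at h ⊢
  rwa [add_comm]

end Container

theorem volume_single_one {j : ℕ} (hj : j ≤ lastLarge) (s : ℚ) : (single 1 j s).volume = s := by
  rw [Container.volume_of_type_one (c := single 1 j s) hj rfl]
  exact Multiset.sum_singleton s

theorem volume_newTemp {j : ℕ} (hj : j ≤ lastLarge) (s : ℚ) : (newTemp j s).volume = s := by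
  rw [Container.volume_of_type_one (c := newTemp j s) hj rfl]
  exact Multiset.sum_singleton s

/-- The properties of the bins that hold at all times; in particular, a negative and a positive bin
never fit together. -/
structure Separated (S : Config) : Prop where
  neg : ∀ n, Bin.negative n ∈ S → n.IsNegative ∧ (IsLarge n.cls → n.IsTemp n.cls)
  pos : ∀ p, Bin.positive p ∈ S → p.IsPositive
  neutral : ∀ n p, Bin.neutral n p ∈ S → n.IsNegative ∧ p.IsPositive
  apart : ∀ n p, Bin.negative n ∈ S → Bin.positive p ∈ S → ¬ n.Fits p

namespace Separated

variable {S : Config}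

theorem of_cons {B : Bin} (h : Separated (B ::ₘ S)) : Separated S :=
  ⟨fun n hn => h.neg n (Multiset.mem_cons_of_mem hn),
    fun n hn => h.pos n (Multiset.mem_cons_of_mem hn),
    fun n p hn => h.neutral n p (Multiset.mem_cons_of_mem hn),
    fun n p hn hp => h.apart n p (Multiset.mem_cons_of_mem hn) (Multiset.mem_cons_of_mem hp)⟩

theorem cons_negative (h : Separated S) {n : Container} (hn : n.IsNegative)
    (ht : IsLarge n.cls → n.IsTemp n.cls) (ha : ∀ p, Bin.positive p ∈ S → ¬ n.Fits p) :
    Separated (.negative n ::ₘ S) where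
  neg n' h' := by
    rcases Multiset.mem_cons.mp h' with h' | h'
    · injection h' with h'
      exact h' ▸ ⟨hn, ht⟩
    · exact h.neg n' h'
  pos p h' := h.pos p ((Multiset.mem_cons.mp h').resolve_left (by simp))
  neutral n p h' := h.neutral n p ((Multiset.mem_cons.mp h').resolve_left (by simp))
  apart n' p h' hp := by
    have hp' := (Multiset.mem_cons.mp hp).resolve_left (by simp)
    rcases Multiset.mem_cons.mp h' with h' | h'
    · injection h' with h'
      exact h' ▸ ha p hp'
    · exact h.apart n' p h' hp'

theorem cons_positive (h : Separated S) {p : Container} (hp : p.IsPositive)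
    (ha : ∀ n, Bin.negative n ∈ S → ¬ n.Fits p) : Separated (.positive p ::ₘ S) where
  neg n h' := h.neg n ((Multiset.mem_cons.mp h').resolve_left (by simp))
  pos p' h' := by
    rcases Multiset.mem_cons.mp h' with h' | h'
    · injection h' with h'
      exact h' ▸ hp
    · exact h.pos p' h'
  neutral n p h' := h.neutral n p ((Multiset.mem_cons.mp h').resolve_left (by simp))
  apart n p' hn h' := by
    have hn' := (Multiset.mem_cons.mp hn).resolve_left (by simp)
    rcases Multiset.mem_cons.mp h' with h' | h'
    · injection h' with h'
      exact h' ▸ ha n hn'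
    · exact h.apart n p' hn' h'

theorem cons_neutral (h : Separated S) {n p : Container} (hn : n.IsNegative) (hp : p.IsPositive) :
    Separated (.neutral n p ::ₘ S) where
  neg n h' := h.neg n ((Multiset.mem_cons.mp h').resolve_left (by simp))
  pos p h' := h.pos p ((Multiset.mem_cons.mp h').resolve_left (by simp))
  neutral n' p' h' := by
    rcases Multiset.mem_cons.mp h' with h' | h'
    · injection h' with h1 h2
      exact ⟨h1 ▸ hn, h2 ▸ hp⟩
    · exact h.neutral n' p' h'
  apart n p hn hp := h.apart n p ((Multiset.mem_cons.mp hn).resolve_left (by simp))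
    ((Multiset.mem_cons.mp hp).resolve_left (by simp))

theorem replace {c : Container} {s : ℚ} {j : ℕ} {B B' : Bin} (h : Separated (B ::ₘ S))
    (hc : c.IsOpen j ∨ c.IsDeclared j) (hB : Bin.Replace c (c.add s) B B') :
    Separated (B' ::ₘ S) := by
  have hv : (c.add s).volume = c.volume := Container.volume_add hc
  cases hB with
  | negative =>
    obtain ⟨h1, h2⟩ := h.neg c (Multiset.mem_cons_self _ _)
    refine h.of_cons.cons_negative (hv.le.trans h1) h2 fun p hp hf => ?_
    unfold Container.Fits at hf
    rw [hv] at hf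
    exact h.apart c p (Multiset.mem_cons_self _ _) (Multiset.mem_cons_of_mem hp) hf
  | positive =>
    refine h.of_cons.cons_positive ((h.pos c (Multiset.mem_cons_self _ _)).trans_eq hv.symm)
      fun n hn hf => ?_
    unfold Container.Fits at hf
    rw [hv] at hf
    exact h.apart n c (Multiset.mem_cons_of_mem hn) (Multiset.mem_cons_self _ _) hf
  | neutralLeft p =>
    obtain ⟨h1, h2⟩ := h.neutral c p (Multiset.mem_cons_self _ _)
    exact h.of_cons.cons_neutral (hv.le.trans h1) h2
  | neutralRight n =>
    obtain ⟨h1, h2⟩ := h.neutral n c (Multiset.mem_cons_self _ _)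
    exact h.of_cons.cons_neutral h1 (h2.trans_eq hv.symm)

theorem placeNew {S' : Config} (h : Separated S) {i j : ℕ} {s : ℚ} (hj : lastLarge < j)
    (hS : PlaceNew (single i j s) S S') : Separated S' := by
  cases hS with
  | negToPositive S p hc hp => exact h.of_cons.cons_neutral hc (h.pos p (Multiset.mem_cons_self _ _))
  | negToTemp S d hc hnone hd hbest =>
    exact h.of_cons.cons_neutral hc (Container.half_lt_volume (c := d.toType2) hd.1.1 rfl)
  | negToNew S hc hnone hnone' =>
    exact h.cons_negative hc (fun hl => absurd hl.2 (not_le.mpr hj))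
      fun p hp hf => hnone p hp hf.symm
  | posToNegative S n hc hn hfit =>
    exact h.of_cons.cons_neutral (h.neg n (Multiset.mem_cons_self _ _)).1 hc
  | posToTemp S d hc hnone hd hfit hbest =>
    exact h.of_cons.cons_neutral (n := d.toRegular) (h.neg d (Multiset.mem_cons_self _ _)).1 hc
  | posToNew S hc hnone => exact h.cons_positive hc hnone

/-- A lone container goes to a new bin only if no bin of the opposite sign can take it. The other
way to obtain a positive bin is to complete a temporary container to type 2; its volume is that of a
new declared container, which was just found to fit into no negative bin. -/
theorem step {S' : Config} {s : ℚ} (h : Separated S) (hS : Step s S S') : Separated S' := by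
  have hhuge : InClass s 1 → (single 1 1 s).IsPositive := by
    intro hs
    rw [Container.IsPositive, volume_single_one (by decide)]
    exact t_one ▸ hs.1
  have hneg : ∀ j, IsLarge j → InClass s j → (single 1 j s).IsNegative := by
    intro j hj hs
    rw [Container.IsNegative, volume_single_one hj.2]
    exact hs.le_half hj
  cases hS with
  | hugeBestFit S n hs hfit hbest =>
    exact h.of_cons.cons_neutral (n := n.toRegular) (h.neg n (Multiset.mem_cons_self _ _)).1
      (hhuge hs)
  | hugeNew S hs hnone => exact h.cons_positive (hhuge hs) hnone
  | smallOpen S j B B' c hj hs hc hB => exact h.replace (.inl hc) hB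
  | smallNew S S' i j hj hs hopen hi hmin hplace => exact h.placeNew hj hplace
  | largeDeclared S j B B' c hj hs hc hB => exact h.replace (.inr hc) hB
  | largeOneBestFit S j p hj hs hdecl hfull hfit hbest =>
    exact h.of_cons.cons_neutral (hneg j hj hs) (h.pos p (Multiset.mem_cons_self _ _))
  | largeOneNew S j hj hs hdecl hfull hnone =>
    refine h.cons_negative (hneg j hj hs) (fun _ => ⟨hj, rfl, rfl, rfl⟩) fun p hp hf => ?_
    exact hnone p hp (Container.Fits.symm (c := single 1 j s) hf)
  | largeTwoNegative S j n hj hs hdecl hfull hfit =>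
    exact h.of_cons.cons_neutral (h.neg n (Multiset.mem_cons_self _ _)).1
      (Container.half_lt_volume hj rfl)
  | largeTwoTemp S j d hj hs hdecl hfull hnone hd hbest =>
    obtain rfl : d.cls = j := hd.2.1
    exact h.of_cons.cons_positive (p := d.toType2.add s) (Container.half_lt_volume hj rfl)
      fun n hn hf => hnone n (Multiset.mem_cons_of_mem hn) (by
        rw [Container.Fits, Container.volume_of_type_ne_one (c := d.toType2.add s) (by
          simp [Container.toType2, Container.add])] at hf
        rwa [Container.Fits, Container.volume_of_type_ne_one (c := single 2 d.cls s) (by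
          simp [single])])
  | largeTwoNew S j hj hs hdecl hfull hnone hnone' =>
    exact h.cons_positive (Container.half_lt_volume hj rfl) hnone

end Separated

theorem Run.separated {I : List ℚ} {S : Config} (h : Run I S) : Separated S := by
  induction h with
  | nil => exact ⟨by simp, by simp, by simp, by simp⟩
  | snoc _ hs ih => exact ih.step hs

/-! ### Large items below a threshold -/

/-- The number of items that are smaller than `v`. -/
def Container.countBelow (v : ℚ) (c : Container) : ℕ := c.items.countP (· < v)

open Classical in
/-- The contribution of a container to `gain`. -/
noncomputable def gainContainer (k : ℕ) (v w m : ℚ) (c : Container) : ℚ :=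
  if c.cls = k then
    (if c.type = 1 then w else m) - m * c.countBelow v - (if c.IsDeclared k then m else 0)
  else 0

/-- The contribution of a bin to `gain`. -/
noncomputable def gainBin (k : ℕ) (v w m : ℚ) : Bin → ℚ
  | .negative n => gainContainer k v w m n - if n.cls = k ∧ v ≤ n.volume then w else 0
  | .positive p => gainContainer k v w m p
  | .neutral n p => gainContainer k v w m n + gainContainer k v w m p +
      if p.cls = k ∧ p.type = 2 then m else 0

/-- A quantity that never becomes negative. Thus, if there are many temporary type 1 containers of
class `k` whose items are at least `v`, then there are few items of class `k` below `v`. -/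
noncomputable def gain (k : ℕ) (v w m : ℚ) (S : Config) : ℚ := (S.map (gainBin k v w m)).sum

section gain

variable {k : ℕ} {v w m : ℚ}

theorem gainContainer_of_ne {c : Container} (h : c.cls ≠ k) : gainContainer k v w m c = 0 :=
  if_neg h

theorem gain_cons (B : Bin) (S : Config) :
    gain k v w m (B ::ₘ S) = gainBin k v w m B + gain k v w m S := by
  rw [gain, Multiset.map_cons, Multiset.sum_cons, gain]

theorem countBelow_add_le (c : Container) (s : ℚ) :
    (c.add s).countBelow v ≤ c.countBelow v + 1 := by
  rw [Container.countBelow, Container.add, Multiset.countP_cons, Container.countBelow]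
  split_ifs <;> omega

theorem countBelow_single (i j : ℕ) (s : ℚ) :
    (single i j s).countBelow v = if s < v then 1 else 0 := by
  rw [Container.countBelow, single, ← Multiset.cons_zero, Multiset.countP_cons]
  simp

/-- A new type 1 container does not decrease the gain. -/
theorem gainContainer_single_one (j : ℕ) (s : ℚ) (hm : m ≤ w) (hw : 0 ≤ w) :
    0 ≤ gainContainer k v w m (single 1 j s) := by
  unfold gainContainer
  split_ifs with h1 h2 h3 h3
  · exact absurd h3.2.2.1 (by simp [single])
  · rw [countBelow_single]
    split_ifs <;> norm_num <;> assumption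
  · exact absurd rfl h2
  · exact absurd rfl h2
  · exact le_rfl

theorem neg_le_gainContainer_type_two {c : Container} (h : c.cls = k) (hc : c.type = 2)
    (hm : 0 ≤ m) : - (m * c.countBelow v) ≤ gainContainer k v w m c := by
  unfold gainContainer
  rw [if_pos h, if_neg (by omega)]
  split_ifs <;> linarith

theorem gainContainer_of_card {c : Container} (h : c.cls = k) (hc : c.type = 2)
    (hcard : c.items.card ≠ 1) : gainContainer k v w m c = m - m * c.countBelow v := by
  unfold gainContainer
  rw [if_pos h, if_neg (by omega), if_neg fun h => hcard h.2.2.2, sub_zero]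

theorem gainContainer_le_of_type_one {c : Container} (h : c.cls = k) (hc : c.type = 1)
    (hm : 0 ≤ m) : gainContainer k v w m c ≤ w - m * c.countBelow v := by
  unfold gainContainer
  rw [if_pos h, if_pos hc]
  split_ifs <;> linarith

theorem gainBin_replace {c c' : Container} {B B' : Bin} (hB : Bin.Replace c c' B B')
    (hcls : c'.cls = c.cls) (htype : c'.type = c.type) (hvol : c'.volume = c.volume)
    (hg : gainContainer k v w m c ≤ gainContainer k v w m c') :
    gainBin k v w m B ≤ gainBin k v w m B' := by
  cases hB <;> simp only [gainBin, hcls, htype, hvol] <;> linarith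

/-- Small and tiny containers contribute nothing themselves, and turning a negative bin with a type
1 container into a neutral bin can only remove the penalty `w`. The one critical move is the
conversion of a temporary container of class `k` to type 2. -/
theorem gain_placeNew {S S' : Config} (hk : IsLarge k) (h : Separated S) {i j : ℕ} {s : ℚ}
    (hj : lastLarge < j) (hS : PlaceNew (single i j s) S S') (hm : 0 ≤ m) (hw : 0 ≤ w)
    (hT : ∃ n, Bin.negative n ∈ S' ∧ n.cls = k ∧ v ≤ n.volume) :
    gain k v w m S ≤ gain k v w m S' := by
  have hjk : j ≠ k := fun h => absurd hk.2 (by omega)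
  have h0 : gainContainer k v w m (single i j s) = 0 := gainContainer_of_ne hjk
  have hjk' : (single i j s).cls ≠ k := hjk
  cases hS with
  | negToPositive S p hc hp =>
    simp only [gain_cons, gainBin, h0]
    split_ifs <;> linarith
  | negToTemp S d hc hnone hd hbest =>
    simp only [gain_cons, gainBin, h0]
    by_cases hdk : d.cls = k
    -- A remaining temporary container of class `k` has volume at least `v`, so the one converted,
    -- being largest, does too. Its credit `w` was cancelled by the penalty of its negative bin,
    -- hence nothing is lost by the conversion.
    · obtain ⟨n, hn, hnk, hnv⟩ := hT
      have hn' : Bin.negative n ∈ S := (Multiset.mem_cons.mp hn).resolve_left (by simp)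
      have htemp := (h.neg n (Multiset.mem_cons_of_mem hn')).2 (hnk ▸ hk)
      have hle := hbest n (Multiset.mem_cons_of_mem hn') (by rw [hdk, ← hnk]; exact htemp)
      rw [if_pos ⟨hdk, hnv.trans hle⟩, if_pos ⟨hdk, rfl⟩]
      have h1 := gainContainer_le_of_type_one (v := v) (w := w) hdk hd.1.2.2.1 hm
      have h2 := neg_le_gainContainer_type_two (v := v) (w := w) (c := d.toType2) hdk rfl hm
      have h3 : d.toType2.countBelow v = d.countBelow v := rfl
      rw [h3] at h2
      linarith
    · rw [gainContainer_of_ne hdk, gainContainer_of_ne (c := d.toType2) hdk,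
        if_neg fun h => hdk h.1, if_neg fun h => hdk h.1]
      linarith
  | negToNew S hc hnone hnone' =>
    simp only [gain_cons, gainBin, h0]
    rw [if_neg fun h => hjk' h.1]
    linarith
  | posToNegative S n hc hn hfit =>
    simp only [gain_cons, gainBin, h0]
    rw [if_neg (c := (single i j s).cls = k ∧ _) fun h => hjk' h.1]
    split_ifs <;> linarith
  | posToTemp S d hc hnone hd hfit hbest =>
    have h1 : gainContainer k v w m d.toRegular = gainContainer k v w m d := rfl
    simp only [gain_cons, gainBin, h0, h1]
    rw [if_neg (c := (single i j s).cls = k ∧ _) fun h => hjk' h.1]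
    split_ifs <;> linarith
  | posToNew S hc hnone =>
    simp only [gain_cons, gainBin, h0]
    linarith

/-- As long as there are temporary type 1 containers of volume at least `v`, the gain does not
decrease. -/
theorem gain_step {S S' : Config} (hk : IsLarge k) (h : Separated S)
    (hv : ∀ c ∈ S.normal, c.IsValid) {s : ℚ}
    (hS : Step s S S') (hm : 0 ≤ m) (hmw : m ≤ w)
    (hT : ∃ n, Bin.negative n ∈ S' ∧ n.cls = k ∧ v ≤ n.volume) :
    gain k v w m S ≤ gain k v w m S' := by
  have hw : 0 ≤ w := hm.trans hmw
  have hhuge : gainContainer k v w m (single 1 1 s) = 0 := gainContainer_of_ne hk.ne_one.symm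
  cases hS with
  | hugeBestFit S n hs hfit hbest =>
    have h1 : gainContainer k v w m n.toRegular = gainContainer k v w m n := rfl
    simp only [gain_cons, gainBin, hhuge, h1]
    split_ifs <;> linarith
  | hugeNew S hs hnone =>
    simp only [gain_cons, gainBin, hhuge]
    linarith
  | smallOpen S j B B' c hj hs hc hB =>
    have hck : c.cls ≠ k := fun h => absurd hk.2 (by have := hc.2.1; omega)
    have := gainBin_replace (k := k) (v := v) (w := w) (m := m) hB rfl rfl
      (Container.volume_add (.inl hc))
      (by rw [gainContainer_of_ne hck, gainContainer_of_ne (c := c.add s) hck])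
    simp only [gain_cons]
    linarith
  | smallNew S S' i j hj hs hopen hi hmin hplace =>
    exact gain_placeNew hk h hj hplace hm hw hT
  | largeDeclared S j B B' c hj hs hc hB =>
    have := gainBin_replace (k := k) (v := v) (w := w) (m := m) hB rfl rfl
      (Container.volume_add (.inr hc)) (by
        by_cases hck : c.cls = k
        · have hc' : c.IsDeclared k := by
            have := hc.2.1
            rwa [← this, hck] at hc
          -- The second item ends the deduction `m` for being declared, which pays for it even if it
          -- is below `v`.
          have h1 : ((c.add s).countBelow v : ℚ) ≤ c.countBelow v + 1 := by
            exact_mod_cast countBelow_add_le c s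
          rw [gainContainer_of_card (c := c.add s) hck hc.2.2.1
            (by simp [Container.add, hc.2.2.2]), gainContainer, if_pos hck,
            if_neg (by have := hc.2.2.1; omega), if_pos hc']
          nlinarith
        · rw [gainContainer_of_ne hck, gainContainer_of_ne (c := c.add s) hck])
    simp only [gain_cons]
    linarith
  | largeOneBestFit S j p hj hs hdecl hfull hfit hbest =>
    have h1 := gainContainer_single_one (k := k) (v := v) j s hmw hw
    simp only [gain_cons, gainBin]
    split_ifs <;> linarith
  | largeOneNew S j hj hs hdecl hfull hnone =>
    have h1 := gainContainer_single_one (k := k) (v := v) j s hmw hw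
    have h2 : gainContainer k v w m (newTemp j s) = gainContainer k v w m (single 1 j s) := rfl
    simp only [gain_cons, gainBin, volume_newTemp hj.2]
    split_ifs with hc
    · have h3 : gainContainer k v w m (single 1 j s) = w := by
        have h4 : (single 1 j s).cls = k := hc.1
        rw [gainContainer, if_pos h4, if_pos (show (single 1 j s).type = 1 from rfl), countBelow_single, if_neg (not_lt.mpr hc.2),
          if_neg fun h => absurd h.2.2.1 (by simp [single])]
        simp
      linarith
    · linarith
  | largeTwoNegative S j n hj hs hdecl hfull hfit =>
    -- The bonus `m` for a type 2 container in a neutral bin pays for its first item.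
    have h1 : 0 ≤ gainContainer k v w m (single 2 j s) +
        if (single 2 j s).cls = k ∧ (single 2 j s).type = 2 then m else 0 := by
      by_cases hjk : (single 2 j s).cls = k
      · have h2 := neg_le_gainContainer_type_two (v := v) (w := w) hjk rfl hm
        rw [if_pos ⟨hjk, rfl⟩]
        rw [countBelow_single] at h2
        split_ifs at h2 <;> norm_num at h2 <;> linarith
      · rw [gainContainer_of_ne hjk, if_neg fun h => hjk h.1, add_zero]
    simp only [gain_cons, gainBin]
    split_ifs at h1 ⊢ <;> linarith
  | largeTwoTemp S j d hj hs hdecl hfull hnone hd hbest =>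
    obtain rfl : d.cls = j := hd.2.1
    simp only [gain_cons, gainBin]
    by_cases hdk : d.cls = k
    -- Again the largest temporary container is at least `v`, so its credit was already cancelled.
    -- The completed type 2 container has credit `m`, which pays for the new item.
    · obtain ⟨n, hn, hnk, hnv⟩ := hT
      have hn' : Bin.negative n ∈ S := (Multiset.mem_cons.mp hn).resolve_left (by simp)
      have htemp := (h.neg n (Multiset.mem_cons_of_mem hn')).2 (hnk ▸ hk)
      have hle := hbest n (Multiset.mem_cons_of_mem hn') (by rw [hdk, ← hnk]; exact htemp)
      rw [if_pos ⟨hdk, hnv.trans hle⟩]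
      have h1 := gainContainer_le_of_type_one (v := v) (w := w) hdk hd.2.2.1 hm
      have h2 := neg_le_gainContainer_type_two (v := v) (w := w) (c := d.toType2) hdk rfl hm
      have h3 : ((d.toType2.add s).countBelow v : ℚ) ≤ d.countBelow v + 1 := by
        exact_mod_cast countBelow_add_le d.toType2 s
      have h4 : d.items.card ≠ 0 := by
        have h4 := (hv d.toRegular (by simp)).of_large hj
        have h5 : d.toRegular.items.card = d.items.card := rfl
        omega
      rw [gainContainer_of_card (c := d.toType2.add s) hdk rfl
        (by simpa [Container.toType2, Container.add] using h4)]
      nlinarith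
    · rw [gainContainer_of_ne hdk, gainContainer_of_ne (c := d.toType2.add s) hdk,
        if_neg fun h => hdk h.1]
      linarith
  | largeTwoNew S j hj hs hdecl hfull hnone hnone' =>
    -- A new bin for a declared container, which would have no credit for its item, is used only if
    -- the class has no temporary container left; for class `k` this contradicts `hT`.
    have hjk : (single 2 j s).cls ≠ k := by
      rintro hjk
      have hjk : j = k := hjk
      subst hjk
      obtain ⟨n, hn, hnk, hnv⟩ := hT
      have hn' : Bin.negative n ∈ S := (Multiset.mem_cons.mp hn).resolve_left (by simp)
      have htemp := (h.neg n hn').2 (hnk ▸ hj)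
      exact hnone' n hn' (hnk ▸ htemp)
    simp only [gain_cons, gainBin, gainContainer_of_ne hjk]
    linarith

/-! ### Nonnegativity of the gain -/

theorem sum_map_ite_class (M : Multiset Container) (k : ℕ) (a b : ℚ) :
    (M.map fun c => if c.cls = k then (if c.type = 2 then b else a) else 0).sum
      = a * ((countClass M k : ℚ) - countType M 2 k) + b * countType M 2 k := by
  induction M using Multiset.induction with
  | empty => simp [countClass, countType]
  | cons c M ih =>
    rw [Multiset.map_cons, Multiset.sum_cons, ih, countClass_cons, countType_cons]
    by_cases h1 : c.cls = k <;> by_cases h2 : c.type = 2 <;> simp [h1, h2] <;> ring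

/-- A sum over the containers as a sum over the bins. -/
theorem sum_normal (S : Config) (f : Container → ℚ) (hf : ∀ c, f c.toRegular = f c) :
    (S.normal.map f).sum = (S.map fun B => (B.containers.map f).sum).sum := by
  rw [Config.normal, Multiset.map_map, Config.containers, Multiset.map_bind, Multiset.sum_bind]
  simp only [Function.comp_def, hf]

theorem countBelow_le_card (c : Container) : c.countBelow v ≤ c.items.card :=
  Multiset.countP_le_card _ _

/-- Without temporary type 1 containers of volume at least `v`, the gain is nonnegative. -/
theorem gain_nonneg_of_forall {I : List ℚ} {S : Config} (hk : IsLarge k) (h : Good I S.normal)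
    (hm : 0 ≤ m) (hmw : m ≤ w * (1 - α 2 k)) (hw : 0 ≤ w)
    (hT : ¬ ∃ n, Bin.negative n ∈ S ∧ n.cls = k ∧ v ≤ n.volume) : 0 ≤ gain k v w m S := by
  -- The worst case is that all items are below `v`. A type 2 container then contributes at least
  -- `-m`, whether declared or complete, and a type 1 container `w - m`. Since at most the
  -- proportion `α 2 k` has type 2, the total is at least `(w * (1 - α 2 k) - m)` times the number
  -- of containers.
  have h1 : ∀ c ∈ S.normal,
      (if c.cls = k then (if c.type = 2 then -m else w - m) else 0) ≤ gainContainer k v w m c := by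
    intro c hc
    by_cases hck : c.cls = k
    · have hle : (c.countBelow v : ℚ) ≤ c.items.card := by
        exact_mod_cast countBelow_le_card c
      rw [if_pos hck]
      rcases (h.valid c hc).of_large (hck ▸ hk) with ⟨h1, h2⟩ | ⟨h1, h2⟩
      · rw [if_neg (by omega), gainContainer, if_pos hck, if_pos h1, if_neg fun h => by
          have := h.2.2.1
          omega]
        rw [h2] at hle
        push_cast at hle
        nlinarith
      · rw [if_pos h1]
        rcases h2 with h2 | h2
        · have := neg_le_gainContainer_type_two (v := v) (w := w) hck h1 hm
          rw [h2] at hle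
          push_cast at hle
          nlinarith
        · rw [gainContainer_of_card hck h1 (by omega)]
          rw [h2] at hle
          push_cast at hle
          nlinarith
    · rw [if_neg hck, gainContainer_of_ne hck]
  have h2 := Multiset.sum_map_le_sum_map _ _ h1
  rw [sum_map_ite_class, sum_normal S _ fun c => rfl] at h2
  have h3 : (S.map fun B => (B.containers.map (gainContainer k v w m)).sum).sum
      ≤ gain k v w m S := by
    refine Multiset.sum_map_le_sum_map _ _ fun B hB => ?_
    cases B with
    | negative n =>
      have hn : ¬ (n.cls = k ∧ v ≤ n.volume) := fun h => hT ⟨n, hB, h⟩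
      simp [Bin.containers, gainBin, hn]
    | positive p => simp [Bin.containers, gainBin]
    | neutral n p =>
      simp only [Bin.containers, gainBin, Multiset.insert_eq_cons, Multiset.map_cons,
        Multiset.map_singleton, Multiset.sum_cons, Multiset.sum_singleton]
      split_ifs <;> linarith
  have h4 : (countType S.normal 2 k : ℚ) ≤ α 2 k * countClass S.normal k :=
    (Nat.cast_le.mpr (h.le_target k hk)).trans
      (Nat.floor_le (mul_nonneg hk.alpha_bounds.1.le (Nat.cast_nonneg _)))
  have h5 : m * (countClass S.normal k : ℚ) ≤ w * (1 - α 2 k) * countClass S.normal k :=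
    mul_le_mul_of_nonneg_right hmw (Nat.cast_nonneg _)
  have h6 := mul_le_mul_of_nonneg_left h4 hw
  linarith

/-- The threshold `v` is fixed throughout the run, and the case distinction is on the configuration
after the step. If it has no lone container of class `k` of volume at least `v`, the proportions
alone give the claim, regardless of the past; otherwise the step was monotone. -/
theorem Run.gain_nonneg {I : List ℚ} {S : Config} (h : Run I S) (hk : IsLarge k)
    (hm : 0 ≤ m) (hmw : m ≤ w * (1 - α 2 k)) (hw : 0 ≤ w) : 0 ≤ gain k v w m S := by
  induction h with
  | nil => simp [gain]
  | @snoc I s S S' h hs ih =>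
    by_cases hT : ∃ n, Bin.negative n ∈ S' ∧ n.cls = k ∧ v ≤ n.volume
    · refine ih.trans (gain_step hk h.separated h.good.valid hs hm (hmw.trans ?_) hT)
      have := mul_nonneg hw hk.alpha_bounds.1.le
      linarith
    · exact gain_nonneg_of_forall hk (h.snoc hs).good hm hmw hw hT

end gain

/-! ### Counting containers by classes -/

theorem mem_row_of_alpha_pos {i j : ℕ} (h : 0 < α i j) : i ∈ (row j).map Prod.fst := by
  have key : ∀ l : List (ℕ × ℚ), i ∉ l.map Prod.fst → l.lookup i = none := by
    intro l
    induction l with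
    | nil => simp
    | cons a l ih =>
      intro hl
      rw [List.map_cons, List.mem_cons, not_or] at hl
      have h1 : (i == a.1) = false := by simpa using hl.1
      rw [List.lookup, h1]
      exact ih hl.2
  by_contra hi
  rw [α, key _ hi] at h
  exact lt_irrefl _ h

/-- A sum over the containers of class `j` as a sum over the types. -/
theorem sum_map_class (M : Multiset Container) (j : ℕ) (l : List ℕ) (hl : l.Nodup)
    (hM : ∀ c ∈ M, c.cls = j → c.type ∈ l) (g : ℕ → ℚ) :
    (M.map fun c => if c.cls = j then g c.type else 0).sum
      = (l.map fun i => g i * countType M i j).sum := by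
  induction M using Multiset.induction with
  | empty => simp [countType]
  | cons c M ih =>
    have h1 : ∀ l : List ℕ, l.Nodup → (l.map fun i => g i * if c.type = i then 1 else 0).sum
        = if c.type ∈ l then g c.type else 0 := by
      intro l hl
      induction l with
      | nil => simp
      | cons a l ih =>
        rw [List.nodup_cons] at hl
        rw [List.map_cons, List.sum_cons, ih hl.2]
        by_cases ha : c.type = a
        · subst ha
          simp [hl.1]
        · simp [ha]
    rw [Multiset.map_cons, Multiset.sum_cons,
      ih fun c hc => hM c (Multiset.mem_cons_of_mem hc)]
    by_cases hc : c.cls = j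
    · have h2 := h1 l hl
      rw [if_pos (hM c (Multiset.mem_cons_self _ _) hc)] at h2
      rw [if_pos hc, ← h2, ← List.sum_map_add]
      refine congrArg List.sum (List.map_congr_left fun i _ => ?_)
      rw [countType_cons]
      by_cases hi : c.type = i
      · simp [hc, hi]
        ring
      · simp [hi]
    · rw [if_neg hc, zero_add]
      refine congrArg List.sum (List.map_congr_left fun i _ => ?_)
      rw [countType_cons, if_neg fun h => hc h.1, add_zero]

/-- If the numbers `x i` are at most `1` above given proportions of their sum `n`, then weighted
sums of the `x i` are essentially proportional. -/
theorem sum_mul_le (r : List (ℕ × ℚ)) (x u σ : ℕ → ℚ) (n b : ℚ) (hu : ∀ i, 0 ≤ u i)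
    (hr : ∀ p ∈ r, 0 ≤ p.2) (hsum : (r.map Prod.snd).sum = 1)
    (hn : (r.map fun p => x p.1).sum = n) (hx : ∀ p ∈ r, x p.1 ≤ p.2 * n + 1)
    (hb : ∀ p ∈ r, σ p.1 ≤ b) (hpos : 0 < (r.map fun p => p.2 * σ p.1).sum) :
    (r.map fun p => u p.1 * x p.1).sum ≤
      (r.map fun p => p.2 * u p.1).sum / (r.map fun p => p.2 * σ p.1).sum *
        ((r.map fun p => σ p.1 * x p.1).sum + (r.map fun p => b - σ p.1).sum) +
      (r.map fun p => u p.1).sum := by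
  have hsub : ∀ f g : ℕ × ℚ → ℚ,
      (r.map fun p => f p - g p).sum = (r.map f).sum - (r.map g).sum := by
    intro f g
    rw [eq_sub_iff_add_eq, ← List.sum_map_add]
    simp only [sub_add_cancel]
  have h1 : (r.map fun p => u p.1 * x p.1).sum
      ≤ (r.map fun p => p.2 * u p.1).sum * n + (r.map fun p => u p.1).sum := by
    rw [← List.sum_map_mul_right, ← List.sum_map_add]
    refine List.sum_le_sum fun p hp => ?_
    nlinarith [mul_le_mul_of_nonneg_left (hx p hp) (hu p.1)]
  -- Only upper bounds for the `x i` are known. Applied to the nonnegative coefficients `b - σ i`,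
  -- and since the `x i` have sum `n`, they become a lower bound for the weighted sum with
  -- coefficients `σ i`.
  have h2 : (r.map fun p => (b - σ p.1) * x p.1).sum
      ≤ (r.map fun p => p.2 * (b - σ p.1)).sum * n + (r.map fun p => b - σ p.1).sum := by
    rw [← List.sum_map_mul_right, ← List.sum_map_add]
    refine List.sum_le_sum fun p hp => ?_
    nlinarith [mul_le_mul_of_nonneg_left (hx p hp) (sub_nonneg.mpr (hb p hp))]
  have h3 : (r.map fun p => (b - σ p.1) * x p.1).sum
      = b * n - (r.map fun p => σ p.1 * x p.1).sum := by
    rw [← hn, ← List.sum_map_mul_left, ← hsub]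
    simp only [sub_mul]
  have h4 : (r.map fun p => p.2 * (b - σ p.1)).sum
      = b - (r.map fun p => p.2 * σ p.1).sum := by
    have : b = (r.map fun p => b * p.2).sum := by
      rw [List.sum_map_mul_left, hsum, mul_one]
    conv_rhs => rw [this]
    rw [← hsub]
    refine congrArg List.sum (List.map_congr_left fun p _ => ?_)
    ring
  rw [h3, h4] at h2
  have h5 : 0 ≤ (r.map fun p => p.2 * u p.1).sum := List.sum_nonneg fun y hy => by
    obtain ⟨p, hp, rfl⟩ := List.mem_map.mp hy
    exact mul_nonneg (hr p hp) (hu p.1)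
  have h6 : (r.map fun p => p.2 * u p.1).sum * n ≤
      (r.map fun p => p.2 * u p.1).sum / (r.map fun p => p.2 * σ p.1).sum *
        ((r.map fun p => σ p.1 * x p.1).sum + (r.map fun p => b - σ p.1).sum) := by
    rw [div_mul_eq_mul_div, mul_div_assoc]
    refine mul_le_mul_of_nonneg_left ?_ h5
    rw [le_div_iff₀ hpos]
    linarith
  linarith

/-- The part of a bin that is attributed to containers of class `j`. -/
def share (w : ℚ) (j : ℕ) : Bin → ℚ
  | .negative n => if n.cls = j then 1 else 0
  | .positive p => if p.cls = j then 1 else 0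
  | .neutral n p => (if n.cls = j then 1 - w else 0) + if p.cls = j then w else 0

/-- The total weight of the items in containers of class `j`. -/
def classSum (P : Params) (v : ℚ) (j : ℕ) (S : Config) : ℚ :=
  (S.normal.map fun c => if c.cls = j then (c.items.map (P.itemWeight v j)).sum else 0).sum

/-- The negative bins are above the threshold `v`, and the positive bins are above `1 - v`. -/
structure Threshold (P : Params) (v : ℚ) (S : Config) : Prop where
  lo : P.lo < v
  hi : v ≤ P.hi
  neg : ∀ n, Bin.negative n ∈ S → v ≤ n.volume
  pos : ∀ p, Bin.positive p ∈ S → 1 - v < p.volume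

theorem valid_of_mem {I : List ℚ} {S : Config} (h : Good I S.normal) {B : Bin} (hB : B ∈ S)
    {c : Container} (hc : c ∈ B.containers) : c.IsValid :=
  h.valid c.toRegular (Multiset.mem_map_of_mem _ (Multiset.mem_bind.mpr ⟨B, hB, hc⟩))

theorem Container.IsValid.volume_mem {c : Container} (h : c.IsValid) (hc : c.cls ≤ lastLarge)
    (h1 : c.type = 1) : ∃ s, c.items = {s} ∧ c.volume = s ∧ InClass s c.cls := by
  have hcard : c.items.card = 1 := by
    rcases h.2 with h | h | h
    · exact h.2.2
    · rcases h.2 with h | h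
      · exact h.2
      · omega
    · omega
  obtain ⟨s, hs⟩ := Multiset.card_eq_one.mp hcard
  refine ⟨s, hs, ?_, h.1 s (by simp [hs])⟩
  rw [volume_of_type_one hc h1, hs, Multiset.sum_singleton]

/-- The contribution of a negative container is bounded by the weight of its type. -/
theorem Params.typeWeight_of_neg (P : Params) {c : Container} (hc : c.IsValid)
    (hneg : c.IsNegative) :
    P.typeWeight c.type c.cls = 1 ∨ P.typeWeight c.type c.cls = 1 - P.w ∧ c.volume ≤ P.lo := by
  unfold Container.IsNegative at hneg
  unfold typeWeight
  by_cases h : c.cls ≤ lastLarge ∧ c.type = 1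
  · obtain ⟨s, hs, hv, hcl⟩ := hc.volume_mem h.1 h.2
    rw [if_pos h, hv]
    split_ifs with hlo
    · exact .inr ⟨rfl, hcl.2.trans hlo⟩
    · exact .inl rfl
  · have hv : c.volume = A c.type c.cls := if_neg h
    rw [if_neg h, hv]
    rw [hv] at hneg
    rw [if_pos hneg]
    split_ifs with hlo
    · exact .inr ⟨rfl, hlo⟩
    · exact .inl rfl

/-- Type 1 containers of large classes are never positive, so the volume is a fixed `A i j`. In the
second case it is at most `1 - v`, which rules out a positive bin. -/
theorem Params.typeWeight_of_pos (P : Params) {c : Container} (hc : c.IsValid)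
    (hcls : c.cls ≠ 1) (hpos : c.IsPositive) :
    P.typeWeight c.type c.cls = 1 ∨
      P.typeWeight c.type c.cls = P.w ∧ c.volume ≤ 1 - P.hi := by
  unfold Container.IsPositive at hpos
  unfold typeWeight
  by_cases h : c.cls ≤ lastLarge ∧ c.type = 1
  · obtain ⟨s, hs, hv, hcl⟩ := hc.volume_mem h.1 h.2
    have := hcl.le_half ⟨by have := hcl.one_le; omega, h.1⟩
    rw [hv] at hpos
    exact absurd hpos (not_lt.mpr this)
  · have hv : c.volume = A c.type c.cls := if_neg h
    rw [if_neg h, hv]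
    rw [hv] at hpos
    rw [if_neg (not_le.mpr hpos)]
    split_ifs with hlo
    · exact .inr ⟨rfl, hlo⟩
    · exact .inl rfl

theorem Params.Valid.typeWeight_bounds {P : Params} (hP : P.Valid) (i j : ℕ) :
    0 ≤ P.typeWeight i j ∧ P.typeWeight i j ≤ 1 := by
  have h1 := hP.w_nonneg
  have h2 := hP.w_le
  unfold typeWeight
  split_ifs <;> constructor <;> linarith

/-- A lone container receives a whole unit, and the threshold guarantees that its type has weight
`1`: a negative one has volume at least `v > lo`, a positive one more than `1 - v ≥ 1 - hi`. In a
neutral bin the share `1 - w` or `w` is the smallest value the type weight can take. -/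
theorem share_le_typeWeight {P : Params} (hP : P.Valid) {v : ℚ} {I : List ℚ} {S : Config}
    (hS : Run I S) (hv : Threshold P v S) {j : ℕ} (hj : j ≠ 1) {B : Bin} (hB : B ∈ S) :
    share P.w j B ≤ (B.containers.map fun c => if c.cls = j then P.typeWeight c.type j else 0).sum := by
  have hw := hP.w_nonneg
  have hsep := hS.separated
  have hval : ∀ c ∈ B.containers, c.IsValid := fun c hc => valid_of_mem hS.good hB hc
  have hlo := hv.lo
  have hhi := hv.hi
  cases B with
  | negative n =>
    simp only [share, Bin.containers, Multiset.map_singleton, Multiset.sum_singleton]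
    split_ifs with h
    · subst h
      rcases P.typeWeight_of_neg (hval n (by simp [Bin.containers])) (hsep.neg n hB).1
        with h | h
      · exact h.ge
      · have := hv.neg n hB
        linarith [h.2]
    · exact le_rfl
  | positive p =>
    simp only [share, Bin.containers, Multiset.map_singleton, Multiset.sum_singleton]
    split_ifs with h
    · subst h
      rcases P.typeWeight_of_pos (hval p (by simp [Bin.containers])) hj (hsep.pos p hB)
        with h | h
      · exact h.ge
      · have := hv.pos p hB
        linarith [h.2]
    · exact le_rfl
  | neutral n p =>
    simp only [share, Bin.containers, Multiset.insert_eq_cons, Multiset.map_cons,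
      Multiset.map_singleton, Multiset.sum_cons, Multiset.sum_singleton]
    refine add_le_add ?_ ?_
    · split_ifs with h
      · subst h
        rcases P.typeWeight_of_neg (hval n (by simp [Bin.containers])) (hsep.neutral n p hB).1
          with h | h
        · rw [h]
          linarith
        · exact h.1.ge
      · exact le_rfl
    · split_ifs with h
      · subst h
        rcases P.typeWeight_of_pos (hval p (by simp [Bin.containers])) hj (hsep.neutral n p hB).2
          with h | h
        · rw [h]
          exact hP.w_le
        · exact h.1.ge
      · exact le_rfl

theorem sum_share_le_typeWeight {P : Params} (hP : P.Valid) {v : ℚ} {I : List ℚ} {S : Config}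
    (hS : Run I S) (hv : Threshold P v S) {j : ℕ} (hj : j ≠ 1) :
    (S.map (share P.w j)).sum ≤
      (S.normal.map fun c => if c.cls = j then P.typeWeight c.type j else 0).sum := by
  rw [sum_normal S _ fun c => rfl]
  exact Multiset.sum_map_le_sum_map _ _ fun B hB => share_le_typeWeight hP hS hv hj hB

/-! ### Shares of the bins compared with weights of the items -/

/-! ### The bound for each class -/

/-- No additive error occurs: a huge item alone in its bin is larger than `1 - v` and so has weight
`1`, while in a neutral bin it receives only `w`, which is at most its weight. -/
theorem sum_share_huge_le {P : Params} (hP : P.Valid) {v : ℚ} {I : List ℚ} {S : Config}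
    (hS : Run I S) (hv : Threshold P v S) : (S.map (share P.w 1)).sum ≤ classSum P v 1 S := by
  rw [classSum, sum_normal S _ fun c => rfl]
  refine Multiset.sum_map_le_sum_map _ _ fun B hB => ?_
  have hsep := hS.separated
  have hval : ∀ c ∈ B.containers, c.cls = 1 →
      ∃ s, c.items = {s} ∧ c.volume = s ∧ 1 / 2 < c.volume := by
    intro c hc h1
    have h2 := valid_of_mem hS.good hB hc
    have h3 : c.type = 1 := by
      rcases h2.2 with h | h | h
      · exact h.2.1
      · exact absurd h1 h.1.ne_one
      · exact absurd h.1 (by rw [h1]; decide)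
    obtain ⟨s, hs, hv, hcl⟩ := h2.volume_mem (by rw [h1]; decide) h3
    refine ⟨s, hs, hv, ?_⟩
    rw [hv, ← t_one, ← h1]
    exact hcl.1
  have hneg : ∀ c ∈ B.containers, c.IsNegative → c.cls ≠ 1 := fun c hc hn h1 => by
    obtain ⟨s, -, -, h⟩ := hval c hc h1
    exact absurd hn (not_le.mpr h)
  have hw := hP.w_le
  cases B with
  | negative n =>
    have := hneg n (by simp [Bin.containers]) (hsep.neg n hB).1
    simp [share, Bin.containers, this]
  | positive p =>
    simp only [share, Bin.containers, Multiset.map_singleton, Multiset.sum_singleton]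
    split_ifs with h
    · obtain ⟨s, hs, hvol, -⟩ := hval p (by simp [Bin.containers]) h
      have := hv.pos p hB
      rw [hs, Multiset.map_singleton, Multiset.sum_singleton, Params.itemWeight, if_pos rfl,
        if_pos (hvol ▸ this)]
    · exact le_rfl
  | neutral n p =>
    have := hneg n (by simp [Bin.containers]) (hsep.neutral n p hB).1
    simp only [share, Bin.containers, Multiset.insert_eq_cons, Multiset.map_cons,
      Multiset.map_singleton, Multiset.sum_cons, Multiset.sum_singleton, if_neg this, zero_add]
    split_ifs with h
    · obtain ⟨s, hs, hvol, -⟩ := hval p (by simp [Bin.containers]) h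
      rw [hs, Multiset.map_singleton, Multiset.sum_singleton, Params.itemWeight, if_pos rfl]
      split_ifs
      · exact hw
      · exact le_rfl
    · exact le_rfl

/-- All containers of the class except for at most one open container are full up to `measure`, and
the numbers of the types exceed their proportions by at most one. So shares and measure are both
proportional to the number of containers, up to a constant. -/
theorem exists_sum_share_small_le {P : Params} (hP : P.Valid) {j : ℕ} (hj : lastLarge < j)
    (hj2 : j ≤ tinyClass) : ∃ C, ∀ (v : ℚ) (I : List ℚ) (S : Config), Run I S → Threshold P v S →
      (S.map (share P.w j)).sum ≤ classSum P v j S + C := by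
  obtain ⟨hr1, hr2, hr3⟩ := row_spec j hj hj2
  have hj1 : j ≠ 1 := by unfold lastLarge at hj; omega
  obtain ⟨b, hb0, hb⟩ : ∃ b, 0 ≤ b ∧ ∀ p ∈ row j, measure p.1 j ≤ b := by
    have : ∀ l : List (ℕ × ℚ), ∃ b, 0 ≤ b ∧ ∀ p ∈ l, measure p.1 j ≤ b := by
      intro l
      induction l with
      | nil => exact ⟨0, le_rfl, by simp⟩
      | cons a l ih =>
        obtain ⟨b, h0, h⟩ := ih
        refine ⟨max b (measure a.1 j), le_max_of_le_left h0, fun p hp => ?_⟩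
        rcases List.mem_cons.mp hp with rfl | hp
        · exact le_max_right _ _
        · exact le_max_of_le_left (h p hp)
    exact this _
  have hpos : 0 < ((row j).map fun p => p.2 * measure p.1 j).sum := by
    have : ∀ j ∈ List.range' 166 47, 0 < ((row j).map fun p => p.2 * measure p.1 j).sum := by
      decide +kernel
    unfold lastLarge at hj
    unfold tinyClass at hj2
    exact this j (List.mem_range'_1.mpr (by omega))
  -- The term `b` pays for the open container; the two sums are the rounding errors from
  -- `sum_mul_le`.
  refine ⟨P.classWeight j * (b + ((row j).map fun p => b - measure p.1 j).sum) +
    ((row j).map fun p => P.typeWeight p.1 j).sum, fun v I S hS hv => ?_⟩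
  have hgood := hS.good
  refine (sum_share_le_typeWeight hP hS hv hj1).trans ?_
  have htype : ∀ c ∈ S.normal, c.cls = j → c.type ∈ (row j).map Prod.fst := by
    intro c hc hcj
    rcases (hgood.valid c hc).2 with h | h | h
    · omega
    · have := h.1.2
      omega
    · exact mem_row_of_alpha_pos (hcj ▸ h.2.1)
  have hsum := fun g => sum_map_class S.normal j _ hr2 htype g
  simp only [List.map_map, Function.comp_def] at hsum
  have hn : ((row j).map fun p => (countType S.normal p.1 j : ℚ)).sum = countClass S.normal j := by
    have h1 := hsum fun _ => 1
    simp only [one_mul] at h1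
    rw [← h1]
    have := sum_map_ite_class S.normal j 1 1
    simp only [ite_self] at this
    rw [this]
    ring
  have h1 := sum_mul_le (row j) (fun i => countType S.normal i j) (fun i => P.typeWeight i j)
    (fun i => measure i j) (countClass S.normal j) b (fun i => (hP.typeWeight_bounds i j).1)
    (fun p hp => (hr3 p hp).2.le) hr1 hn (fun p hp => ?_) hb hpos
  · have h2 : ((row j).map fun p => measure p.1 j * (countType S.normal p.1 j : ℚ)).sum
        ≤ (S.normal.map fun c =>
            if c.cls = j then (c.items.map (itemMeasure j)).sum else 0).sum + b := by
      rw [← hsum fun i => measure i j]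
      have hopen : ((countOpen S.normal j : ℕ) : ℚ) ≤ 1 := by exact_mod_cast hgood.opened j
      classical
      have hcount : (S.normal.map fun c => if c.IsOpen j then b else 0).sum
          = b * countOpen S.normal j := by
        induction S.normal using Multiset.induction with
        | empty => simp [countOpen]
        | cons c M ih =>
          rw [Multiset.map_cons, Multiset.sum_cons, ih, countOpen_cons]
          by_cases ho : c.IsOpen j
          · simp [ho]
            ring
          · simp [ho]
      have h3 : (S.normal.map fun c => if c.cls = j then measure c.type j else 0).sum ≤
          (S.normal.map fun c => (if c.cls = j then (c.items.map (itemMeasure j)).sum else 0) +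
            if c.IsOpen j then b else 0).sum := by
        refine Multiset.sum_map_le_sum_map _ _ fun c hc => ?_
        by_cases hcj : c.cls = j
        · rw [if_pos hcj, if_pos hcj]
          have hpos : ∀ s ∈ c.items, 0 ≤ itemMeasure j s := fun s hs => by
            have := ((hgood.valid c hc).1 s hs).pos
            unfold itemMeasure
            split_ifs <;> linarith
          by_cases ho : c.IsOpen j
          · rw [if_pos ho]
            obtain ⟨p, hp, hpt⟩ := List.mem_map.mp (htype c hc hcj)
            have h4 : 0 ≤ (c.items.map (itemMeasure j)).sum :=
              Multiset.sum_nonneg fun y hy => by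
                obtain ⟨s, hs, rfl⟩ := Multiset.mem_map.mp hy
                exact hpos s hs
            have := hb p hp
            rw [hpt] at this
            linarith
          · rw [if_neg ho, add_zero]
            -- A tiny container that is no longer open has total size more than `A i j - t
            -- lastSmall`; in a small class the planned number of items is reached.
            have ho' := fun h => ho ⟨hj, hcj, h⟩
            unfold measure itemMeasure
            by_cases ht : j = tinyClass
            · simp only [ht, if_true] at ho' ⊢
              rw [Multiset.map_id']
              exact (not_le.mp ho').le
            · simp only [ht, if_false] at ho' ⊢
              rw [Multiset.map_const', Multiset.sum_replicate, nsmul_one]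
              exact_mod_cast not_lt.mp ho'
        · rw [if_neg hcj, if_neg hcj, if_neg fun h => hcj h.2.1, zero_add]
      rw [Multiset.sum_map_add, hcount] at h3
      nlinarith
    have h3 : classSum P v j S = P.classWeight j * (S.normal.map fun c =>
        if c.cls = j then (c.items.map (itemMeasure j)).sum else 0).sum := by
      rw [classSum, ← Multiset.sum_map_mul_left]
      refine congrArg Multiset.sum (Multiset.map_congr rfl fun c _ => ?_)
      rw [mul_ite, mul_zero, ← Multiset.sum_map_mul_left]
      have : ∀ s, P.itemWeight v j s = P.classWeight j * itemMeasure j s := fun s => by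
        rw [Params.itemWeight, if_neg hj1, if_neg (not_le.mpr hj)]
      simp only [this]
    have h4 : 0 ≤ P.classWeight j := div_nonneg (List.sum_nonneg fun y hy => by
      obtain ⟨p, hp, rfl⟩ := List.mem_map.mp hy
      exact mul_nonneg (hr3 p hp).2.le (hP.typeWeight_bounds _ _).1) hpos.le
    rw [hsum fun i => P.typeWeight i j, h3]
    refine h1.trans ?_
    change P.classWeight j * _ + _ ≤ _
    nlinarith [mul_le_mul_of_nonneg_left h2 h4]
  · have h2 := hgood.small p.1 j hj
    have h3 : ((⌊α p.1 j * countClass S.normal j⌋₊ : ℕ) : ℚ) ≤ p.2 * countClass S.normal j := by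
      rw [(hr3 p hp).1]
      exact Nat.floor_le (mul_nonneg (hr3 p hp).2.le (Nat.cast_nonneg _))
    have h4 : (countType S.normal p.1 j : ℚ) ≤ (⌊α p.1 j * countClass S.normal j⌋₊ : ℕ) + 1 := by
      exact_mod_cast h2
    linarith

/-- The number of items of a large class, in terms of the numbers of its containers. -/
theorem Good.le_sum_card {I : List ℚ} {M : Multiset Container} (h : Good I M) {k : ℕ}
    (hk : IsLarge k) : (countClass M k : ℚ) * (1 + α 2 k) ≤
      (M.map fun c => if c.cls = k then (c.items.card : ℚ) else 0).sum + 4 := by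
  classical
  -- Counting two items for each type 2 container is wrong by one exactly for the declared ones,
  -- whose number is bounded.
  have h1 : (M.map fun c => if c.cls = k then (if c.type = 2 then (2 : ℚ) else 1) else 0).sum ≤
      (M.map fun c => (if c.cls = k then (c.items.card : ℚ) else 0) +
        if c.IsDeclared k then 1 else 0).sum := by
    refine Multiset.sum_map_le_sum_map _ _ fun c hc => ?_
    by_cases hck : c.cls = k
    · rw [if_pos hck, if_pos hck]
      rcases (h.valid c hc).of_large (hck ▸ hk) with ⟨h1, h2⟩ | ⟨h1, h2 | h2⟩
      · rw [if_neg (by omega), h2]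
        split_ifs <;> norm_num
      · rw [if_pos h1, h2, if_pos ⟨hk, hck, h1, h2⟩]
        norm_num
      · rw [if_pos h1, h2]
        split_ifs <;> norm_num
    · rw [if_neg hck, if_neg hck, if_neg fun h => hck h.2.1, zero_add]
  have h2 : (M.map fun c => if c.IsDeclared k then (1 : ℚ) else 0).sum = countDeclared M k := by
    clear h1 h
    induction M using Multiset.induction with
    | empty => simp [countDeclared]
    | cons c M ih =>
      rw [Multiset.map_cons, Multiset.sum_cons, ih, countDeclared_cons]
      split_ifs <;> push_cast <;> ring
  rw [sum_map_ite_class, Multiset.sum_map_add, h2] at h1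
  have h3 : (countDeclared M k : ℚ) + target M k ≤ countType M 2 k + 2 := by
    exact_mod_cast h.declared k hk
  have h4 : (countType M 2 k : ℚ) ≤ target M k := by exact_mod_cast h.le_target k hk
  have h5 : (target M k : ℚ) ≤ countType M 2 k + 1 := by exact_mod_cast h.target_le k hk
  have h6 : α 2 k * countClass M k < target M k + 1 := Nat.lt_floor_add_one _
  linarith

theorem Good.countType_two_le {I : List ℚ} {M : Multiset Container} (h : Good I M) {k : ℕ}
    (hk : IsLarge k) : (countType M 2 k : ℚ) ≤ α 2 k * countClass M k ∧
      α 2 k * countClass M k ≤ countType M 2 k + 2 := by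
  have h4 : (countType M 2 k : ℚ) ≤ target M k := by exact_mod_cast h.le_target k hk
  have h5 : (target M k : ℚ) ≤ countType M 2 k + 1 := by exact_mod_cast h.target_le k hk
  have h6 : α 2 k * countClass M k < target M k + 1 := Nat.lt_floor_add_one _
  have h7 : (target M k : ℚ) ≤ α 2 k * countClass M k :=
    Nat.floor_le (mul_nonneg hk.alpha_bounds.1.le (Nat.cast_nonneg _))
  constructor <;> linarith

theorem IsLarge.measure_eq {j : ℕ} (hj : IsLarge j) (i : ℕ) : measure i j = i :=
  if_neg fun h => absurd hj.2 (by rw [h]; decide)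

theorem Params.classWeight_large (P : Params) {j : ℕ} (hj : IsLarge j) : P.classWeight j =
    ((1 - α 2 j) * P.typeWeight 1 j + α 2 j * P.typeWeight 2 j) / (1 + α 2 j) := by
  rw [classWeight, hj.sum_row fun i => P.typeWeight i j]
  simp only [hj.measure_eq]
  rw [hj.sum_row fun i => (i : ℚ)]
  congr 1
  push_cast
  ring

/-- Outside the group all items of the class have one weight, so it suffices to count containers and
items. The additive constant absorbs missing items, `4` at most, and the deviation of the number of
type 2 containers from its proportion. -/
theorem sum_share_large_le {P : Params} (hP : P.Valid) {j : ℕ} (hj : IsLarge j)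
    (hg : ¬ (P.k₁ ≤ j ∧ j ≤ P.k₂)) {v : ℚ} {I : List ℚ} {S : Config} (hS : Run I S)
    (hv : Threshold P v S) :
    (S.map (share P.w j)).sum ≤ classSum P v j S + (4 * P.classWeight j + 2) := by
  refine (sum_share_le_typeWeight hP hS hv hj.ne_one).trans ?_
  have hgood := hS.good
  have h1 : (S.normal.map fun c => if c.cls = j then P.typeWeight c.type j else 0) =
      S.normal.map fun c => if c.cls = j then
        (if c.type = 2 then P.typeWeight 2 j else P.typeWeight 1 j) else 0 := by
    refine Multiset.map_congr rfl fun c hc => ?_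
    by_cases hcj : c.cls = j
    · rw [if_pos hcj, if_pos hcj]
      rcases (hgood.valid c hc).of_large (hcj ▸ hj) with ⟨h1, -⟩ | ⟨h1, -⟩ <;> simp [h1]
    · rw [if_neg hcj, if_neg hcj]
  have h2 : classSum P v j S = P.classWeight j *
      (S.normal.map fun c => if c.cls = j then (c.items.card : ℚ) else 0).sum := by
    rw [classSum, ← Multiset.sum_map_mul_left]
    refine congrArg Multiset.sum (Multiset.map_congr rfl fun c _ => ?_)
    have : ∀ s, P.itemWeight v j s = P.classWeight j := fun s => by
      rw [Params.itemWeight, if_neg hj.ne_one, if_pos hj.2, Params.highWeight, Params.lowWeight,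
        if_neg hg, if_neg hg, ite_self]
    simp only [this, Multiset.map_const', Multiset.sum_replicate, nsmul_eq_mul]
    split_ifs <;> ring
  rw [h1, sum_map_ite_class, h2]
  obtain ⟨ha0, ha1⟩ := hj.alpha_bounds
  obtain ⟨hu0, hu1⟩ := hP.typeWeight_bounds 1 j
  obtain ⟨hw0, hw1⟩ := hP.typeWeight_bounds 2 j
  obtain ⟨h3, h4⟩ := hgood.countType_two_le hj
  have h5 := hgood.le_sum_card hj
  have hW := P.classWeight_large hj
  set n : ℚ := (countClass S.normal j : ℚ)
  set n₂ : ℚ := (countType S.normal 2 j : ℚ)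
  set X := (S.normal.map fun c => if c.cls = j then (c.items.card : ℚ) else 0).sum
  set u₁ := P.typeWeight 1 j
  set u₂ := P.typeWeight 2 j
  have h6 : 0 ≤ P.classWeight j := by
    rw [hW]
    exact div_nonneg (add_nonneg (mul_nonneg (by linarith) hu0) (mul_nonneg ha0.le hw0))
      (by linarith)
  have h7 : P.classWeight j * (1 + α 2 j) = (1 - α 2 j) * u₁ + α 2 j * u₂ := by
    rw [hW, div_mul_cancel₀]
    linarith
  have h8 := mul_le_mul_of_nonneg_left h5 h6
  have h9 : P.classWeight j * (n * (1 + α 2 j)) = ((1 - α 2 j) * u₁ + α 2 j * u₂) * n := by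
    rw [← h7]
    ring
  -- At most two type 2 containers are missing from the exact proportion, and each replacement of
  -- type 2 by type 1 costs at most `1`.
  have h10 : (u₁ - u₂) * (α 2 j * n - n₂) ≤ 1 * 2 :=
    (mul_le_mul_of_nonneg_right (show u₁ - u₂ ≤ 1 by linarith) (by linarith)).trans
      (mul_le_mul_of_nonneg_left (by linarith) zero_le_one)
  linarith

/-- The gain turns every share into an amount depending only on the type and the items. A lone type
1 container has share `1`, and its credit and penalty `w` cancel; in a neutral bin, share `1 - w`
and credit `w` add up to `1`. A type 2 container gets at most `1 + m` when alone, and at most `w + 2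
* m` in a neutral bin, where `m ≤ 1 - w` is needed. -/
theorem share_add_gainBin_le {P : Params} (hP : P.Valid) {k : ℕ} (hk : IsLarge k) {v : ℚ}
    {I : List ℚ} {S : Config} (hS : Run I S) (hv : Threshold P v S) {B : Bin} (hB : B ∈ S) :
    share P.w k B + gainBin k v P.w P.m B ≤ (B.containers.map fun c => if c.cls = k then
      (if c.type = 2 then 1 + P.m else 1) - P.m * c.countBelow v else 0).sum := by
  have hsep := hS.separated
  have hval : ∀ c ∈ B.containers, c.IsValid := fun c hc => valid_of_mem hS.good hB hc
  have hneg : ∀ c ∈ B.containers, c.cls = k → c.IsNegative → c.type = 1 := by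
    intro c hc hck hn
    rcases (hval c hc).of_large (hck ▸ hk) with h | h
    · exact h.1
    · exact absurd hn (not_le.mpr (Container.half_lt_volume (hck ▸ hk) h.1))
  have hpos : ∀ c ∈ B.containers, c.cls = k → c.IsPositive → c.type = 2 := by
    intro c hc hck hn
    rcases (hval c hc).of_large (hck ▸ hk) with h | h
    · obtain ⟨s, -, hs, hcl⟩ := (hval c hc).volume_mem (hck ▸ hk.2) h.1
      rw [Container.IsPositive, hs] at hn
      exact absurd hn (not_lt.mpr (hcl.le_half (hck ▸ hk)))
    · exact h.1
  have hg1 : ∀ c : Container, c.cls = k → c.type = 1 →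
      gainContainer k v P.w P.m c ≤ P.w - P.m * c.countBelow v := fun c hc h1 =>
    gainContainer_le_of_type_one hc h1 hP.m_nonneg
  have hg2 : ∀ c : Container, c.cls = k → c.type = 2 →
      gainContainer k v P.w P.m c ≤ P.m - P.m * c.countBelow v := by
    intro c hc h1
    have := hP.m_nonneg
    rw [gainContainer, if_pos hc, if_neg (by omega)]
    split_ifs <;> linarith
  have hm := hP.m_le
  cases B with
  | negative n =>
    simp only [share, gainBin, Bin.containers, Multiset.map_singleton, Multiset.sum_singleton]
    by_cases h : n.cls = k
    · have h1 := hneg n (by simp [Bin.containers]) h (hsep.neg n hB).1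
      rw [if_pos h, if_pos h, if_pos ⟨h, hv.neg n hB⟩, if_neg (by omega)]
      linarith [hg1 n h h1]
    · rw [if_neg h, if_neg h, if_neg fun h' => h h'.1, gainContainer_of_ne h]
      norm_num
  | positive p =>
    simp only [share, gainBin, Bin.containers, Multiset.map_singleton, Multiset.sum_singleton]
    by_cases h : p.cls = k
    · have h1 := hpos p (by simp [Bin.containers]) h (hsep.pos p hB)
      rw [if_pos h, if_pos h, if_pos h1]
      linarith [hg2 p h h1]
    · rw [if_neg h, if_neg h, gainContainer_of_ne h, add_zero]
  | neutral n p =>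
    simp only [share, gainBin, Bin.containers, Multiset.insert_eq_cons, Multiset.map_cons,
      Multiset.map_singleton, Multiset.sum_cons, Multiset.sum_singleton]
    have hn : (if n.cls = k then 1 - P.w else 0) + gainContainer k v P.w P.m n ≤
        if n.cls = k then (if n.type = 2 then 1 + P.m else 1) - P.m * n.countBelow v else 0 := by
      by_cases h : n.cls = k
      · have h1 := hneg n (by simp [Bin.containers]) h (hsep.neutral n p hB).1
        rw [if_pos h, if_pos h, if_neg (by omega)]
        linarith [hg1 n h h1]
      · rw [if_neg h, if_neg h, gainContainer_of_ne h, add_zero]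
    have hp : (if p.cls = k then P.w else 0) + gainContainer k v P.w P.m p +
        (if p.cls = k ∧ p.type = 2 then P.m else 0) ≤
        if p.cls = k then (if p.type = 2 then 1 + P.m else 1) - P.m * p.countBelow v else 0 := by
      by_cases h : p.cls = k
      · have h1 := hpos p (by simp [Bin.containers]) h (hsep.neutral n p hB).2
        rw [if_pos h, if_pos h, if_pos h1, if_pos ⟨h, h1⟩]
        linarith [hg2 p h h1]
      · rw [if_neg h, if_neg h, if_neg fun h' => h h'.1, gainContainer_of_ne h]
        norm_num
    linarith

/-- As the gain is nonnegative, the shares are at most the number of containers plus `m` for every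
type 2 container minus `m` for every item below `v`. With the proportion `α 2 j` and nearly `1 + α 2
j` items per container, this is `highWeight` per item, reduced by `m` below the threshold. -/
theorem sum_share_group_le {P : Params} (hP : P.Valid) {j : ℕ}
    (hg : P.k₁ ≤ j ∧ j ≤ P.k₂) {v : ℚ} {I : List ℚ} {S : Config} (hS : Run I S)
    (hv : Threshold P v S) :
    (S.map (share P.w j)).sum ≤ classSum P v j S + 4 * P.highWeight j := by
  obtain ⟨hj', hmw⟩ := hP.group j (List.mem_range'_1.mpr (by omega))
  have hj : IsLarge j := hj'
  have hgood := hS.good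
  obtain ⟨ha0, ha1⟩ := hj.alpha_bounds
  have hm := hP.m_nonneg
  have h1 := Multiset.sum_map_le_sum_map _ _ fun B hB => share_add_gainBin_le hP hj hS hv (B := B) hB
  rw [Multiset.sum_map_add, ← sum_normal S (fun c => if c.cls = j then
      (if c.type = 2 then 1 + P.m else 1) - P.m * c.countBelow v else 0) fun c => rfl] at h1
  have h2 : 0 ≤ (S.map (gainBin j v P.w P.m)).sum :=
    hS.gain_nonneg (v := v) hj hm hmw hP.w_nonneg
  have h3 : (S.normal.map fun c => if c.cls = j then
      (if c.type = 2 then 1 + P.m else 1) - P.m * c.countBelow v else 0).sum =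
      1 * ((countClass S.normal j : ℚ) - countType S.normal 2 j) +
        (1 + P.m) * countType S.normal 2 j -
      P.m * (S.normal.map fun c => if c.cls = j then (c.countBelow v : ℚ) else 0).sum := by
    rw [← sum_map_ite_class, ← Multiset.sum_map_mul_left, ← Multiset.sum_map_sub]
    refine congrArg Multiset.sum (Multiset.map_congr rfl fun c _ => ?_)
    by_cases h : c.cls = j <;> simp [h]
  have h4 : classSum P v j S =
      P.highWeight j * (S.normal.map fun c => if c.cls = j then (c.items.card : ℚ) else 0).sum -
      P.m * (S.normal.map fun c => if c.cls = j then (c.countBelow v : ℚ) else 0).sum := by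
    rw [classSum, ← Multiset.sum_map_mul_left, ← Multiset.sum_map_mul_left,
      ← Multiset.sum_map_sub]
    refine congrArg Multiset.sum (Multiset.map_congr rfl fun c _ => ?_)
    by_cases h : c.cls = j
    · rw [if_pos h, if_pos h, if_pos h, Container.countBelow]
      -- The two weights are defined so that they differ by exactly `m`; hence the total weight is
      -- linear in the number of items and the number of those below `v`.
      have hlow : P.lowWeight j = P.highWeight j - P.m := by
        rw [Params.lowWeight, Params.highWeight, if_pos hg, if_pos hg]
        field_simp
        ring
      induction c.items using Multiset.induction with
      | empty => simp
      | cons s M ih =>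
        rw [Multiset.map_cons, Multiset.sum_cons, ih, Params.itemWeight, if_neg hj.ne_one,
          if_pos hj.2, hlow, Multiset.card_cons, Multiset.countP_cons]
        rcases le_or_gt v s with hs | hs
        · rw [if_pos hs, if_neg (not_lt.mpr hs)]
          push_cast
          ring
        · rw [if_neg (not_le.mpr hs), if_pos hs]
          push_cast
          ring
    · rw [if_neg h, if_neg h, if_neg h]
      ring
  rw [h3] at h1
  rw [h4]
  obtain ⟨h5, -⟩ := hgood.countType_two_le hj
  have h6 := hgood.le_sum_card hj
  have h7 : P.highWeight j * (1 + α 2 j) = 1 + P.m * α 2 j := by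
    rw [Params.highWeight, if_pos hg, div_mul_cancel₀]
    linarith
  have h8 : 0 ≤ P.highWeight j := by
    rw [Params.highWeight, if_pos hg]
    exact div_nonneg (add_nonneg zero_le_one (mul_nonneg hm ha0.le)) (by linarith)
  have h9 := mul_le_mul_of_nonneg_left h6 h8
  have h10 : P.highWeight j * ((countClass S.normal j : ℚ) * (1 + α 2 j)) =
      (1 + P.m * α 2 j) * countClass S.normal j := by
    rw [← h7]
    ring
  have h11 := mul_le_mul_of_nonneg_left h5 hm
  linarith

theorem exists_sum_share_le {P : Params} (hP : P.Valid) {j : ℕ} (hj1 : 1 ≤ j)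
    (hj2 : j ≤ tinyClass) : ∃ C, ∀ (v : ℚ) (I : List ℚ) (S : Config), Run I S → Threshold P v S →
      (S.map (share P.w j)).sum ≤ classSum P v j S + C := by
  by_cases h1 : j = 1
  · subst h1
    exact ⟨0, fun v I S hS hv => by simpa using sum_share_huge_le hP hS hv⟩
  by_cases h2 : lastLarge < j
  · exact exists_sum_share_small_le hP h2 hj2
  have hj : IsLarge j := ⟨by omega, by omega⟩
  by_cases hg : P.k₁ ≤ j ∧ j ≤ P.k₂
  · exact ⟨_, fun v I S hS hv => sum_share_group_le hP hg hS hv⟩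
  · exact ⟨_, fun v I S hS hv => sum_share_large_le hP hj hg hS hv⟩

/-! ### The competitive ratio -/

theorem sum_multiset_sum {β : Type*} (J : Finset ℕ) (M : Multiset β) (f : ℕ → β → ℚ) :
    ∑ j ∈ J, (M.map (f j)).sum = (M.map fun x => ∑ j ∈ J, f j x).sum := by
  induction M using Multiset.induction with
  | empty => simp
  | cons x M ih => simp only [Multiset.map_cons, Multiset.sum_cons, Finset.sum_add_distrib, ih]

theorem Container.IsValid.cls_mem {c : Container} (h : c.IsValid) :
    c.cls ∈ Finset.Icc 1 tinyClass := by
  have h0 : c.items ≠ 0 := by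
    rw [← Multiset.card_pos]
    rcases h.2 with h | h | h <;> omega
  obtain ⟨s, hs⟩ := Multiset.exists_mem_of_ne_zero h0
  exact Finset.mem_Icc.mpr ⟨(h.1 s hs).one_le, (h.1 s hs).le_tiny⟩

/-- The number of bins is bounded by the total weight of the items, up to a constant. -/
theorem Params.Valid.exists_card_le {P : Params} (hP : P.Valid) :
    ∃ C, ∀ (v : ℚ) (I : List ℚ) (S : Config), Run I S → Threshold P v S →
      (S.card : ℚ) ≤ (I.map (P.weight v)).sum + C := by
  have hex : ∀ j : ℕ, ∃ C, j ∈ Finset.Icc 1 tinyClass → ∀ (v : ℚ) (I : List ℚ) (S : Config),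
      Run I S → Threshold P v S → (S.map (share P.w j)).sum ≤ classSum P v j S + C := by
    intro j
    by_cases hj : j ∈ Finset.Icc 1 tinyClass
    · obtain ⟨C, hC⟩ := exists_sum_share_le hP (Finset.mem_Icc.mp hj).1 (Finset.mem_Icc.mp hj).2
      exact ⟨C, fun _ => hC⟩
    · exact ⟨0, fun h => absurd h hj⟩
  choose C hC using hex
  refine ⟨∑ j ∈ Finset.Icc 1 tinyClass, C j, fun v I S hS hv => ?_⟩
  have hgood := hS.good
  -- The shares of a bin over all classes add up to `1`, since a container belongs to exactly one of
  -- the classes `1` to `212`.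
  have h1 : (S.card : ℚ) = ∑ j ∈ Finset.Icc 1 tinyClass, (S.map (share P.w j)).sum := by
    rw [sum_multiset_sum]
    have : ∀ B ∈ S, ∑ j ∈ Finset.Icc 1 tinyClass, share P.w j B = 1 := by
      intro B hB
      have hmem : ∀ c ∈ B.containers, c.cls ∈ Finset.Icc 1 tinyClass := fun c hc =>
        (valid_of_mem hgood hB hc).cls_mem
      cases B with
      | negative n => simp only [share, Finset.sum_ite_eq, hmem n (by simp [Bin.containers]), if_true]
      | positive p => simp only [share, Finset.sum_ite_eq, hmem p (by simp [Bin.containers]), if_true]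
      | neutral n p =>
        simp only [share, Finset.sum_add_distrib, Finset.sum_ite_eq,
          hmem n (by simp [Bin.containers]), hmem p (by simp [Bin.containers]), if_true]
        ring
    rw [Multiset.map_congr rfl this, Multiset.map_const', Multiset.sum_replicate, nsmul_one]
  have h2 : ∑ j ∈ Finset.Icc 1 tinyClass, classSum P v j S = (I.map (P.weight v)).sum := by
    have h3 : ∀ c ∈ S.normal, ∑ j ∈ Finset.Icc 1 tinyClass,
        (if c.cls = j then (c.items.map (P.itemWeight v j)).sum else 0)
          = (c.items.map (P.weight v)).sum := by
      intro c hc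
      have hval := hgood.valid c hc
      rw [Finset.sum_ite_eq, if_pos hval.cls_mem]
      refine congrArg Multiset.sum (Multiset.map_congr rfl fun s hs => ?_)
      rw [Params.weight, (hval.1 s hs).classOf_eq]
    have h4 : ((I : Multiset ℚ).map (P.weight v)).sum = (I.map (P.weight v)).sum := by
      rw [Multiset.map_coe, Multiset.sum_coe]
    simp only [classSum]
    rw [sum_multiset_sum, Multiset.map_congr rfl h3, ← h4, ← hgood.items]
    induction S.normal using Multiset.induction with
    | empty => simp
    | cons c M ih => simp [ih]
  rw [h1, ← h2, ← Finset.sum_add_distrib]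
  exact Finset.sum_le_sum fun j hj => hC j hj v I S hS hv

theorem A_pos {i j : ℕ} (hj : lastLarge < j) (h : 0 < α i j) (hj2 : j ≤ tinyClass) : 0 < A i j := by
  have h1 : ∀ j ∈ List.range' 166 47, ∀ p ∈ row j, 0 < A p.1 j := by decide +kernel
  obtain ⟨p, hp, rfl⟩ := List.mem_map.mp (mem_row_of_alpha_pos h)
  unfold lastLarge at hj
  unfold tinyClass at hj2
  exact h1 j (List.mem_range'_1.mpr (by omega)) p hp

/-- The smallest volume of a negative bin must be positive, because the intervals of `allParams`
cover only `(0, 1]`. -/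
theorem Container.IsValid.volume_pos {c : Container} (h : c.IsValid) : 0 < c.volume := by
  by_cases hc : c.cls ≤ lastLarge ∧ c.type = 1
  · obtain ⟨s, -, hs, hcl⟩ := h.volume_mem hc.1 hc.2
    exact hs ▸ hcl.pos
  · rcases h.2 with h' | h' | h'
    · exact absurd ⟨by rw [h'.1]; decide, h'.2.1⟩ hc
    · have : c.type = 2 := by
        rcases h'.2 with h | h
        · exact absurd ⟨h'.1.2, h.1⟩ hc
        · exact h.1
      have := Container.half_lt_volume h'.1 this
      linarith
    · rw [Container.volume_of_lt h'.1]
      exact A_pos h'.1 h'.2.1 (Finset.mem_Icc.mp h.cls_mem).2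

/-- Every final configuration has a threshold. -/
theorem Run.exists_threshold {I : List ℚ} {S : Config} (h : Run I S) :
    ∃ P ∈ allParams, ∃ v, Threshold P v S := by
  have hsep := h.separated
  by_cases hn : ∃ n, Bin.negative n ∈ S
  · have hfin : {n | Bin.negative n ∈ S}.Finite := by
      classical
      have hinj : Function.Injective Bin.negative := fun _ _ h => by injection h
      refine Set.Finite.subset (Set.Finite.preimage hinj.injOn S.toFinset.finite_toSet) ?_
      intro n hn
      simpa using hn
    obtain ⟨n, hn, hmin⟩ := Set.exists_min_image _ Container.volume hfin hn
    have hhalf : n.volume ≤ 1 / 2 := (hsep.neg n hn).1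
    obtain ⟨P, hP, h1, h2⟩ := exists_params n.volume
      (valid_of_mem h.good hn (by simp [Bin.containers])).volume_pos (by linarith)
    refine ⟨P, hP, n.volume, h1, h2, hmin, fun p hp => ?_⟩
    have := not_le.mp (hsep.apart n p hn hp)
    linarith
  -- Without negative bins, the threshold `1` requires of positive bins only a positive volume.
  · push Not at hn
    obtain ⟨P, hP, h1, h2⟩ := exists_params 1 one_pos le_rfl
    refine ⟨P, hP, 1, h1, h2, fun n h => absurd h (hn n), fun p hp => ?_⟩
    have : 1 / 2 < p.volume := hsep.pos p hp
    linarith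

/-! ### Comparison with an optimal packing -/

theorem packable_OPT (I : List ℚ) (hI : IsInput I) : Packable I (OPT I) := by
  refine Nat.sInf_mem (s := {m | Packable I m}) ⟨I.length, id, fun b => ?_⟩
  have : (Finset.univ.filter fun k => id k = b) = {b} := by
    ext k
    simp
  rw [this, Finset.sum_singleton]
  exact (hI _ (List.get_mem I b)).2

theorem Packable.sum_weight_le {I : List ℚ} {k : ℕ} (h : Packable I k) (hI : IsInput I)
    {P : Params} (hP : P.Valid) {v : ℚ} (hv : v ≤ P.hi) :
    (I.map (P.weight v)).sum ≤ ratio * k := by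
  obtain ⟨f, hf⟩ := h
  have h1 : (I.map (P.weight v)).sum = ∑ i : Fin I.length, P.weight v (I.get i) :=
    (Fin.sum_univ_fun_getElem I _).symm
  rw [h1, ← Finset.sum_fiberwise Finset.univ f]
  have h2 : ∀ b : Fin k, ∑ i with f i = b, P.weight v (I.get i) ≤ ratio := by
    intro b
    have h3 := P.sum_weight_le hP hv ((Finset.univ.filter fun i => f i = b).val.map I.get)
      (fun s hs => ?_) (hf b)
    · rwa [Multiset.map_map] at h3
    · obtain ⟨i, -, rfl⟩ := Multiset.mem_map.mp hs
      exact hI _ (List.get_mem I i)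
  refine (Finset.sum_le_sum fun b _ => h2 b).trans ?_
  rw [Finset.sum_const, Finset.card_univ, Fintype.card_fin, nsmul_eq_mul, mul_comm]

/-- The parameters depend on the final configuration, but there are only finitely many, so the
largest of their additive constants works for all inputs. -/
theorem exists_card_le_OPT : ∃ C : ℚ, 0 ≤ C ∧ ∀ (I : List ℚ) (S : Config),
    IsInput I → Run I S → (S.card : ℚ) ≤ ratio * OPT I + C := by
  have h1 : ∀ l : List Params, (∀ P ∈ l, P.Valid) → ∃ C : ℚ, 0 ≤ C ∧
      ∀ P ∈ l, ∀ (v : ℚ) (I : List ℚ) (S : Config), Run I S → Threshold P v S →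
        (S.card : ℚ) ≤ (I.map (P.weight v)).sum + C := by
    intro l
    induction l with
    | nil => exact fun _ => ⟨0, le_rfl, by simp⟩
    | cons P l ih =>
      intro hl
      obtain ⟨C, h0, hC⟩ := ih fun Q hQ => hl Q (List.mem_cons_of_mem _ hQ)
      obtain ⟨D, hD⟩ := (hl P List.mem_cons_self).exists_card_le
      refine ⟨max C D, le_max_of_le_left h0, fun Q hQ v I S hS hv => ?_⟩
      rcases List.mem_cons.mp hQ with rfl | hQ
      · linarith [hD v I S hS hv, le_max_right C D]
      · linarith [hC Q hQ v I S hS hv, le_max_left C D]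
  obtain ⟨C, h0, hC⟩ := h1 allParams valid_of_mem_allParams
  refine ⟨C, h0, fun I S hI hS => ?_⟩
  obtain ⟨P, hP, v, hv⟩ := hS.exists_threshold
  have h2 := hC P hP v I S hS hv
  have h3 := (packable_OPT I hI).sum_weight_le hI (valid_of_mem_allParams P hP) hv.hi
  linarith

theorem exists_real_card_le_OPT : ∃ C : ℝ, 0 ≤ C ∧ ∀ (I : List ℚ) (S : Config),
    IsInput I → Run I S →
      (S.card : ℝ) ≤ 10060574276093395247 / 6374352691333693440 * (OPT I : ℝ) + C := by
  obtain ⟨C, h0, hC⟩ := exists_card_le_OPT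
  refine ⟨C, by exact_mod_cast h0, fun I S hI hS => ?_⟩
  have h : ((S.card : ℚ) : ℝ) ≤ ((ratio * OPT I + C : ℚ) : ℝ) := Rat.cast_le.mpr (hC I S hI hS)
  unfold ratio at h
  push_cast at h
  exact h

end AdvancedHarmonic

theorem mainTheorem1 :
    (∃ C : ℝ, 0 ≤ C ∧ ∀ (I : List ℚ) (S : AdvancedHarmonic.Config),
      AdvancedHarmonic.IsInput I → AdvancedHarmonic.Run I S →
        (S.card : ℝ) ≤
          10060574276093395247 / 6374352691333693440 * (AdvancedHarmonic.OPT I : ℝ) + C) ∧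
    AdvancedHarmonic.asymptoticRatio ≤ ENNReal.ofReal 1.57828956 := by
  refine ⟨AdvancedHarmonic.exists_real_card_le_OPT, ?_⟩
  obtain ⟨C, h0, hC⟩ := AdvancedHarmonic.exists_real_card_le_OPT
  -- The bound `1.57828956` exceeds the exact ratio by at least `10 ^ (-9)`, so the additive
  -- constant is absorbed once the optimum is at least `C * 10 ^ 9`.
  obtain ⟨N, hN⟩ := exists_nat_ge (C * 10 ^ 9)
  refine Filter.limsup_le_of_le (h := ?_)
  filter_upwards [Filter.eventually_ge_atTop (max N 1)] with n hn
  refine iSup_le fun I => iSup_le fun S => iSup_le fun ⟨hI, hS, hopt⟩ => ?_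
  have h1 := hC I S hI hS
  have h2 : C * 10 ^ 9 ≤ AdvancedHarmonic.OPT I :=
    hN.trans (Nat.cast_le.mpr ((le_max_left N 1).trans (hn.trans hopt)))
  refine ENNReal.div_le_of_le_mul ?_
  rw [← ENNReal.ofReal_natCast, ← ENNReal.ofReal_natCast, ← ENNReal.ofReal_mul (by norm_num)]
  refine ENNReal.ofReal_le_ofReal (h1.trans ?_)
  norm_num at h2 ⊢
  linarith
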